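/- Let $\Omega_1=\operatorname{SL}(2,\mathbb C)/\operatorname{SL}(2,\mathbb Z[i])$, where the class of $M$ is identified with the lattice $M\mathbb Z[i]^2\subset\mathbb C^2$, and let $g_t=\operatorname{diag}(e^t,e^{-t})$ act on $\Omega_1$ by left multiplication. On $M_2(\mathbb C)\cong\mathbb C^4$ put $\omega_M(M_1,M_2,M_3)=\det(M,M_1,M_2,M_3)$, and let $\overline\omega$ be the pullback of $\omega$ under entrywise complex conjugation. Let $\alpha=-i\,\omega\wedge\overline\omega$, with the wedge product normalized so that $(dx_1\wedge\dots\wedge dx_6)(\partial_1,\dots,\partial_6)=1$. Let $T\subset\Omega_1$ be the set of lattices $\Lambda$ containing vectors $u=(u_1,u_2)$, $v=(v_1,v_2)$ with $|u_2|,|v_1|<|u_1|=|v_2|=r$ such that the only nonzero vectors of $\Lambda$ of sup norm at most $r$ are $\zeta u$ and $\zeta v$ with $\zeta\in\{\pm1,\pm i\}$. For $k=1,2$, let $T_k$ be the set of those $\Lambda\in T$ for which $\mathbb Z[i]u+\mathbb Z[i]v$ has index $k$ in $\Lambda$. For $\theta\in\mathbb R$ and $w_1,w_2$ in the open unit disk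 $\mathbb D$ put $$r=\frac{k^{1/4}}{\sqrt{|1-w_1w_2|}},\qquad u=r\,(e^{i\theta},\,e^{i\theta'}w_2),\qquad v=r\,(e^{i\theta}w_1,\,e^{i\theta'}),\qquad \theta'=(k-1)\tfrac{\pi}{4}-\theta-\arg(1-w_1w_2),$$ $$\Psi_1(\theta,w_1,w_2)=\mathbb Z[i]u+\mathbb Z[i]v,\qquad \Psi_2(\theta,w_1,w_2)=\mathbb Z[i]u+\tfrac1{1+i}\mathbb Z[i](u+v).$$ Let $D_k$ be the set of $(\theta,w_1,w_2)\in[0,\frac{\pi}{2})\times\mathbb D^2$ such that $\Psi_k(\theta,w_1,w_2)\in T_k$ and the only vector of $\Psi_k(\theta,w_1,w_2)$ in the interior of the cylinder $\{(z_1,z_2):|z_1|\le\max(|u_1|,|v_1|),\ |z_2|\le\max(|u_2|,|v_2|)\}$ is $0$. Then the following hold. 1. There is exactly one measure $\mu_1$ on $\operatorname{SL}(2,\mathbb C)$ associated with the volume form $\alpha$ (in every smooth local parametrization it is the integral of the absolute value of the coefficient of $\alpha$), and it is a Haar measure. It induces exactly one measure $m$ on $\Omega_1$, namely the image of the restriction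 of $\mu_1$ to any fundamental domain. 2. There is exactly one Borel measure $\nu$ carried by $T$ that is induced by $m$ and the flow, that is, such that $m(\{g_tx: 0\le t<\varepsilon,\ x\in A\})=\varepsilon\,\nu(A)$ for all Borel sets $A\subset T$ and all $\varepsilon>0$ for which $(t,x)\mapsto g_tx$ is injective on $[0,\varepsilon)\times A$. 3. $T$ is the disjoint union of $T_1$ and $T_2$. For $k=1,2$, $\Psi_k$ maps $D_k$ bijectively onto $T_k$, and in the coordinates $(\theta,w_1,w_2)\in D_k$ the measure $\nu$ has the density $$h(\theta,w_1,w_2)=\frac{32}{|1-w_1w_2|^4}$$ with respect to Lebesgue measure: $\nu(\Psi_k(E))=\int_E h\,d\theta\,dw_1\,dw_2$ for all Borel sets $E\subset D_k$, where $dw_j$ is Lebesgue measure on $\mathbb C$. -/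

import Mathlib

open MeasureTheory Set
open scoped ContDiff ENNReal

noncomputable section

namespace GaussLattice

/-- The real Lie group `SL(2, ℂ)`. -/
abbrev SL2C : Type := Matrix.SpecialLinearGroup (Fin 2) ℂ

/-- Borel sets of `SL(2, ℂ)`, for the topology induced from `M₂(ℂ)`. -/
instance instMeasurableSpaceSL2C : MeasurableSpace SL2C := borel SL2C

instance instBorelSpaceSL2C : BorelSpace SL2C := ⟨rfl⟩

/-- `SL(2, ℤ[i])` as a subgroup of `SL(2, ℂ)`. -/
def SL2Zi : Subgroup SL2C :=
  (Matrix.SpecialLinearGroup.map (n := Fin 2) GaussianInt.toComplex).range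

/-- The space `Ω₁ = SL(2, ℂ) / SL(2, ℤ[i])` of unimodular Gauss lattices in `ℂ²`, with the
quotient topology and the quotient measurable structure (a set is measurable when its preimage
in `SL(2, ℂ)` is Borel). -/
abbrev LatticeSpace : Type := SL2C ⧸ SL2Zi

/-! ### The volume form and the Haar measure -/

/-- The identification of `M₂(ℂ)` with `ℂ⁴`. -/
def vec4 (M : Fin 2 → Fin 2 → ℂ) : Fin 4 → ℂ := ![M 0 0, M 0 1, M 1 0, M 1 1]

/-- The complex 3-form `ω_M (M₁, M₂, M₃) = det (M, M₁, M₂, M₃)` on `M₂(ℂ)`. -/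
def omega (M : Fin 2 → Fin 2 → ℂ) (v : Fin 3 → Fin 2 → Fin 2 → ℂ) : ℂ :=
  Matrix.det (Matrix.of ![vec4 M, vec4 (v 0), vec4 (v 1), vec4 (v 2)])

/-- The conjugate form: the pullback of `ω` under entrywise complex conjugation. -/
def omegaBar (M : Fin 2 → Fin 2 → ℂ) (v : Fin 3 → Fin 2 → Fin 2 → ℂ) : ℂ :=
  omega (fun a b => star (M a b)) (fun j a b => star (v j a b))

/-- The wedge product of two alternating 3-forms, normalised so that
`(dx₁ ∧ ⋯ ∧ dx₆) (∂₁, …, ∂₆) = 1`: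
`(η ∧ ζ) (v₀, …, v₅) = 1 / (3! 3!) ∑_σ sign σ • η (v_σ0, v_σ1, v_σ2) ζ (v_σ3, v_σ4, v_σ5)`. -/
def wedge33 {V : Type*} (η ζ : (Fin 3 → V) → ℂ) (v : Fin 6 → V) : ℂ :=
  (1 / 36 : ℂ) * ∑ σ : Equiv.Perm (Fin 6), ((Equiv.Perm.sign σ : ℤ) : ℂ) *
    (η ![v (σ 0), v (σ 1), v (σ 2)] * ζ ![v (σ 3), v (σ 4), v (σ 5)])

/-- The 6-form `α = -i ω ∧ ω̄`. -/
def alpha (M : Fin 2 → Fin 2 → ℂ) (v : Fin 6 → Fin 2 → Fin 2 → ℂ) : ℂ :=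
  -Complex.I * wedge33 (omega M) (omegaBar M) v

/-- The entries of an element of `SL(2, ℂ)`, as a point of the vector space `M₂(ℂ)`. -/
def entries (g : SL2C) : Fin 2 → Fin 2 → ℂ := fun a b => (g : Matrix (Fin 2) (Fin 2) ℂ) a b

/-- `φ`, restricted to the open set `U ⊆ ℝ⁶`, is a smooth local parametrization of the
6-dimensional real manifold `SL(2, ℂ)`: an injective smooth immersion. -/
structure IsLocalParam (U : Set (Fin 6 → ℝ)) (φ : (Fin 6 → ℝ) → SL2C) : Prop where
  isOpen : IsOpen U
  smooth : ContDiffOn ℝ ∞ (fun x => entries (φ x)) U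
  injOn : InjOn φ U
  immersion : ∀ x ∈ U, Function.Injective (fderiv ℝ (fun y => entries (φ y)) x)

/-- `μ` is the measure on `SL(2, ℂ)` associated with the volume form `α`: in every smooth local
parametrization, it is given by integrating the absolute value of the coefficient of `α`. -/
def IsVolumeFormMeasure (μ : Measure SL2C) : Prop :=
  ∀ (U : Set (Fin 6 → ℝ)) (φ : (Fin 6 → ℝ) → SL2C), IsLocalParam U φ →
    ∀ E ⊆ U, MeasurableSet E →
      μ (φ '' E) = ∫⁻ x in E,
        ‖alpha (entries (φ x))
          (fun i => fderiv ℝ (fun y => entries (φ y)) x (Pi.single i 1))‖ₑ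

/-- `m` is the measure induced on `SL(2, ℂ) / SL(2, ℤ[i])` by the measure `μ` on `SL(2, ℂ)`: the
image of the restriction of `μ` to any fundamental domain of `SL(2, ℤ[i])` acting on the right. -/
def IsQuotientMeasure (μ : Measure SL2C) (m : Measure LatticeSpace) : Prop :=
  @QuotientMeasureEqMeasurePreimage SL2Zi.op SL2C _ _ _ μ m

/-! ### The flow and the lattices -/

/-- `g_t = diag (e^t, e^{-t})`. -/
def diagFlow (t : ℝ) : SL2C :=
  ⟨!![(Real.exp t : ℂ), 0; 0, (Real.exp (-t) : ℂ)], by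
    rw [Matrix.det_fin_two_of, ← Complex.ofReal_mul, ← Real.exp_add]; simp⟩

/-- The subgroup `M ℤ[i]² = {M z : z ∈ ℤ[i]²}` of `ℂ²`. -/
def gaussSpan (M : Matrix (Fin 2) (Fin 2) ℂ) : AddSubgroup (Fin 2 → ℂ) :=
  ((Matrix.mulVecLin M).toAddMonoidHom.comp
    (GaussianInt.toComplex.toAddMonoidHom.compLeft (Fin 2))).range

/-- The matrix with columns `u` and `v`. -/
def cols (u v : Fin 2 → ℂ) : Matrix (Fin 2) (Fin 2) ℂ := !![u 0, v 0; u 1, v 1]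

theorem gaussSpan_mul_le (M : Matrix (Fin 2) (Fin 2) ℂ) {γ : SL2C} (hγ : γ ∈ SL2Zi) :
    gaussSpan (M * (γ : Matrix (Fin 2) (Fin 2) ℂ)) ≤ gaussSpan M := by
  obtain ⟨δ, rfl⟩ := hγ
  rintro _ ⟨z, rfl⟩
  refine ⟨(δ : Matrix (Fin 2) (Fin 2) GaussianInt).mulVec z, ?_⟩
  have h : (fun i => GaussianInt.toComplex
      ((δ : Matrix (Fin 2) (Fin 2) GaussianInt).mulVec z i)) =
      ((δ : Matrix (Fin 2) (Fin 2) GaussianInt).map GaussianInt.toComplex).mulVec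
        (fun i => GaussianInt.toComplex (z i)) := by
    funext i
    exact RingHom.map_mulVec GaussianInt.toComplex _ z i
  change M.mulVec (fun i => GaussianInt.toComplex _) = (M * _).mulVec
    (fun i => GaussianInt.toComplex (z i))
  rw [h, Matrix.mulVec_mulVec]
  rfl

/-- The lattice `M ℤ[i]²` attached to the class `M SL(2, ℤ[i])`. -/
def lattice (x : LatticeSpace) : AddSubgroup (Fin 2 → ℂ) :=
  Quotient.liftOn' x (fun M : SL2C => gaussSpan (M : Matrix (Fin 2) (Fin 2) ℂ)) (by
    intro M N h
    have h1 : M⁻¹ * N ∈ SL2Zi := QuotientGroup.leftRel_apply.mp h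
    have h2 : N⁻¹ * M ∈ SL2Zi := by
      have := SL2Zi.inv_mem h1
      rwa [mul_inv_rev, inv_inv] at this
    apply le_antisymm
    · have := gaussSpan_mul_le (N : Matrix (Fin 2) (Fin 2) ℂ) h2
      rwa [← Matrix.SpecialLinearGroup.coe_mul, mul_inv_cancel_left] at this
    · have := gaussSpan_mul_le (M : Matrix (Fin 2) (Fin 2) ℂ) h1
      rwa [← Matrix.SpecialLinearGroup.coe_mul, mul_inv_cancel_left] at this)

/-- The cylinder `C(u, v)`. -/
def cylinder (u v : Fin 2 → ℂ) : Set (Fin 2 → ℂ) :=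
  {z | ‖z 0‖ ≤ max ‖u 0‖ ‖v 0‖ ∧ ‖z 1‖ ≤ max ‖u 1‖ ‖v 1‖}

/-! ### The transversal -/

/-- `u` and `v` are vectors of the lattice `x` with `|u₂|, |v₁| < |u₁| = |v₂| = r`, such that the
only nonzero vectors of the lattice of sup norm at most `r` are the multiples of `u` and of `v`
by fourth roots of unity. (The norm of `Fin 2 → ℂ` is the sup norm.) -/
structure IsAssociated (x : LatticeSpace) (u v : Fin 2 → ℂ) : Prop where
  left_mem : u ∈ lattice x
  right_mem : v ∈ lattice x
  norm_eq : ‖u 0‖ = ‖v 1‖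
  left_lt : ‖u 1‖ < ‖u 0‖
  right_lt : ‖v 0‖ < ‖u 0‖
  only : ∀ y ∈ lattice x, y ≠ 0 → ‖y‖ ≤ ‖u 0‖ →
    ∃ ζ : ℂ, ζ ^ 4 = 1 ∧ (y = ζ • u ∨ y = ζ • v)

/-- The open transversal `T`. -/
def transversal : Set LatticeSpace := {x | ∃ u v, IsAssociated x u v}

/-- The piece `T_k` of the transversal (`k = 1, 2`): the associated vectors span over `ℤ[i]` a
sublattice of index `k`. -/
def transversalPiece (k : ℕ) : Set LatticeSpace :=
  {x | ∃ u v, IsAssociated x u v ∧ (gaussSpan (cols u v)).relIndex (lattice x) = k}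

/-- `ν` is the measure induced on the transversal `T` by the measure `m` and the flow `g_t`: `ν`
lives on `T`, and `m` is the product `dt ⊗ ν` in flow boxes, i.e. if the points `g_t x`,
`0 ≤ t < ε`, `x ∈ A`, are pairwise distinct, then the set of these points has measure
`ε ν(A)`. -/
structure IsInducedMeasure (m ν : Measure LatticeSpace) : Prop where
  null_compl : ν transversalᶜ = 0
  flow_box : ∀ A ⊆ transversal, MeasurableSet A → ∀ ε : ℝ, 0 < ε →
    InjOn (fun q : ℝ × LatticeSpace => diagFlow q.1 • q.2) (Ico 0 ε ×ˢ A) →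
    m ((fun q : ℝ × LatticeSpace => diagFlow q.1 • q.2) '' (Ico 0 ε ×ˢ A)) =
      ENNReal.ofReal ε * ν A

/-! ### The parametrizations. A triple `(θ, w₁, w₂)` is an element `p` of `ℝ × ℂ × ℂ`. -/

/-- `r = k^{1/4} / √|1 - w₁ w₂|`. -/
def rad (k : ℕ) (p : ℝ × ℂ × ℂ) : ℝ :=
  (k : ℝ) ^ (1 / 4 : ℝ) / √‖1 - p.2.1 * p.2.2‖

/-- `u₁ = exp (i θ)`. -/
def uCoord (p : ℝ × ℂ × ℂ) : ℂ := Complex.exp (Complex.I * p.1)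

/-- `v₂ = exp (i ((k - 1) π / 4 - θ - arg (1 - w₁ w₂)))`. -/
def vCoord (k : ℕ) (p : ℝ × ℂ × ℂ) : ℂ :=
  Complex.exp (Complex.I *
    ((((k : ℝ) - 1) * (Real.pi / 4) - p.1 - Complex.arg (1 - p.2.1 * p.2.2) : ℝ) : ℂ))

/-- `u = r (u₁, v₂ w₂)`. -/
def uVec (k : ℕ) (p : ℝ × ℂ × ℂ) : Fin 2 → ℂ :=
  ![rad k p * uCoord p, rad k p * (vCoord k p * p.2.2)]

/-- `v = r (u₁ w₁, v₂)`. -/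
def vVec (k : ℕ) (p : ℝ × ℂ × ℂ) : Fin 2 → ℂ :=
  ![rad k p * (uCoord p * p.2.1), rad k p * vCoord k p]

/-- The columns of this matrix are the `ℤ[i]`-basis of the lattice `Ψ_k(θ, w₁, w₂)`: it is
`(u, v)` for `k = 1` and `(u, (u + v) / (1 + i))` for `k = 2`. -/
def psiMatrix (k : ℕ) (p : ℝ × ℂ × ℂ) : Matrix (Fin 2) (Fin 2) ℂ :=
  if k = 2 then cols (uVec k p) ((1 / (1 + Complex.I) : ℂ) • (uVec k p + vVec k p))
  else cols (uVec k p) (vVec k p)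

theorem det_cols_uVec_vVec (k : ℕ) (p : ℝ × ℂ × ℂ) (h : p.2.1 * p.2.2 ≠ 1) :
    (cols (uVec k p) (vVec k p)).det =
      ((√(k : ℝ) : ℝ) : ℂ) * Complex.exp (Complex.I * ((((k : ℝ) - 1) * (Real.pi / 4) : ℝ) : ℂ)) := by
  have hz : 1 - p.2.1 * p.2.2 ≠ 0 := sub_ne_zero.mpr (Ne.symm h)
  have hn : ‖1 - p.2.1 * p.2.2‖ ≠ 0 := norm_ne_zero_iff.mpr hz
  have hr : rad k p ^ 2 * ‖1 - p.2.1 * p.2.2‖ = √(k : ℝ) := by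
    unfold rad
    rw [div_pow, Real.sq_sqrt (norm_nonneg _), div_mul_cancel₀ _ hn, ← Real.rpow_natCast,
      ← Real.rpow_mul (Nat.cast_nonneg k), Real.sqrt_eq_rpow]
    norm_num
  have he : uCoord p * vCoord k p *
      Complex.exp (Complex.arg (1 - p.2.1 * p.2.2) * Complex.I) =
      Complex.exp (Complex.I * ((((k : ℝ) - 1) * (Real.pi / 4) : ℝ) : ℂ)) := by
    unfold uCoord vCoord
    rw [← Complex.exp_add, ← Complex.exp_add]
    congr 1
    push_cast
    ring
  have hp := Complex.norm_mul_exp_arg_mul_I (1 - p.2.1 * p.2.2)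
  rw [← hr, ← he, cols, Matrix.det_fin_two_of]
  simp only [uVec, vVec, Matrix.cons_val_zero, Matrix.cons_val_one]
  push_cast
  linear_combination (-(rad k p : ℂ) ^ 2 * uCoord p * vCoord k p) * hp

theorem det_psiMatrix {k : ℕ} (hk : k = 1 ∨ k = 2) (p : ℝ × ℂ × ℂ) (h : p.2.1 * p.2.2 ≠ 1) :
    (psiMatrix k p).det = 1 := by
  have hd := det_cols_uVec_vVec k p h
  rcases hk with rfl | rfl
  · simpa [psiMatrix] using hd
  · have h1 : (1 + Complex.I : ℂ) ≠ 0 := by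
      intro hh
      have := congrArg Complex.re hh
      simp at this
    have h2 : (((√((2 : ℕ) : ℝ) : ℝ) : ℂ)) *
        Complex.exp (Complex.I * (((((2 : ℕ) : ℝ) - 1) * (Real.pi / 4) : ℝ) : ℂ)) =
        1 + Complex.I := by
      have e : ((((2 : ℕ) : ℝ) - 1) * (Real.pi / 4)) = Real.pi / 4 := by norm_num
      rw [e, mul_comm Complex.I, Complex.exp_mul_I, ← Complex.ofReal_cos, ← Complex.ofReal_sin,
        Real.cos_pi_div_four, Real.sin_pi_div_four]
      have hs : (((√(2 : ℝ) : ℝ) : ℂ)) * ((√(2 : ℝ) : ℝ) : ℂ) = 2 := by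
        rw [← Complex.ofReal_mul, Real.mul_self_sqrt (by norm_num)]; norm_num
      push_cast
      linear_combination ((1 + Complex.I) / 2) * hs
    rw [h2] at hd
    rw [cols, Matrix.det_fin_two_of] at hd
    rw [psiMatrix, if_pos rfl, cols, Matrix.det_fin_two_of]
    simp only [Pi.smul_apply, Pi.add_apply, smul_eq_mul]
    field_simp
    linear_combination hd

/-- The class in `Ω₁` of a matrix of determinant one (other matrices are sent to a fixed
class). -/
def classOf (M : Matrix (Fin 2) (Fin 2) ℂ) : LatticeSpace :=
  open Classical in
  if h : M.det = 1 then QuotientGroup.mk (⟨M, h⟩ : SL2C) else QuotientGroup.mk (1 : SL2C)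

/-- The parametrization `Ψ_k`, `k = 1, 2`; `det_psiMatrix` shows that `psiMatrix k p` is in
`SL(2, ℂ)` at all the points used. -/
def psi (k : ℕ) (p : ℝ × ℂ × ℂ) : LatticeSpace := classOf (psiMatrix k p)

/-- The domain of the coordinates `(θ, w₁, w₂)` on `T_k`: the points of `[0, π/2) × 𝔻²` whose
lattice `Ψ_k(θ, w₁, w₂)` is in `T_k` and meets the interior of `C(u, v)` only at `0`. -/
def coordDomain (k : ℕ) : Set (ℝ × ℂ × ℂ) :=
  {p | p.1 ∈ Ico 0 (Real.pi / 2) ∧ ‖p.2.1‖ < 1 ∧ ‖p.2.2‖ < 1 ∧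
    psi k p ∈ transversalPiece k ∧
    (lattice (psi k p) : Set (Fin 2 → ℂ)) ∩ interior (cylinder (uVec k p) (vVec k p)) = {0}}

end GaussLattice

end

noncomputable section

namespace GaussLattice

/-! ### Determinants and the wedge product -/

/-! Group side. Where the upper left entry `a` is nonzero, `(a, b, c)` are holomorphic coordinates
on the group, and on tangent vectors ω is `(-2/a) da ∧ db ∧ dc`. So α has absolute density `(2/|a|)²
· 8 = 32/|a|²` with respect to Lebesgue measure (`omega_eq`, `norm_det_conj`, `norm_alpha`); this
density defines `volMeasure`. The locus `a = 0` is carried into the chart by a left translation. As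
ω is invariant under both translations by matrices of determinant one, the measure is unique, left
and right invariant, and Haar. Discreteness of `SL(2, ℤ[i])` gives a measurable fundamental domain,
hence `m`, and a set that injects into the quotient keeps its volume there
(`IsQuotientMeasure.measure_image`).

Lattice side. If `u, v` are associated vectors then `r` is the least sup norm in the lattice.
Hermite's inequality gives `r⁴ ≤ 2`, so `δ = det(u, v)`, a Gaussian integer, satisfies `|δ|² < 8`
and has norm 1, 2, 4 or 5. Every lattice vector is `(αu + βv)/δ`, and α, β may be changed modulo δ;
if the result has small coefficients, the vector is shorter than `r` and so zero. Arithmetic modulo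
δ excludes norms 5 and 4, and for norm 2 it shows that the nontrivial coset is that of `(u + v)/δ`
(`norm_det_le_two`, `IsAssociated.dichotomy`). Associated vectors are unique up to fourth roots of
unity. Restricting `θ` to `[0, π/2)` removes the freedom in `u`, and prescribing the determinant (1
or `1 + i`) removes the freedom in `v`; this is `bijOn_psi`.

Density. Put `s = t + iθ`, and let κ be the prescribed determinant. The entries of `g_t` times the
basis of Ψ_k are obtained by changing one complex variable at a time, holomorphically with the other
two fixed: `s` to `a`, then `w₁` to `b`, then `w₂` to `c`. The derivatives are `a`, `a/κ` and
`κ/(a(1 - w₁w₂)²)`. The squared modulus of their product times `32/|a|²` is `32/|1 - w₁w₂|⁴`, so κ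
and the flow time cancel (`setLIntegral_flowEntries`).

Induced measure. This computation shows that the measure with the stated density satisfies the flow
box identity. Uniqueness needs enough injective boxes: on `|w₁| ≤ e^{-2ε}` no orbit returns within
time ε (`eq_zero_of_diagFlow_smul`), and these sets exhaust the transversal as ε tends to 0. -/

/-- Laplace expansion along a block of columns, summed over all permutations of the rows. -/
theorem sum_perm_det_mul_det {m n R : Type*} [Fintype m] [DecidableEq m] [Fintype n]
    [DecidableEq n] [CommRing R] (A : Matrix (m ⊕ n) (m ⊕ n) R) :
    ∑ σ : Equiv.Perm (m ⊕ n), ((Equiv.Perm.sign σ : ℤ) : R) *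
      (Matrix.det (Matrix.of fun i j => A (σ (Sum.inl i)) (Sum.inl j)) *
        Matrix.det (Matrix.of fun i j => A (σ (Sum.inr i)) (Sum.inr j))) =
      (Fintype.card (Equiv.Perm m) * Fintype.card (Equiv.Perm n) : ℕ) * A.det := by
  -- After both small determinants are expanded, each pair `(τ, ρ)` contributes a full copy of `det
  -- A`: the substitution `σ ↦ σ ∘ (τ ⊕ ρ)` in the Leibniz formula produces exactly this sum.
  have key : ∀ (τ : Equiv.Perm m) (ρ : Equiv.Perm n),
      ∑ σ : Equiv.Perm (m ⊕ n), ((Equiv.Perm.sign σ : ℤ) : R) *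
        ((((Equiv.Perm.sign τ : ℤ) : R) * ∏ j, A (σ (Sum.inl (τ j))) (Sum.inl j)) *
          (((Equiv.Perm.sign ρ : ℤ) : R) * ∏ j, A (σ (Sum.inr (ρ j))) (Sum.inr j))) = A.det := by
    intro τ ρ
    symm
    rw [Matrix.det_apply', ← Equiv.sum_comp (Equiv.mulRight (Equiv.Perm.sumCongr τ ρ))]
    refine Finset.sum_congr rfl fun σ _ => ?_
    simp only [Equiv.coe_mulRight, Equiv.Perm.sign_mul, Equiv.Perm.sign_sumCongr,
      Fintype.prod_sum_type, Equiv.Perm.mul_apply, Equiv.Perm.sumCongr_apply, Sum.map_inl,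
      Sum.map_inr]
    push_cast
    ring
  have hexp : ∀ σ : Equiv.Perm (m ⊕ n), ((Equiv.Perm.sign σ : ℤ) : R) *
      (Matrix.det (Matrix.of fun i j => A (σ (Sum.inl i)) (Sum.inl j)) *
        Matrix.det (Matrix.of fun i j => A (σ (Sum.inr i)) (Sum.inr j))) =
      ∑ τ : Equiv.Perm m, ∑ ρ : Equiv.Perm n, ((Equiv.Perm.sign σ : ℤ) : R) *
        ((((Equiv.Perm.sign τ : ℤ) : R) * ∏ j, A (σ (Sum.inl (τ j))) (Sum.inl j)) *
          (((Equiv.Perm.sign ρ : ℤ) : R) * ∏ j, A (σ (Sum.inr (ρ j))) (Sum.inr j))) := by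
    intro σ
    rw [Matrix.det_apply', Matrix.det_apply', Finset.sum_mul_sum, Finset.mul_sum]
    refine Finset.sum_congr rfl fun τ _ => ?_
    rw [Finset.mul_sum]
    rfl
  rw [Finset.sum_congr rfl fun σ _ => hexp σ, Finset.sum_comm]
  have : ∀ τ : Equiv.Perm m, ∑ σ : Equiv.Perm (m ⊕ n), ∑ ρ : Equiv.Perm n,
      ((Equiv.Perm.sign σ : ℤ) : R) *
        ((((Equiv.Perm.sign τ : ℤ) : R) * ∏ j, A (σ (Sum.inl (τ j))) (Sum.inl j)) *
          (((Equiv.Perm.sign ρ : ℤ) : R) * ∏ j, A (σ (Sum.inr (ρ j))) (Sum.inr j))) =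
        Fintype.card (Equiv.Perm n) * A.det := by
    intro τ
    rw [Finset.sum_comm, Finset.sum_congr rfl fun ρ _ => key τ ρ, Finset.sum_const]
    simp
  rw [Finset.sum_congr rfl fun τ _ => this τ, Finset.sum_const]
  simp [mul_assoc]

/-- Block Laplace expansion, with its factor `3! · 3! = 36` cancelling the normalization of the
wedge. The determinant formulas are only required on the given six vectors, since for ω they hold
only on tangent vectors. -/
theorem wedge33_eq_det {V : Type*} (η ζ : (Fin 3 → V) → ℂ) (v : Fin 6 → V) (p q : V → Fin 3 → ℂ)
    (c d : ℂ)
    (hη : ∀ i j k, η ![v i, v j, v k] = c * Matrix.det (Matrix.of ![p (v i), p (v j), p (v k)]))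
    (hζ : ∀ i j k, ζ ![v i, v j, v k] = d * Matrix.det (Matrix.of ![q (v i), q (v j), q (v k)])) :
    wedge33 η ζ v = c * d * Matrix.det (Matrix.of fun i j : Fin 3 ⊕ Fin 3 =>
      Sum.elim (p (v (finSumFinEquiv i))) (q (v (finSumFinEquiv i))) j) := by
  have h := sum_perm_det_mul_det (Matrix.of fun i j : Fin 3 ⊕ Fin 3 =>
      Sum.elim (p (v (finSumFinEquiv i))) (q (v (finSumFinEquiv i))) j)
  have h36 : ((Fintype.card (Equiv.Perm (Fin 3)) * Fintype.card (Equiv.Perm (Fin 3)) : ℕ) : ℂ)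
      = 36 := by
    simp [Fintype.card_perm, Nat.factorial]
  rw [h36] at h
  have hD : ∀ D : ℂ, c * d * D = c * d * (1 / 36) * (36 * D) := fun D => by ring
  rw [hD, ← h, wedge33,
    ← Equiv.sum_comp (finSumFinEquiv (m := 3) (n := 3)).permCongr, Finset.mul_sum, Finset.mul_sum]
  refine Finset.sum_congr rfl fun σ _ => ?_
  have e0 : (0 : Fin 6) = finSumFinEquiv (m := 3) (n := 3) (Sum.inl 0) := rfl
  have e1 : (1 : Fin 6) = finSumFinEquiv (m := 3) (n := 3) (Sum.inl 1) := rfl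
  have e2 : (2 : Fin 6) = finSumFinEquiv (m := 3) (n := 3) (Sum.inl 2) := rfl
  have e3 : (3 : Fin 6) = finSumFinEquiv (m := 3) (n := 3) (Sum.inr 0) := rfl
  have e4 : (4 : Fin 6) = finSumFinEquiv (m := 3) (n := 3) (Sum.inr 1) := rfl
  have e5 : (5 : Fin 6) = finSumFinEquiv (m := 3) (n := 3) (Sum.inr 2) := rfl
  rw [e0, e1, e2, e3, e4, e5, Equiv.Perm.sign_permCongr]
  simp only [Equiv.permCongr_apply, Equiv.symm_apply_apply]
  rw [hη, hζ]
  have hp : (Matrix.of fun i j : Fin 3 => (Matrix.of fun i j : Fin 3 ⊕ Fin 3 =>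
      Sum.elim (p (v (finSumFinEquiv i))) (q (v (finSumFinEquiv i))) j)
        (σ (Sum.inl i)) (Sum.inl j)) =
      Matrix.of ![p (v (finSumFinEquiv (σ (Sum.inl 0)))), p (v (finSumFinEquiv (σ (Sum.inl 1)))),
        p (v (finSumFinEquiv (σ (Sum.inl 2))))] := by
    ext i j; fin_cases i <;> simp
  have hq : (Matrix.of fun i j : Fin 3 => (Matrix.of fun i j : Fin 3 ⊕ Fin 3 =>
      Sum.elim (p (v (finSumFinEquiv i))) (q (v (finSumFinEquiv i))) j)
        (σ (Sum.inr i)) (Sum.inr j)) =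
      Matrix.of ![q (v (finSumFinEquiv (σ (Sum.inr 0)))), q (v (finSumFinEquiv (σ (Sum.inr 1)))),
        q (v (finSumFinEquiv (σ (Sum.inr 2))))] := by
    ext i j; fin_cases i <;> simp
  rw [hp, hq]
  ring

/-- The determinant of `(P | P̄)` is, up to the factor `8 i`, that of `(Re P | Im P)`. -/
theorem norm_det_conj (P : Fin 3 ⊕ Fin 3 → Fin 3 → ℂ) :
    ‖Matrix.det (Matrix.of fun i j : Fin 3 ⊕ Fin 3 =>
      Sum.elim (P i) (fun k => star (P i k)) j)‖ =
    8 * |Matrix.det (Matrix.of fun i j : Fin 3 ⊕ Fin 3 =>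
      Sum.elim (fun k => (P i k).re) (fun k => (P i k).im) j)| := by
  -- `(P | P̄)` is `(Re P | Im P)` times the block matrix with rows `(1, 1)` and `(i, -i)`, whose
  -- determinant is `(-2i)³`.
  have h : (Matrix.of fun i j : Fin 3 ⊕ Fin 3 => Sum.elim (P i) (fun k => star (P i k)) j) =
      (Matrix.of fun i j : Fin 3 ⊕ Fin 3 =>
        Sum.elim (fun k => (P i k).re) (fun k => (P i k).im) j).map (algebraMap ℝ ℂ) *
      Matrix.fromBlocks (1 : Matrix (Fin 3) (Fin 3) ℂ) 1
        (Complex.I • (1 : Matrix (Fin 3) (Fin 3) ℂ))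
        (-Complex.I • (1 : Matrix (Fin 3) (Fin 3) ℂ)) := by
    ext i (j | j)
    · simp [Matrix.mul_apply, Fintype.sum_sum_type, Matrix.one_apply, Complex.re_add_im]
    · simp [Matrix.mul_apply, Fintype.sum_sum_type, Matrix.one_apply]
      apply Complex.ext <;> simp
  rw [h, Matrix.det_mul, ← RingHom.mapMatrix_apply, ← RingHom.map_det, norm_mul,
    Matrix.det_fromBlocks_one₁₁]
  have : (-Complex.I • (1 : Matrix (Fin 3) (Fin 3) ℂ) -
      Complex.I • (1 : Matrix (Fin 3) (Fin 3) ℂ) * 1) = (-2 * Complex.I) • 1 := by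
    rw [mul_one, ← sub_smul]; congr 1; ring
  rw [this, Matrix.det_smul]
  simp
  norm_num
  ring

/-- The entries of a `2 × 2` matrix other than the lower right one. -/
def three (v : Fin 2 → Fin 2 → ℂ) : Fin 3 → ℂ := ![v 0 0, v 0 1, v 1 0]

/-- Tangent vectors of `SL(2, ℂ)` at `M`. -/
def IsTangent (M v : Fin 2 → Fin 2 → ℂ) : Prop :=
  M 0 0 * v 1 1 + M 1 1 * v 0 0 - M 0 1 * v 1 0 - M 1 0 * v 0 1 = 0

/-- Tangency expresses the last entry of each `vⱼ` through the other three. The corresponding column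
operation clears the last column of the 4 × 4 determinant except in the row of `M`, where `2(ad -
bc)/a = 2/a` remains; the corner position gives the sign. -/
theorem omega_eq {M : Fin 2 → Fin 2 → ℂ} (hM : M 0 0 * M 1 1 - M 0 1 * M 1 0 = 1)
    (ha : M 0 0 ≠ 0) {v₀ v₁ v₂ : Fin 2 → Fin 2 → ℂ} (h₀ : IsTangent M v₀) (h₁ : IsTangent M v₁)
    (h₂ : IsTangent M v₂) :
    omega M ![v₀, v₁, v₂] =
      (-2 / M 0 0) * Matrix.det (Matrix.of ![three v₀, three v₁, three v₂]) := by
  have hd : M 1 1 = (1 + M 0 1 * M 1 0) / M 0 0 := by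
    field_simp; linear_combination hM
  have hv : ∀ v, IsTangent M v →
      v 1 1 = (M 0 1 * v 1 0 + M 1 0 * v 0 1 - M 1 1 * v 0 0) / M 0 0 := by
    intro v h
    rw [IsTangent] at h
    field_simp; linear_combination h
  rw [omega, Matrix.det_fin_three, Matrix.det_succ_row_zero]
  simp only [Matrix.det_fin_three, Fin.sum_univ_four, vec4, three]
  simp [Matrix.submatrix_apply, Fin.succAbove, Fin.succ, Fin.lt_def]
  rw [hv _ h₀, hv _ h₁, hv _ h₂, hd]
  field_simp
  ring

theorem star_three (v : Fin 2 → Fin 2 → ℂ) :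
    three (fun a b => star (v a b)) = fun k => star (three v k) := by
  funext k; fin_cases k <;> rfl

/-- The constant is `2 · 2 · 8`: one factor `2/|a|` from each of ω and its conjugate, and 8 from
passing to real and imaginary parts. -/
theorem norm_alpha {M : Fin 2 → Fin 2 → ℂ} (hM : M 0 0 * M 1 1 - M 0 1 * M 1 0 = 1)
    (ha : M 0 0 ≠ 0) {v : Fin 6 → Fin 2 → Fin 2 → ℂ} (hv : ∀ i, IsTangent M (v i)) :
    ‖alpha M v‖ = 32 / ‖M 0 0‖ ^ 2 * |Matrix.det (Matrix.of fun i j : Fin 3 ⊕ Fin 3 =>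
      Sum.elim (fun k => (three (v (finSumFinEquiv i)) k).re)
        (fun k => (three (v (finSumFinEquiv i)) k).im) j)| := by
  rw [alpha, wedge33_eq_det (omega M) (omegaBar M) v three (fun w k => star (three w k))
    (-2 / M 0 0) (-2 / star (M 0 0))]
  · rw [norm_mul, norm_mul, norm_mul, norm_det_conj (fun i => three (v (finSumFinEquiv i)))]
    have : ‖M 0 0‖ ≠ 0 := norm_ne_zero_iff.mpr ha
    simp
    field_simp
    norm_num
    ring
  · intro i j k
    exact omega_eq hM ha (hv i) (hv j) (hv k)
  · have ht : ∀ i, IsTangent (fun a b => star (M a b)) (fun a b => star (v i a b)) := by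
      intro i
      have := congrArg star (hv i)
      simpa [IsTangent] using this
    have hM' : star (M 0 0) * star (M 1 1) - star (M 0 1) * star (M 1 0) = 1 := by
      have := congrArg star hM
      simpa using this
    intro i j k
    have := omega_eq (M := fun a b => star (M a b)) hM' (star_ne_zero.mpr ha) (ht i) (ht j) (ht k)
    rw [star_three, star_three, star_three] at this
    rw [← this, omegaBar]
    congr 1
    funext l
    fin_cases l <;> rfl

/-! ### Invariance of the volume form -/

/-- The product of two `2 × 2` matrices, as functions. -/
def mulEntries (A M : Fin 2 → Fin 2 → ℂ) : Fin 2 → Fin 2 → ℂ :=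
  fun a b => A a 0 * M 0 b + A a 1 * M 1 b

theorem entries_mul (g h : SL2C) : entries (g * h) = mulEntries (entries g) (entries h) := by
  funext a b
  simp [entries, mulEntries, Matrix.mul_apply, Fin.sum_univ_two]

/-- On `ℂ⁴` left multiplication acts as two copies of `A`, with determinant `(det A)² = 1`. Right
multiplication behaves in the same way. -/
theorem omega_mul_left (A : Fin 2 → Fin 2 → ℂ) (hA : A 0 0 * A 1 1 - A 0 1 * A 1 0 = 1)
    (M : Fin 2 → Fin 2 → ℂ) (v : Fin 3 → Fin 2 → Fin 2 → ℂ) :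
    omega (mulEntries A M) (fun j => mulEntries A (v j)) = omega M v := by
  have h : (Matrix.of ![vec4 (mulEntries A M), vec4 (mulEntries A (v 0)),
      vec4 (mulEntries A (v 1)), vec4 (mulEntries A (v 2))]) =
      Matrix.of ![vec4 M, vec4 (v 0), vec4 (v 1), vec4 (v 2)] *
        !![A 0 0, 0, A 1 0, 0; 0, A 0 0, 0, A 1 0; A 0 1, 0, A 1 1, 0; 0, A 0 1, 0, A 1 1] := by
    ext i j
    fin_cases i <;> fin_cases j <;>
      simp [Matrix.mul_apply, Fin.sum_univ_four, vec4, mulEntries, mul_comm]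
  have hdet : Matrix.det !![A 0 0, 0, A 1 0, 0; 0, A 0 0, 0, A 1 0; A 0 1, 0, A 1 1, 0;
      0, A 0 1, 0, A 1 1] = (A 0 0 * A 1 1 - A 0 1 * A 1 0) ^ 2 := by
    simp [Matrix.det_succ_row_zero, Fin.sum_univ_succ, Fin.succAbove]
    ring
  rw [omega, h, Matrix.det_mul, hdet, hA, omega]
  ring

theorem omega_mul_right (A : Fin 2 → Fin 2 → ℂ) (hA : A 0 0 * A 1 1 - A 0 1 * A 1 0 = 1)
    (M : Fin 2 → Fin 2 → ℂ) (v : Fin 3 → Fin 2 → Fin 2 → ℂ) :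
    omega (mulEntries M A) (fun j => mulEntries (v j) A) = omega M v := by
  have h : (Matrix.of ![vec4 (mulEntries M A), vec4 (mulEntries (v 0) A),
      vec4 (mulEntries (v 1) A), vec4 (mulEntries (v 2) A)]) =
      Matrix.of ![vec4 M, vec4 (v 0), vec4 (v 1), vec4 (v 2)] *
        !![A 0 0, A 0 1, 0, 0; A 1 0, A 1 1, 0, 0; 0, 0, A 0 0, A 0 1; 0, 0, A 1 0, A 1 1] := by
    ext i j
    fin_cases i <;> fin_cases j <;>
      simp [Matrix.mul_apply, Fin.sum_univ_four, vec4, mulEntries]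
  have hdet : Matrix.det !![A 0 0, A 0 1, 0, 0; A 1 0, A 1 1, 0, 0; 0, 0, A 0 0, A 0 1;
      0, 0, A 1 0, A 1 1] = (A 0 0 * A 1 1 - A 0 1 * A 1 0) ^ 2 := by
    simp [Matrix.det_succ_row_zero, Fin.sum_univ_succ, Fin.succAbove]
    ring
  rw [omega, h, Matrix.det_mul, hdet, hA, omega]
  ring

theorem alpha_congr_of_omega {M N : Fin 2 → Fin 2 → ℂ} (f : (Fin 2 → Fin 2 → ℂ) → Fin 2 → Fin 2 → ℂ)
    (h : ∀ v : Fin 3 → Fin 2 → Fin 2 → ℂ, omega N (fun j => f (v j)) = omega M v)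
    (h' : ∀ v : Fin 3 → Fin 2 → Fin 2 → ℂ, omegaBar N (fun j => f (v j)) = omegaBar M v)
    (v : Fin 6 → Fin 2 → Fin 2 → ℂ) : alpha N (fun i => f (v i)) = alpha M v := by
  have e : ∀ x y z, ![f x, f y, f z] = fun j => f (![x, y, z] j) := by
    intro x y z; funext j; fin_cases j <;> rfl
  simp only [alpha, wedge33, e, h, h']

theorem alpha_mul_left (A : Fin 2 → Fin 2 → ℂ) (hA : A 0 0 * A 1 1 - A 0 1 * A 1 0 = 1)
    (M : Fin 2 → Fin 2 → ℂ) (v : Fin 6 → Fin 2 → Fin 2 → ℂ) :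
    alpha (mulEntries A M) (fun j => mulEntries A (v j)) = alpha M v := by
  refine alpha_congr_of_omega (mulEntries A) (omega_mul_left A hA M) (fun v => ?_) v
  have hA' : star (A 0 0) * star (A 1 1) - star (A 0 1) * star (A 1 0) = 1 := by
    simpa using congrArg star hA
  refine Eq.trans ?_ (omega_mul_left (fun a b => star (A a b)) hA' _ _)
  rw [omegaBar]
  congr 1 <;> · funext; simp [mulEntries]

theorem alpha_mul_right (A : Fin 2 → Fin 2 → ℂ) (hA : A 0 0 * A 1 1 - A 0 1 * A 1 0 = 1)
    (M : Fin 2 → Fin 2 → ℂ) (v : Fin 6 → Fin 2 → Fin 2 → ℂ) :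
    alpha (mulEntries M A) (fun j => mulEntries (v j) A) = alpha M v := by
  refine alpha_congr_of_omega (fun w => mulEntries w A) (omega_mul_right A hA M) (fun v => ?_) v
  have hA' : star (A 0 0) * star (A 1 1) - star (A 0 1) * star (A 1 0) = 1 := by
    simpa using congrArg star hA
  refine Eq.trans ?_ (omega_mul_right (fun a b => star (A a b)) hA' _ _)
  rw [omegaBar]
  congr 1 <;> · funext; simp [mulEntries]

/-! ### The topology of `SL(2, ℂ)` -/

theorem isClosedEmbedding_entries : Topology.IsClosedEmbedding entries :=
  Matrix.SpecialLinearGroup.isClosedEmbedding_val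

theorem continuous_entries : Continuous entries := isClosedEmbedding_entries.continuous

instance instSecondCountableSL2C : SecondCountableTopology SL2C :=
  isClosedEmbedding_entries.isEmbedding.secondCountableTopology

theorem measurable_SL2C {α : Type*} [MeasurableSpace α] {f : α → SL2C}
    (h : ∀ a b, Measurable fun x => entries (f x) a b) : Measurable f :=
  isClosedEmbedding_entries.measurableEmbedding.measurable_comp_iff.1
    (measurable_pi_lambda _ fun a => measurable_pi_lambda _ fun b => h a b)

theorem measurable_entries (a b : Fin 2) : Measurable fun g : SL2C => entries g a b :=
  (measurable_pi_iff.1 (measurable_pi_iff.1 continuous_entries.measurable a)) b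

theorem entries_det (g : SL2C) :
    entries g 0 0 * entries g 1 1 - entries g 0 1 * entries g 1 0 = 1 := by
  rw [← g.det_coe, Matrix.det_fin_two]; rfl

theorem entries_injective : Function.Injective entries := isClosedEmbedding_entries.injective

/-! ### Coordinates on `SL(2, ℂ)` -/

/-- The matrix with first row `(a, b)` and lower left entry `c`. -/
def chart (z : ℂ × ℂ × ℂ) : SL2C :=
  if h : z.1 = 0 then 1 else
    (⟨!![z.1, z.2.1; z.2.2, (1 + z.2.1 * z.2.2) / z.1], by
      rw [Matrix.det_fin_two_of, mul_div_cancel₀ _ h]; ring⟩ : SL2C)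

/-- The upper left, upper right and lower left entries. -/
def coords (g : SL2C) : ℂ × ℂ × ℂ := (entries g 0 0, entries g 0 1, entries g 1 0)

theorem entries_chart {z : ℂ × ℂ × ℂ} (h : z.1 ≠ 0) :
    entries (chart z) = ![![z.1, z.2.1], ![z.2.2, (1 + z.2.1 * z.2.2) / z.1]] := by
  have : chart z = (⟨!![z.1, z.2.1; z.2.2, (1 + z.2.1 * z.2.2) / z.1], by
      rw [Matrix.det_fin_two_of, mul_div_cancel₀ _ h]; ring⟩ : SL2C) := dif_neg h
  funext a b
  rw [this]
  fin_cases a <;> fin_cases b <;> rfl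

theorem coords_chart {z : ℂ × ℂ × ℂ} (h : z.1 ≠ 0) : coords (chart z) = z := by
  rw [coords, entries_chart h]; rfl

theorem chart_coords {g : SL2C} (h : entries g 0 0 ≠ 0) : chart (coords g) = g := by
  apply entries_injective
  rw [entries_chart (by exact h)]
  have := entries_det g
  funext a b
  fin_cases a <;> fin_cases b <;> simp [coords]
  field_simp
  linear_combination -this

theorem measurable_chart : Measurable chart := by
  apply measurable_SL2C
  have hs : MeasurableSet {z : ℂ × ℂ × ℂ | z.1 = 0} :=
    measurable_fst (measurableSet_singleton 0)
  intro a b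
  have h : (fun z : ℂ × ℂ × ℂ => entries (chart z) a b) = fun z =>
      if z.1 = 0 then (1 : Matrix (Fin 2) (Fin 2) ℂ) a b else
        !![z.1, z.2.1; z.2.2, (1 + z.2.1 * z.2.2) / z.1] a b := by
    funext z
    split_ifs with hz
    · rw [show chart z = 1 from dif_pos hz]; rfl
    · rw [entries_chart hz]; fin_cases a <;> fin_cases b <;> rfl
  rw [h]
  refine Measurable.ite hs measurable_const ?_
  fin_cases a <;> fin_cases b <;> simp <;> fun_prop

/-! ### Real coordinates -/

/-- The identification of `ℝ⁶` with `ℂ³`, the real parts coming first. -/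
def toC3 (x : Fin 6 → ℝ) : ℂ × ℂ × ℂ := (⟨x 0, x 3⟩, ⟨x 1, x 4⟩, ⟨x 2, x 5⟩)

/-- The inverse of `toC3`. -/
def ofC3 (z : ℂ × ℂ × ℂ) : Fin 6 → ℝ :=
  ![z.1.re, z.2.1.re, z.2.2.re, z.1.im, z.2.1.im, z.2.2.im]

theorem toC3_ofC3 (z : ℂ × ℂ × ℂ) : toC3 (ofC3 z) = z := rfl

theorem ofC3_toC3 (x : Fin 6 → ℝ) : ofC3 (toC3 x) = x := by
  funext i; fin_cases i <;> rfl

theorem measurable_complex_mk : Measurable fun p : ℝ × ℝ => (⟨p.1, p.2⟩ : ℂ) :=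
  Complex.measurableEquivRealProd.symm.measurable

theorem measurable_toC3 : Measurable toC3 := by
  have h : ∀ i j : Fin 6, Measurable fun x : Fin 6 → ℝ => (⟨x i, x j⟩ : ℂ) := fun i j =>
    measurable_complex_mk.comp
      (Measurable.prodMk (f := fun x : Fin 6 → ℝ => x i) (g := fun x : Fin 6 → ℝ => x j)
        (measurable_pi_apply i) (measurable_pi_apply j))
  exact (h 0 3).prodMk ((h 1 4).prodMk (h 2 5))

theorem measurable_ofC3 : Measurable ofC3 := by
  refine measurable_pi_lambda _ fun i => ?_
  fin_cases i <;> simp [ofC3] <;> fun_prop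

/-- `toC3` as a measurable equivalence. -/
def equivC3 : (Fin 6 → ℝ) ≃ᵐ ℂ × ℂ × ℂ where
  toFun := toC3
  invFun := ofC3
  left_inv := ofC3_toC3
  right_inv := toC3_ofC3
  measurable_toFun := measurable_toC3
  measurable_invFun := measurable_ofC3

theorem volume_reProdIm {s t : Set ℝ} (hs : MeasurableSet s) (ht : MeasurableSet t) :
    volume (s ×ℂ t) = volume s * volume t := by
  have := Complex.volume_preserving_equiv_real_prod.measure_preimage (hs.prod ht).nullMeasurableSet
  rw [Measure.volume_eq_prod, Measure.prod_prod] at this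
  exact this

theorem measurePreserving_ofC3 : MeasurePreserving ofC3 := by
  refine ⟨measurable_ofC3, ?_⟩
  symm
  refine Measure.pi_eq fun s hs => ?_
  rw [Measure.map_apply measurable_ofC3 (MeasurableSet.univ_pi hs)]
  have : ofC3 ⁻¹' (univ.pi s) = (s 0 ×ℂ s 3) ×ˢ (s 1 ×ℂ s 4) ×ˢ (s 2 ×ℂ s 5) := by
    ext z
    simp only [mem_preimage, mem_univ_pi, mem_prod, Complex.mem_reProdIm, Fin.forall_fin_succ]
    simp [ofC3]
    tauto
  rw [this, Measure.volume_eq_prod, Measure.prod_prod, Measure.volume_eq_prod, Measure.prod_prod,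
    volume_reProdIm (hs _) (hs _), volume_reProdIm (hs _) (hs _), volume_reProdIm (hs _) (hs _)]
  simp only [Fin.prod_univ_six]
  ring

theorem measurePreserving_toC3 : MeasurePreserving toC3 :=
  MeasurePreserving.symm equivC3.symm measurePreserving_ofC3

theorem setLIntegral_image_toC3 (f : ℂ × ℂ × ℂ → ℝ≥0∞) (s : Set (Fin 6 → ℝ)) :
    ∫⁻ x in s, f (toC3 x) = ∫⁻ z in toC3 '' s, f z :=
  measurePreserving_toC3.setLIntegral_comp_emb equivC3.measurableEmbedding f s

/-- Real coordinates `(Re a, Re b, Re c, Im a, Im b, Im c)` of a matrix. -/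
def realThree : (Fin 2 → Fin 2 → ℂ) →L[ℝ] (Fin 6 → ℝ) :=
  LinearMap.toContinuousLinearMap
    { toFun := fun v i =>
        Sum.elim (fun k => (three v k).re) (fun k => (three v k).im) (finSumFinEquiv.symm i)
      map_add' := by
        intro v w
        funext i
        obtain ⟨j, rfl⟩ := (finSumFinEquiv (m := 3) (n := 3)).surjective i
        rcases j with j | j <;> fin_cases j <;> simp [three]
      map_smul' := by
        intro c v
        funext i
        obtain ⟨j, rfl⟩ := (finSumFinEquiv (m := 3) (n := 3)).surjective i
        rcases j with j | j <;> fin_cases j <;> simp [three] }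

theorem realThree_apply (v : Fin 2 → Fin 2 → ℂ) (j : Fin 3 ⊕ Fin 3) :
    realThree v (finSumFinEquiv j) =
      Sum.elim (fun k => (three v k).re) (fun k => (three v k).im) j := by
  simp [realThree]

theorem toC3_realThree (v : Fin 2 → Fin 2 → ℂ) : toC3 (realThree v) = (v 0 0, v 0 1, v 1 0) := by
  have h := realThree_apply v
  have e0 : realThree v 0 = (v 0 0).re := h (Sum.inl 0)
  have e1 : realThree v 1 = (v 0 1).re := h (Sum.inl 1)
  have e2 : realThree v 2 = (v 1 0).re := h (Sum.inl 2)
  have e3 : realThree v 3 = (v 0 0).im := h (Sum.inr 0)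
  have e4 : realThree v 4 = (v 0 1).im := h (Sum.inr 1)
  have e5 : realThree v 5 = (v 1 0).im := h (Sum.inr 2)
  simp only [toC3, e0, e1, e2, e3, e4, e5]

/-! ### The measure of the volume form -/

/-- The density of the volume form in the coordinates `(a, b, c)`. -/
def chartDensity (z : ℂ × ℂ × ℂ) : ℝ≥0∞ := ENNReal.ofReal (32 / ‖z.1‖ ^ 2)

theorem measurable_chartDensity : Measurable chartDensity := by
  unfold chartDensity; fun_prop

/-- The measure on `SL(2, ℂ)` with density `32 / |a|²` in the coordinates `(a, b, c)`. -/
def volMeasure : Measure SL2C :=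
  ((volume.restrict {z : ℂ × ℂ × ℂ | z.1 ≠ 0}).withDensity chartDensity).map chart

theorem measurableSet_entry_ne : MeasurableSet {g : SL2C | entries g 0 0 ≠ 0} :=
  (measurable_entries 0 0 (measurableSet_singleton 0)).compl

theorem coords_image (S : Set SL2C) :
    coords '' (S ∩ {g | entries g 0 0 ≠ 0}) = chart ⁻¹' S ∩ {z : ℂ × ℂ × ℂ | z.1 ≠ 0} := by
  ext z
  constructor
  · rintro ⟨g, ⟨hg, ha⟩, rfl⟩
    exact ⟨by rw [mem_preimage, chart_coords ha]; exact hg, ha⟩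
  · rintro ⟨hz, ha⟩
    refine ⟨chart z, ⟨hz, ?_⟩, coords_chart ha⟩
    rw [mem_ofPred_eq, entries_chart ha]; exact ha

theorem volMeasure_apply {S : Set SL2C} (hS : MeasurableSet S) :
    volMeasure S = ∫⁻ z in coords '' (S ∩ {g | entries g 0 0 ≠ 0}), chartDensity z := by
  rw [volMeasure, Measure.map_apply measurable_chart hS,
    withDensity_apply _ (measurable_chart hS), Measure.restrict_restrict (measurable_chart hS),
    coords_image]

theorem volMeasure_inter {S : Set SL2C} (hS : MeasurableSet S) :
    volMeasure (S ∩ {g | entries g 0 0 ≠ 0}) = volMeasure S := by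
  rw [volMeasure_apply hS, volMeasure_apply (hS.inter measurableSet_entry_ne), inter_assoc,
    inter_self]

/-- Differentiate the equation `ad - bc = 1` along the parametrization. -/
theorem isTangent_fderiv {U : Set (Fin 6 → ℝ)} (hU : IsOpen U) {φ : (Fin 6 → ℝ) → SL2C}
    (hφ : DifferentiableOn ℝ (fun x => entries (φ x)) U) {x : Fin 6 → ℝ} (hx : x ∈ U)
    (h : Fin 6 → ℝ) :
    IsTangent (entries (φ x)) (fderiv ℝ (fun y => entries (φ y)) x h) := by
  have hd := (hφ.differentiableAt (hU.mem_nhds hx)).hasFDerivAt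
  have hc : ∀ a b, HasFDerivAt (fun y => entries (φ y) a b)
      ((ContinuousLinearMap.proj (R := ℝ) (φ := fun _ : Fin 2 => ℂ) b).comp
        ((ContinuousLinearMap.proj (R := ℝ) (φ := fun _ : Fin 2 => Fin 2 → ℂ) a).comp
          (fderiv ℝ (fun y => entries (φ y)) x))) x := fun a b =>
    hasFDerivAt_pi'.1 (hasFDerivAt_pi'.1 hd a) b
  have h1 := ((hc 0 0).mul (hc 1 1)).sub ((hc 0 1).mul (hc 1 0))
  have h2 : HasFDerivAt (fun _ : Fin 6 → ℝ => (1 : ℂ)) (0 : (Fin 6 → ℝ) →L[ℝ] ℂ) x :=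
    hasFDerivAt_const _ _
  have h3 := h1.unique (h2.congr_of_eventuallyEq
    (Filter.Eventually.of_forall fun y => entries_det (φ y)))
  have h4 := congrArg (fun L : (Fin 6 → ℝ) →L[ℝ] ℂ => L h) h3
  simp at h4
  rw [IsTangent]
  linear_combination h4

theorem measurableSet_image {U : Set (Fin 6 → ℝ)} {φ : (Fin 6 → ℝ) → SL2C}
    (hφ : DifferentiableOn ℝ (fun x => entries (φ x)) U) {E : Set (Fin 6 → ℝ)} (hE : E ⊆ U)
    (hEm : MeasurableSet E) (hinj : InjOn φ E) : MeasurableSet (φ '' E) := by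
  refine hEm.image_of_continuousOn_injOn ?_ hinj
  exact (isClosedEmbedding_entries.isInducing.continuousOn_iff.2 hφ.continuousOn).mono hE

/-- Change of variables in the coordinates `(a, b, c)`: the Jacobian of `x ↦ realThree (entries (φ
x))` is the real determinant occurring in `norm_alpha`. -/
theorem volMeasure_image_of_ne_zero {U : Set (Fin 6 → ℝ)} (hU : IsOpen U)
    {φ : (Fin 6 → ℝ) → SL2C} (hφ : DifferentiableOn ℝ (fun x => entries (φ x)) U)
    {E : Set (Fin 6 → ℝ)} (hE : E ⊆ U) (hEm : MeasurableSet E) (hinj : InjOn φ E)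
    (ha : ∀ x ∈ E, entries (φ x) 0 0 ≠ 0) :
    volMeasure (φ '' E) = ∫⁻ x in E, ‖alpha (entries (φ x))
      (fun i => fderiv ℝ (fun y => entries (φ y)) x (Pi.single i 1))‖ₑ := by
  rw [volMeasure_apply (measurableSet_image hφ hE hEm hinj)]
  have hset : coords '' (φ '' E ∩ {g | entries g 0 0 ≠ 0}) =
      toC3 '' ((fun x => realThree (entries (φ x))) '' E) := by
    have : φ '' E ∩ {g | entries g 0 0 ≠ 0} = φ '' E := by
      rw [inter_eq_left]; rintro _ ⟨x, hx, rfl⟩; exact ha x hx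
    rw [this, image_image, image_image]
    refine image_congr fun x _ => ?_
    rw [toC3_realThree]; rfl
  rw [hset, ← setLIntegral_image_toC3]
  have hd : ∀ x ∈ E, HasFDerivWithinAt (fun x => realThree (entries (φ x)))
      (realThree.comp (fderiv ℝ (fun y => entries (φ y)) x)) E x := fun x hx =>
    (realThree.hasFDerivAt.comp x
      (hφ.differentiableAt (hU.mem_nhds (hE hx))).hasFDerivAt).hasFDerivWithinAt
  have hi : InjOn (fun x => realThree (entries (φ x))) E := by
    intro x hx y hy hxy
    apply hinj hx hy
    rw [← chart_coords (ha x hx), ← chart_coords (ha y hy)]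
    congr 1
    have := congrArg toC3 hxy
    simpa only [toC3_realThree, coords] using this
  rw [lintegral_image_eq_lintegral_abs_det_fderiv_mul volume hEm hd hi]
  refine setLIntegral_congr_fun hEm fun x hx => ?_
  have hn := norm_alpha (entries_det (φ x)) (ha x hx)
    (v := fun i => fderiv ℝ (fun y => entries (φ y)) x (Pi.single i 1))
    (fun i => isTangent_fderiv hU hφ (hE hx) _)
  set L := realThree.comp (fderiv ℝ (fun y => entries (φ y)) x) with hL
  have hdet : L.det = Matrix.det (Matrix.of fun i j : Fin 3 ⊕ Fin 3 =>
      Sum.elim (fun k => (three (fderiv ℝ (fun y => entries (φ y)) x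
        (Pi.single (finSumFinEquiv i) 1)) k).re)
        (fun k => (three (fderiv ℝ (fun y => entries (φ y)) x
        (Pi.single (finSumFinEquiv i) 1)) k).im) j) := by
    rw [ContinuousLinearMap.det, ← LinearMap.det_toMatrix', ← Matrix.det_transpose,
      ← Matrix.det_submatrix_equiv_self (finSumFinEquiv (m := 3) (n := 3))]
    congr 1
    ext i j
    rw [Matrix.submatrix_apply, Matrix.transpose_apply, LinearMap.toMatrix'_apply,
      Matrix.of_apply, ← realThree_apply]
    rfl
  rw [← hdet] at hn
  rw [← ofReal_norm, hn, chartDensity, toC3_realThree,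
    ← ENNReal.ofReal_mul (abs_nonneg _), mul_comm]

/-- The matrix with rows `(0, -1)` and `(1, 0)`. -/
def rot : SL2C := ⟨!![0, -1; 1, 0], by simp [Matrix.det_fin_two_of]⟩

theorem entries_rot_mul (g : SL2C) :
    entries (rot * g) = ![![-entries g 1 0, -entries g 1 1], ![entries g 0 0, entries g 0 1]] := by
  rw [entries_mul]
  funext a b
  fin_cases a <;> fin_cases b <;> simp [mulEntries, rot, entries]

/-- Left multiplication, as a continuous linear map. -/
def mulLeftCLM (A : Fin 2 → Fin 2 → ℂ) : (Fin 2 → Fin 2 → ℂ) →L[ℝ] (Fin 2 → Fin 2 → ℂ) :=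
  LinearMap.toContinuousLinearMap
    { toFun := mulEntries A
      map_add' := by intro v w; funext a b; simp [mulEntries]; ring
      map_smul' := by intro c v; funext a b; simp [mulEntries]; ring }

/-- Right multiplication, as a continuous linear map. -/
def mulRightCLM (A : Fin 2 → Fin 2 → ℂ) : (Fin 2 → Fin 2 → ℂ) →L[ℝ] (Fin 2 → Fin 2 → ℂ) :=
  LinearMap.toContinuousLinearMap
    { toFun := fun M => mulEntries M A
      map_add' := by intro v w; funext a b; simp [mulEntries]; ring
      map_smul' := by intro c v; funext a b; simp [mulEntries]; ring }

theorem differentiableOn_mul_left (g : SL2C) {U : Set (Fin 6 → ℝ)} {φ : (Fin 6 → ℝ) → SL2C}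
    (hφ : DifferentiableOn ℝ (fun x => entries (φ x)) U) :
    DifferentiableOn ℝ (fun x => entries (g * φ x)) U := by
  simp only [entries_mul]
  exact (mulLeftCLM (entries g)).differentiable.comp_differentiableOn hφ

theorem alpha_fderiv_mul_left (g : SL2C) {φ : (Fin 6 → ℝ) → SL2C} {x : Fin 6 → ℝ}
    (hφ : DifferentiableAt ℝ (fun x => entries (φ x)) x) :
    alpha (entries (g * φ x))
      (fun i => fderiv ℝ (fun y => entries (g * φ y)) x (Pi.single i 1)) =
    alpha (entries (φ x)) (fun i => fderiv ℝ (fun y => entries (φ y)) x (Pi.single i 1)) := by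
  have : fderiv ℝ (fun y => entries (g * φ y)) x =
      (mulLeftCLM (entries g)).comp (fderiv ℝ (fun y => entries (φ y)) x) := by
    simp only [entries_mul]
    exact ((mulLeftCLM (entries g)).hasFDerivAt.comp x hφ.hasFDerivAt).fderiv
  rw [this, entries_mul]
  exact alpha_mul_left (entries g) (entries_det g) _ _

theorem alpha_fderiv_mul_right (g : SL2C) {φ : (Fin 6 → ℝ) → SL2C} {x : Fin 6 → ℝ}
    (hφ : DifferentiableAt ℝ (fun x => entries (φ x)) x) :
    alpha (entries (φ x * g))
      (fun i => fderiv ℝ (fun y => entries (φ y * g)) x (Pi.single i 1)) =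
    alpha (entries (φ x)) (fun i => fderiv ℝ (fun y => entries (φ y)) x (Pi.single i 1)) := by
  have : fderiv ℝ (fun y => entries (φ y * g)) x =
      (mulRightCLM (entries g)).comp (fderiv ℝ (fun y => entries (φ y)) x) := by
    simp only [entries_mul]
    exact ((mulRightCLM (entries g)).hasFDerivAt.comp x hφ.hasFDerivAt).fderiv
  rw [this, entries_mul]
  exact alpha_mul_right (entries g) (entries_det g) _ _

/-- Left multiplication by `rot` sends `a = 0` into this null set, which is how the locus missed by
the chart is discarded. -/
theorem volMeasure_lower_left_zero : volMeasure {g | entries g 1 0 = 0} = 0 := by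
  have hm : MeasurableSet {g : SL2C | entries g 1 0 = 0} :=
    measurable_entries 1 0 (measurableSet_singleton 0)
  rw [volMeasure_apply hm]
  have h0 : (volume : Measure (ℂ × ℂ × ℂ)) (univ ×ˢ univ ×ˢ {0}) = 0 := by
    rw [Measure.volume_eq_prod, Measure.prod_prod, Measure.volume_eq_prod, Measure.prod_prod]
    simp
  refine setLIntegral_measure_zero _ _ (measure_mono_null ?_ h0)
  rintro _ ⟨g, ⟨hg, -⟩, rfl⟩
  exact ⟨mem_univ _, mem_univ _, hg⟩

theorem volMeasure_image {U : Set (Fin 6 → ℝ)} (hU : IsOpen U)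
    {φ : (Fin 6 → ℝ) → SL2C} (hφ : DifferentiableOn ℝ (fun x => entries (φ x)) U)
    {E : Set (Fin 6 → ℝ)} (hE : E ⊆ U) (hEm : MeasurableSet E) (hinj : InjOn φ E) :
    volMeasure (φ '' E) = ∫⁻ x in E, ‖alpha (entries (φ x))
      (fun i => fderiv ℝ (fun y => entries (φ y)) x (Pi.single i 1))‖ₑ := by
  have hc : ContinuousOn φ U := isClosedEmbedding_entries.isInducing.continuousOn_iff.2
    hφ.continuousOn
  set V : Set (Fin 6 → ℝ) := U ∩ φ ⁻¹' {g | entries g 0 0 ≠ 0} with hV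
  have hVm : MeasurableSet V := (hc.isOpen_inter_preimage hU (by
    have h00 : Continuous fun g : SL2C => entries g 0 0 :=
      (continuous_apply 0).comp ((continuous_apply 0).comp continuous_entries)
    exact isOpen_ne.preimage h00)).measurableSet
  have hE0 : E \ V ⊆ U := sdiff_subset.trans hE
  have ha0 : ∀ x ∈ E \ V, entries (φ x) 0 0 = 0 := fun x hx => by
    by_contra h
    exact hx.2 ⟨hE hx.1, h⟩
  -- On this part `a = 0`, hence `c ≠ 0`, so after translation by `rot` the chart applies. As α is
  -- invariant, the integral is the volume of a subset of `{c = 0}`.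
  have hzero : ∫⁻ x in E \ V, ‖alpha (entries (φ x))
      (fun i => fderiv ℝ (fun y => entries (φ y)) x (Pi.single i 1))‖ₑ = 0 := by
    have h := volMeasure_image_of_ne_zero hU (differentiableOn_mul_left rot hφ) hE0
      (hEm.diff hVm) (fun x hx y hy hxy => hinj hx.1 hy.1 (mul_left_cancel hxy)) (fun x hx => by
        have := entries_det (φ x)
        rw [ha0 x hx, zero_mul, zero_sub] at this
        rw [entries_rot_mul]
        intro h
        simp only [Matrix.cons_val_zero, neg_eq_zero] at h
        rw [h] at this
        simp at this)
    rw [setLIntegral_congr_fun (hEm.diff hVm) (fun x hx => by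
      rw [← alpha_fderiv_mul_left rot (hφ.differentiableAt (hU.mem_nhds (hE hx.1)))]), ← h]
    refine measure_mono_null ?_ volMeasure_lower_left_zero
    rintro _ ⟨x, hx, rfl⟩
    simp only [mem_ofPred_eq, entries_rot_mul]
    exact ha0 x hx
  rw [← lintegral_inter_add_sdiff _ E hVm, hzero, add_zero,
    ← volMeasure_inter (measurableSet_image hφ hE hEm hinj),
    ← volMeasure_image_of_ne_zero hU hφ (inter_subset_left.trans hE) (hEm.inter hVm)
      (hinj.mono inter_subset_left) (fun x hx => hx.2.2)]
  congr 1
  ext g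
  constructor
  · rintro ⟨⟨x, hx, rfl⟩, hg⟩
    exact ⟨x, ⟨hx, hE hx, hg⟩, rfl⟩
  · rintro ⟨x, hx, rfl⟩
    exact ⟨⟨x, hx.1, rfl⟩, hx.2.2⟩

theorem isVolumeFormMeasure_volMeasure : IsVolumeFormMeasure volMeasure := fun U φ h E hE hEm =>
  volMeasure_image h.isOpen (h.smooth.differentiableOn (by simp)) hE hEm (h.injOn.mono hE)

/-! ### Uniqueness and invariance of the measure of the volume form -/

theorem IsLocalParam.mul_left {U : Set (Fin 6 → ℝ)} {φ : (Fin 6 → ℝ) → SL2C}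
    (h : IsLocalParam U φ) (g : SL2C) : IsLocalParam U (fun x => g * φ x) where
  isOpen := h.isOpen
  smooth := by
    simp only [entries_mul]
    exact (mulLeftCLM (entries g)).contDiff.comp_contDiffOn h.smooth
  injOn := fun x hx y hy hxy => h.injOn hx hy (mul_left_cancel hxy)
  immersion := by
    intro x hx
    have hd : DifferentiableAt ℝ (fun y => entries (φ y)) x :=
      (h.smooth.differentiableOn (by simp)).differentiableAt (h.isOpen.mem_nhds hx)
    have : fderiv ℝ (fun y => entries (g * φ y)) x =
        (mulLeftCLM (entries g)).comp (fderiv ℝ (fun y => entries (φ y)) x) := by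
      simp only [entries_mul]
      exact ((mulLeftCLM (entries g)).hasFDerivAt.comp x hd.hasFDerivAt).fderiv
    rw [this]
    have hi : Function.LeftInverse (mulLeftCLM (entries g⁻¹)) (mulLeftCLM (entries g)) := by
      intro M
      have h1 := entries_mul g⁻¹ g
      have h2 : ∀ A B : Fin 2 → Fin 2 → ℂ,
          mulEntries A (mulEntries B M) = mulEntries (mulEntries A B) M := by
        intro A B; funext a b; simp [mulEntries]; ring
      change mulEntries (entries g⁻¹) (mulEntries (entries g) M) = M
      rw [h2, ← h1, inv_mul_cancel]
      funext a b
      fin_cases a <;> simp [mulEntries, entries]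
    exact hi.injective.comp (h.immersion x hx)

theorem IsLocalParam.mul_right {U : Set (Fin 6 → ℝ)} {φ : (Fin 6 → ℝ) → SL2C}
    (h : IsLocalParam U φ) (g : SL2C) : IsLocalParam U (fun x => φ x * g) where
  isOpen := h.isOpen
  smooth := by
    simp only [entries_mul]
    exact (mulRightCLM (entries g)).contDiff.comp_contDiffOn h.smooth
  injOn := fun x hx y hy hxy => h.injOn hx hy (mul_right_cancel hxy)
  immersion := by
    intro x hx
    have hd : DifferentiableAt ℝ (fun y => entries (φ y)) x :=
      (h.smooth.differentiableOn (by simp)).differentiableAt (h.isOpen.mem_nhds hx)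
    have : fderiv ℝ (fun y => entries (φ y * g)) x =
        (mulRightCLM (entries g)).comp (fderiv ℝ (fun y => entries (φ y)) x) := by
      simp only [entries_mul]
      exact ((mulRightCLM (entries g)).hasFDerivAt.comp x hd.hasFDerivAt).fderiv
    rw [this]
    have hi : Function.LeftInverse (mulRightCLM (entries g⁻¹)) (mulRightCLM (entries g)) := by
      intro M
      have h1 := entries_mul g g⁻¹
      have h2 : ∀ A B : Fin 2 → Fin 2 → ℂ,
          mulEntries (mulEntries M A) B = mulEntries M (mulEntries A B) := by
        intro A B; funext a b; simp [mulEntries]; ring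
      change mulEntries (mulEntries M (entries g)) (entries g⁻¹) = M
      rw [h2, ← h1, mul_inv_cancel]
      funext a b
      fin_cases b <;> simp [mulEntries, entries]
    exact hi.injective.comp (h.immersion x hx)

theorem continuous_toC3 : Continuous toC3 := by
  have h : ∀ i j : Fin 6, Continuous fun x : Fin 6 → ℝ => (⟨x i, x j⟩ : ℂ) := fun i j =>
    Complex.equivRealProdCLM.symm.continuous.comp
      (Continuous.prodMk (f := fun x : Fin 6 → ℝ => x i) (g := fun x : Fin 6 → ℝ => x j)
        (continuous_apply i) (continuous_apply j))
  exact (h 0 3).prodMk ((h 1 4).prodMk (h 2 5))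

/-- The open set of `ℝ⁶` on which the chart is defined. -/
def chartSource : Set (Fin 6 → ℝ) := {x | (toC3 x).1 ≠ 0}

theorem isOpen_chartSource : IsOpen chartSource :=
  isOpen_ne.preimage (continuous_fst.comp continuous_toC3)

theorem contDiffOn_chart :
    ContDiffOn ℝ ∞ (fun x => entries (chart (toC3 x))) chartSource := by
  have h : ∀ i j : Fin 6, ContDiff ℝ ∞ fun x : Fin 6 → ℝ => (⟨x i, x j⟩ : ℂ) := fun i j =>
    Complex.equivRealProdCLM.symm.contDiff.comp
      (ContDiff.prodMk (f := fun x : Fin 6 → ℝ => x i) (g := fun x : Fin 6 → ℝ => x j)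
        (contDiff_apply ℝ ℝ i) (contDiff_apply ℝ ℝ j))
  have h1 : ContDiff ℝ ∞ fun x => (toC3 x).1 := h 0 3
  have h2 : ContDiff ℝ ∞ fun x => (toC3 x).2.1 := h 1 4
  have h3 : ContDiff ℝ ∞ fun x => (toC3 x).2.2 := h 2 5
  have hd : ContDiffOn ℝ ∞
      (fun x => (1 + (toC3 x).2.1 * (toC3 x).2.2) / (toC3 x).1) chartSource := by
    simp only [div_eq_mul_inv]
    exact (contDiff_const.add (h2.mul h3)).contDiffOn.mul (h1.contDiffOn.inv fun x hx => hx)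
  refine ContDiffOn.congr (f := fun x => ![![(toC3 x).1, (toC3 x).2.1],
    ![(toC3 x).2.2, (1 + (toC3 x).2.1 * (toC3 x).2.2) / (toC3 x).1]]) ?_
    fun x hx => entries_chart hx
  refine contDiffOn_pi.2 fun a => contDiffOn_pi.2 fun b => ?_
  fin_cases a <;> fin_cases b
  · exact h1.contDiffOn
  · exact h2.contDiffOn
  · exact h3.contDiffOn
  · exact hd

theorem isLocalParam_chart : IsLocalParam chartSource (fun x => chart (toC3 x)) where
  isOpen := isOpen_chartSource
  smooth := contDiffOn_chart
  injOn := by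
    intro x hx y hy hxy
    have := congrArg coords hxy
    simp only [coords_chart hx, coords_chart hy] at this
    rw [← ofC3_toC3 x, this, ofC3_toC3]
  immersion := by
    intro x hx
    have hd : DifferentiableAt ℝ (fun y => entries (chart (toC3 y))) x :=
      (contDiffOn_chart.differentiableOn (by simp)).differentiableAt
        (isOpen_chartSource.mem_nhds hx)
    have h1 := (realThree.hasFDerivAt.comp x hd.hasFDerivAt)
    have h2 : HasFDerivAt (fun y : Fin 6 → ℝ => y) (ContinuousLinearMap.id ℝ (Fin 6 → ℝ)) x :=
      hasFDerivAt_id x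
    have h3 := h1.unique (h2.congr_of_eventuallyEq (by
      filter_upwards [isOpen_chartSource.mem_nhds hx] with y hy
      have : toC3 (realThree (entries (chart (toC3 y)))) = toC3 y := by
        rw [toC3_realThree]; exact coords_chart hy
      simp only [Function.comp_apply]
      rw [← ofC3_toC3 (realThree _), this, ofC3_toC3]))
    intro v w hvw
    have hv := congrArg (fun L : (Fin 6 → ℝ) →L[ℝ] (Fin 6 → ℝ) => L v) h3
    have hw := congrArg (fun L : (Fin 6 → ℝ) →L[ℝ] (Fin 6 → ℝ) => L w) h3
    simp only [ContinuousLinearMap.comp_apply, ContinuousLinearMap.id_apply] at hv hw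
    rw [← hv, ← hw, hvw]

theorem image_chart (S : Set SL2C) :
    (fun x => chart (toC3 x)) '' ((fun x => chart (toC3 x)) ⁻¹' S ∩ chartSource) =
      S ∩ {g | entries g 0 0 ≠ 0} := by
  ext g
  constructor
  · rintro ⟨x, ⟨hx, hx'⟩, rfl⟩
    refine ⟨hx, ?_⟩
    simp only [mem_ofPred_eq, entries_chart hx']
    exact hx'
  · rintro ⟨hg, ha⟩
    have : chart (toC3 (ofC3 (coords g))) = g := by rw [toC3_ofC3, chart_coords ha]
    exact ⟨ofC3 (coords g), ⟨by rw [mem_preimage, this]; exact hg, ha⟩, this⟩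

/-- The chart and its translate by `rot⁻¹` cover the group. Splitting a set along `a ≠ 0` gives a
formula for its measure in which the measure itself no longer appears. -/
theorem IsVolumeFormMeasure.eq_volMeasure {μ : Measure SL2C} (h : IsVolumeFormMeasure μ) :
    μ = volMeasure := by
  have key : ∀ {ν : Measure SL2C}, IsVolumeFormMeasure ν → ∀ S : Set SL2C, MeasurableSet S →
      ν S = (∫⁻ x in (fun x => chart (toC3 x)) ⁻¹' S ∩ chartSource,
        ‖alpha (entries (chart (toC3 x)))
          (fun i => fderiv ℝ (fun y => entries (chart (toC3 y))) x (Pi.single i 1))‖ₑ) +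
        ∫⁻ x in (fun x => chart (toC3 x)) ⁻¹' ((fun g => rot⁻¹ * g) ⁻¹'
          (S \ {g | entries g 0 0 ≠ 0})) ∩ chartSource,
        ‖alpha (entries (rot⁻¹ * chart (toC3 x)))
          (fun i => fderiv ℝ (fun y => entries (rot⁻¹ * chart (toC3 y))) x (Pi.single i 1))‖ₑ := by
    intro ν hν S hS
    have hm : Measurable fun g : SL2C => rot⁻¹ * g := measurable_const_mul _
    have hc : Measurable fun x => chart (toC3 x) := measurable_chart.comp measurable_toC3
    rw [← hν _ _ isLocalParam_chart _ inter_subset_right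
        ((hc hS).inter isOpen_chartSource.measurableSet),
      ← hν _ _ (isLocalParam_chart.mul_left rot⁻¹) _ inter_subset_right
        ((hc (hm (hS.diff measurableSet_entry_ne))).inter isOpen_chartSource.measurableSet),
      image_chart, ← image_image (fun g => rot⁻¹ * g), image_chart]
    rw [← measure_inter_add_sdiff S measurableSet_entry_ne]
    congr 2
    ext g
    constructor
    · intro hg
      refine ⟨rot * g, ⟨?_, ?_⟩, by simp⟩
      · simpa using hg
      · have := entries_det g
        have h0 : entries g 0 0 = 0 := by simpa using hg.2
        rw [h0] at this
        simp only [mem_ofPred_eq, entries_rot_mul]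
        intro h
        simp only [Matrix.cons_val_zero, neg_eq_zero] at h
        rw [h] at this
        simp at this
    · rintro ⟨g, ⟨hg, -⟩, rfl⟩
      exact hg
  ext S hS
  rw [key h S hS, key isVolumeFormMeasure_volMeasure S hS]

/-- The translate of the measure is again associated with the invariant form α, so uniqueness
identifies the two. -/
instance instIsMulLeftInvariantVolMeasure : volMeasure.IsMulLeftInvariant where
  map_mul_left_eq_self := by
    intro g
    apply IsVolumeFormMeasure.eq_volMeasure
    intro U φ h E hE hEm
    have h1 : volMeasure.map (fun x => g * x) (φ '' E) = volMeasure ((fun x => g⁻¹ * φ x) '' E) := by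
      rw [show (fun x => g * x) = MeasurableEquiv.mulLeft g from rfl, MeasurableEquiv.map_apply]
      congr 1
      ext y
      constructor
      · rintro ⟨x, hx, hxy⟩
        exact ⟨x, hx, by simp only [hxy]; simp⟩
      · rintro ⟨x, hx, rfl⟩
        exact ⟨x, hx, by simp⟩
    rw [h1, isVolumeFormMeasure_volMeasure U _ (h.mul_left g⁻¹) E hE hEm]
    refine setLIntegral_congr_fun hEm fun x hx => ?_
    rw [alpha_fderiv_mul_left]
    exact (h.smooth.differentiableOn (by simp)).differentiableAt (h.isOpen.mem_nhds (hE hx))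

instance instIsMulRightInvariantVolMeasure : volMeasure.IsMulRightInvariant where
  map_mul_right_eq_self := by
    intro g
    apply IsVolumeFormMeasure.eq_volMeasure
    intro U φ h E hE hEm
    have h1 : volMeasure.map (fun x => x * g) (φ '' E) = volMeasure ((fun x => φ x * g⁻¹) '' E) := by
      rw [show (fun x => x * g) = MeasurableEquiv.mulRight g from rfl, MeasurableEquiv.map_apply]
      congr 1
      ext y
      constructor
      · rintro ⟨x, hx, hxy⟩
        exact ⟨x, hx, by simp only [hxy]; simp⟩
      · rintro ⟨x, hx, rfl⟩
        exact ⟨x, hx, by simp⟩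
    rw [h1, isVolumeFormMeasure_volMeasure U _ (h.mul_right g⁻¹) E hE hEm]
    refine setLIntegral_congr_fun hEm fun x hx => ?_
    rw [alpha_fderiv_mul_right]
    exact (h.smooth.differentiableOn (by simp)).differentiableAt (h.isOpen.mem_nhds (hE hx))

/-! ### The measure of the volume form is a Haar measure -/

theorem continuous_coords : Continuous coords := by
  have h : ∀ a b, Continuous fun g : SL2C => entries g a b := fun a b =>
    (continuous_apply b).comp ((continuous_apply a).comp continuous_entries)
  exact (h 0 0).prodMk ((h 0 1).prodMk (h 1 0))

theorem entries_rot_mul_ne_zero {g : SL2C} (h0 : entries g 0 0 = 0) :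
    entries (rot * g) 0 0 ≠ 0 := by
  have := entries_det g
  rw [h0] at this
  rw [entries_rot_mul]
  intro h
  simp only [Matrix.cons_val_zero, neg_eq_zero] at h
  rw [h] at this
  simp at this

/-- The density `32/|a|²` is bounded on a small polydisc about a point with `a ≠ 0`. -/
theorem exists_mem_nhds_volMeasure_lt_top {g : SL2C} (h : entries g 0 0 ≠ 0) :
    ∃ s ∈ nhds g, volMeasure s < ⊤ := by
  set r := ‖entries g 0 0‖ / 2 with hr
  have hn : 0 < ‖entries g 0 0‖ := norm_pos_iff.2 h
  have hr0 : 0 < r := by positivity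
  set N : Set (ℂ × ℂ × ℂ) := Metric.ball (entries g 0 0) r ×ˢ Metric.ball (entries g 0 1) 1 ×ˢ
    Metric.ball (entries g 1 0) 1 with hN
  have hNo : IsOpen N := Metric.isOpen_ball.prod (Metric.isOpen_ball.prod Metric.isOpen_ball)
  have ho : IsOpen (coords ⁻¹' N) := hNo.preimage continuous_coords
  refine ⟨coords ⁻¹' N, ho.mem_nhds ⟨Metric.mem_ball_self hr0, Metric.mem_ball_self one_pos,
    Metric.mem_ball_self one_pos⟩, ?_⟩
  rw [volMeasure_apply ho.measurableSet]
  have hsub : coords '' (coords ⁻¹' N ∩ {g | entries g 0 0 ≠ 0}) ⊆ N := by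
    rintro _ ⟨g, hg, rfl⟩; exact hg.1
  refine (lintegral_mono_set hsub).trans_lt ?_
  refine (setLIntegral_mono' hNo.measurableSet (g := fun _ => ENNReal.ofReal (32 / r ^ 2)) ?_).trans_lt ?_
  · intro z hz
    have h1 : ‖z.1 - entries g 0 0‖ < r := mem_ball_iff_norm.1 hz.1
    have h2 : r ≤ ‖z.1‖ := by
      have := norm_sub_norm_le (entries g 0 0) z.1
      rw [norm_sub_rev] at this
      linarith
    unfold chartDensity
    gcongr
  · rw [setLIntegral_const, hN, Measure.volume_eq_prod, Measure.prod_prod, Measure.volume_eq_prod,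
      Measure.prod_prod]
    exact ENNReal.mul_lt_top ENNReal.ofReal_lt_top (ENNReal.mul_lt_top measure_ball_lt_top
      (ENNReal.mul_lt_top measure_ball_lt_top measure_ball_lt_top))

instance instIsLocallyFiniteVolMeasure : IsLocallyFiniteMeasure volMeasure where
  finiteAtNhds := by
    intro g
    by_cases h : entries g 0 0 = 0
    · obtain ⟨s, hs, hs'⟩ := exists_mem_nhds_volMeasure_lt_top (entries_rot_mul_ne_zero h)
      refine ⟨(fun x => rot * x) ⁻¹' s, (continuous_const_mul rot).continuousAt hs, ?_⟩
      rwa [measure_preimage_mul]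
    · exact exists_mem_nhds_volMeasure_lt_top h

theorem volMeasure_pos_of_isOpen {V : Set SL2C} (hV : IsOpen V) {g : SL2C} (hg : g ∈ V)
    (h : entries g 0 0 ≠ 0) : volMeasure V ≠ 0 := by
  rw [volMeasure_apply hV.measurableSet, coords_image,
    ← image_preimage_eq (f := toC3) (chart ⁻¹' V ∩ {z | z.1 ≠ 0}) equivC3.surjective, ← setLIntegral_image_toC3]
  have ho : IsOpen (toC3 ⁻¹' (chart ⁻¹' V ∩ {z | z.1 ≠ 0})) := by
    have hc : ContinuousOn (fun x => chart (toC3 x)) chartSource :=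
      isClosedEmbedding_entries.isInducing.continuousOn_iff.2
        isLocalParam_chart.smooth.continuousOn
    have := hc.isOpen_inter_preimage isOpen_chartSource hV
    rwa [inter_comm] at this
  have hne : (toC3 ⁻¹' (chart ⁻¹' V ∩ {z | z.1 ≠ 0})).Nonempty :=
    ⟨ofC3 (coords g), by
      rw [mem_preimage, toC3_ofC3]
      exact ⟨by rw [mem_preimage, chart_coords h]; exact hg, h⟩⟩
  refine ne_of_gt ?_
  refine (setLIntegral_pos_iff (f := fun x => chartDensity (toC3 x))
    (measurable_chartDensity.comp measurable_toC3)).2 ?_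
  refine (ho.measure_pos volume hne).trans_le (measure_mono fun x hx => ⟨?_, hx⟩)
  rw [Function.mem_support]
  have : 0 < ‖(toC3 x).1‖ := norm_pos_iff.2 hx.2
  simp only [chartDensity, ne_eq, ENNReal.ofReal_eq_zero, not_le]
  positivity

instance instIsOpenPosVolMeasure : volMeasure.IsOpenPosMeasure where
  open_pos := by
    rintro V hV ⟨g, hg⟩
    by_cases h : entries g 0 0 = 0
    · rw [← measure_preimage_mul volMeasure rot⁻¹ V]
      refine volMeasure_pos_of_isOpen (hV.preimage (continuous_const_mul _)) (g := rot * g) ?_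
        (entries_rot_mul_ne_zero h)
      simpa using hg
    · exact volMeasure_pos_of_isOpen hV hg h

instance instIsHaarVolMeasure : volMeasure.IsHaarMeasure where

/-! ### A fundamental domain for `SL(2, ℤ[i])` -/

instance instCountableGaussianInt : Countable GaussianInt :=
  Function.Injective.countable (f := fun z : GaussianInt => (z.re, z.im)) fun z w h => by
    rw [Prod.mk.injEq] at h
    exact Zsqrtd.ext h.1 h.2

instance instCountableSL2Zi : Countable SL2Zi := by
  have : Countable (Matrix.SpecialLinearGroup (Fin 2) GaussianInt) :=
    Function.Injective.countable
      (f := fun (g : Matrix.SpecialLinearGroup (Fin 2) GaussianInt) (i j : Fin 2) => g i j)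
      fun g h hgh => Matrix.SpecialLinearGroup.ext _ _ fun i j => congrFun (congrFun hgh i) j
  exact (MonoidHom.rangeRestrict_surjective
    (Matrix.SpecialLinearGroup.map (n := Fin 2) GaussianInt.toComplex)).countable

instance instCountableSL2ZiOp : Countable SL2Zi.op :=
  Function.Injective.countable (f := fun γ : SL2Zi.op => (⟨γ.1.unop, γ.2⟩ : SL2Zi))
    fun _ _ h => Subtype.ext (MulOpposite.unop_injective (congrArg Subtype.val h))

theorem norm_toComplex_sq (z : GaussianInt) : ‖(z : ℂ)‖ ^ 2 = ((z.norm : ℤ) : ℝ) := by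
  rw [← Complex.normSq_eq_norm_sq, ← GaussianInt.intCast_real_norm]

theorem toComplex_eq_zero_of_norm_lt_one {z : GaussianInt} (h : ‖(z : ℂ)‖ < 1) : z = 0 := by
  have h1 : ‖(z : ℂ)‖ ^ 2 < 1 := by
    have := norm_nonneg (z : ℂ)
    nlinarith
  rw [norm_toComplex_sq] at h1
  have h2 : z.norm < 1 := by exact_mod_cast h1
  have h3 : 0 ≤ z.norm := GaussianInt.norm_nonneg z
  exact (Zsqrtd.norm_eq_zero_iff (by norm_num) z).1 (by omega)

/-- Discreteness of the group: a Gaussian integer of modulus less than one is zero. -/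
theorem eq_one_of_entries_near {γ : SL2C} (h : γ ∈ SL2Zi)
    (hn : ∀ a b, ‖entries γ a b - entries 1 a b‖ < 1) : γ = 1 := by
  obtain ⟨δ, rfl⟩ := h
  apply entries_injective
  funext a b
  have h1 : entries (Matrix.SpecialLinearGroup.map GaussianInt.toComplex δ) a b - entries 1 a b =
      ((δ a b - (1 : Matrix (Fin 2) (Fin 2) GaussianInt) a b : GaussianInt) : ℂ) := by
    rw [map_sub]
    congr 1
    fin_cases a <;> fin_cases b <;> simp [entries]
  have h2 := hn a b
  rw [h1] at h2
  have h3 := toComplex_eq_zero_of_norm_lt_one h2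
  rw [h3, map_zero] at h1
  exact sub_eq_zero.1 h1

theorem nhds_one_entries_near :
    {g : SL2C | ∀ a b, ‖entries g a b - entries 1 a b‖ < 1} ∈ nhds (1 : SL2C) := by
  have h : ∀ a b, {g : SL2C | ‖entries g a b - entries 1 a b‖ < 1} ∈ nhds (1 : SL2C) := by
    intro a b
    have hc : Continuous fun g : SL2C => entries g a b :=
      (continuous_apply b).comp ((continuous_apply a).comp continuous_entries)
    exact (isOpen_lt (hc.sub continuous_const).norm continuous_const).mem_nhds (by simp)
  filter_upwards [h 0 0, h 0 1, h 1 0, h 1 1] with g h1 h2 h3 h4 a b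
  fin_cases a <;> fin_cases b
  exacts [h1, h2, h3, h4]

theorem exists_nhds_one_disjoint : ∃ U ∈ nhds (1 : SL2C), ∀ x ∈ U, ∀ y ∈ U,
    x⁻¹ * y ∈ SL2Zi → x = y := by
  have hc : Filter.Tendsto (fun p : SL2C × SL2C => p.1⁻¹ * p.2) (nhds 1 ×ˢ nhds 1) (nhds 1) := by
    have : Continuous fun p : SL2C × SL2C => p.1⁻¹ * p.2 := continuous_fst.inv.mul continuous_snd
    have h := this.tendsto (1, 1)
    rwa [nhds_prod_eq, inv_one, one_mul] at h
  obtain ⟨U, hU, h⟩ := Filter.mem_prod_same_iff.1 (hc nhds_one_entries_near)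
  refine ⟨U, hU, fun x hx y hy hxy => ?_⟩
  have h1 : (x, y) ∈ (fun p : SL2C × SL2C => p.1⁻¹ * p.2) ⁻¹'
    {g : SL2C | ∀ a b, ‖entries g a b - entries 1 a b‖ < 1} := h (mk_mem_prod hx hy)
  exact inv_mul_eq_one.1 (eq_one_of_entries_near hxy h1)

theorem smul_op_eq (γ : SL2Zi.op) (g : SL2C) : γ • g = g * γ.1.unop := rfl

theorem mk_eq_mk_iff {g h : SL2C} :
    (QuotientGroup.mk g : LatticeSpace) = QuotientGroup.mk h ↔ g⁻¹ * h ∈ SL2Zi :=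
  QuotientGroup.eq

theorem measurable_mk : Measurable (QuotientGroup.mk : SL2C → LatticeSpace) :=
  measurable_quotient_mk''

theorem measurableSet_lattice_iff {S : Set LatticeSpace} :
    MeasurableSet S ↔ MeasurableSet ((QuotientGroup.mk : SL2C → LatticeSpace) ⁻¹' S) :=
  Iff.rfl

theorem preimage_image_mk (B : Set SL2C) :
    (QuotientGroup.mk : SL2C → LatticeSpace) ⁻¹' (QuotientGroup.mk '' B) =
      ⋃ γ : SL2Zi.op, (γ • ·) '' B :=
  MulAction.quotient_preimage_image_eq_union_mul B

theorem measurableSet_smul {B : Set SL2C} (hB : MeasurableSet B) (γ : SL2Zi.op) :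
    MeasurableSet ((γ • ·) '' B) :=
  (MeasurableEquiv.smul γ).measurableSet_image.2 hB

/-- The saturation of `B` is a countable union of right translates of `B`. -/
theorem measurableSet_image_mk {B : Set SL2C} (hB : MeasurableSet B) :
    MeasurableSet ((QuotientGroup.mk : SL2C → LatticeSpace) '' B) := by
  rw [measurableSet_lattice_iff, preimage_image_mk]
  exact MeasurableSet.iUnion fun γ => measurableSet_smul hB γ

/-- Countably many left translates `W n` of a small open set cover the group, and each meets every
orbit at most once. Keep in `W n` only the points whose orbit misses all earlier `W m`; `Q n` is the
saturation of `W n`. -/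
theorem exists_measurable_fundamental_set : ∃ F : Set SL2C, MeasurableSet F ∧
    ∀ g : SL2C, ∃! γ : SL2Zi.op, γ • g ∈ F := by
  obtain ⟨U, hU, hUd⟩ := exists_nhds_one_disjoint
  have hW : ∀ g : SL2C, (fun x => g⁻¹ * x) ⁻¹' interior U ∈ nhds g := fun g =>
    (continuous_const_mul g⁻¹).continuousAt.preimage_mem_nhds (by
      rw [inv_mul_cancel]; exact interior_mem_nhds.2 hU)
  obtain ⟨s, hsc, hs⟩ := TopologicalSpace.countable_cover_nhds hW
  have hsne : s.Nonempty := by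
    rw [nonempty_iff_ne_empty]
    rintro rfl
    simp at hs
    exact (univ_nonempty (α := SL2C)).ne_empty hs.symm
  obtain ⟨c, hc⟩ := hsc.exists_eq_range hsne
  set W : ℕ → Set SL2C := fun n => (fun x => (c n)⁻¹ * x) ⁻¹' interior U with hWdef
  have hWm : ∀ n, MeasurableSet (W n) := fun n =>
    (isOpen_interior.preimage (continuous_const_mul _)).measurableSet
  have hcov : ∀ g, ∃ n, g ∈ W n := by
    intro g
    have : g ∈ ⋃ x ∈ s, (fun y => x⁻¹ * y) ⁻¹' interior U := hs ▸ mem_univ g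
    rw [hc] at this
    simpa [hWdef] using this
  set Q : ℕ → Set SL2C := fun n =>
    (QuotientGroup.mk : SL2C → LatticeSpace) ⁻¹' (QuotientGroup.mk '' W n) with hQ
  have hQm : ∀ n, MeasurableSet (Q n) := fun n =>
    measurable_mk (measurableSet_image_mk (hWm n))
  have hWQ : ∀ n, W n ⊆ Q n := fun n => subset_preimage_image _ _
  have hinv : ∀ n (γ : SL2Zi.op) g, γ • g ∈ Q n ↔ g ∈ Q n := by
    intro n γ g
    have : (QuotientGroup.mk (γ • g) : LatticeSpace) = QuotientGroup.mk g := by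
      rw [mk_eq_mk_iff, smul_op_eq, ← SL2Zi.inv_mem_iff]
      have e : (g * γ.1.unop)⁻¹ * g = (γ.1.unop)⁻¹ := by group
      rw [e, inv_inv]
      exact γ.2
    rw [hQ, mem_preimage, this, mem_preimage]
  refine ⟨⋃ n, W n \ ⋃ m < n, Q m, MeasurableSet.iUnion fun n => (hWm n).diff
    (MeasurableSet.iUnion fun m => MeasurableSet.iUnion fun _ => hQm m), fun g => ?_⟩
  classical
  have hex : ∃ n, g ∈ Q n := (hcov g).imp fun n hn => hWQ n hn
  have hmem : ∀ γ : SL2Zi.op, γ • g ∈ ⋃ n, W n \ ⋃ m < n, Q m ↔ γ • g ∈ W (Nat.find hex) := by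
    intro γ
    simp only [mem_iUnion, mem_sdiff, not_exists]
    constructor
    · rintro ⟨n, hn, hlt⟩
      have h1 : g ∈ Q n := (hinv n γ g).1 (hWQ n hn)
      have : n = Nat.find hex := by
        refine ((Nat.find_eq_iff hex).2 ⟨h1, fun m hm hgm => ?_⟩).symm
        exact hlt m hm ((hinv m γ g).2 hgm)
      rwa [← this]
    · intro h
      exact ⟨_, h, fun m hm hgm => Nat.find_min hex hm ((hinv m γ g).1 hgm)⟩
  simp only [hmem]
  obtain ⟨w, hw, hwg⟩ := Nat.find_spec hex
  have hγ := mk_eq_mk_iff.1 hwg.symm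
  refine ⟨⟨MulOpposite.op (g⁻¹ * w), hγ⟩, ?_, ?_⟩
  · change g * (g⁻¹ * w) ∈ _
    rwa [mul_inv_cancel_left]
  · intro γ hγ'
    have h1 : γ • g = w := by
      have h2 := hUd _ (interior_subset hγ') _ (interior_subset hw) (by
        have e : ((c (Nat.find hex))⁻¹ * γ • g)⁻¹ * ((c (Nat.find hex))⁻¹ * w) =
            (γ.1.unop)⁻¹ * (g⁻¹ * w) := by rw [smul_op_eq]; group
        rw [e]
        exact SL2Zi.mul_mem (SL2Zi.inv_mem γ.2) hγ)
      exact mul_left_cancel h2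
    apply Subtype.ext
    apply MulOpposite.unop_injective
    change γ.1.unop = g⁻¹ * w
    rw [← h1, smul_op_eq, inv_mul_cancel_left]

theorem exists_isFundamentalDomain : ∃ F : Set SL2C, IsFundamentalDomain SL2Zi.op F volMeasure := by
  obtain ⟨F, hF, h⟩ := exists_measurable_fundamental_set
  exact ⟨F, IsFundamentalDomain.mk' hF.nullMeasurableSet h⟩

instance instSMulInvariantVolMeasure : SMulInvariantMeasure SL2Zi.op SL2C volMeasure where
  measure_preimage_smul γ s _ := measure_preimage_mul_right volMeasure γ.1.unop s

/-- Right invariance of the Haar measure makes the image from a fundamental domain independent of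
the domain. -/
theorem existsUnique_isQuotientMeasure : ∃! m : Measure LatticeSpace,
    IsQuotientMeasure volMeasure m := by
  obtain ⟨F, hF⟩ := exists_isFundamentalDomain
  refine ⟨(volMeasure.restrict F).map QuotientGroup.mk,
    hF.quotientMeasureEqMeasurePreimage_quotientMeasure, fun m hm => ?_⟩
  exact hm.projection_respects_measure' F hF

/-- Unfolding: the translates of `B` are pairwise disjoint because `B` injects into the quotient,
and their intersections with a fundamental domain have total volume that of `B`. -/
theorem IsQuotientMeasure.measure_image {m : Measure LatticeSpace}
    (hm : IsQuotientMeasure volMeasure m) {B : Set SL2C} (hB : MeasurableSet B)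
    (hinj : InjOn (QuotientGroup.mk : SL2C → LatticeSpace) B) :
    m (QuotientGroup.mk '' B) = volMeasure B := by
  obtain ⟨F, hF⟩ := exists_isFundamentalDomain
  have h1 : m = (volMeasure.restrict F).map (QuotientGroup.mk : SL2C → LatticeSpace) :=
    hm.projection_respects_measure' F hF
  have hmB : MeasurableSet ((QuotientGroup.mk : SL2C → LatticeSpace) ⁻¹' (QuotientGroup.mk '' B)) :=
    measurable_mk (measurableSet_image_mk hB)
  rw [h1, Measure.map_apply measurable_mk (measurableSet_image_mk hB),
    Measure.restrict_apply hmB, preimage_image_mk, hF.measure_eq_tsum B, iUnion_inter,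
    measure_iUnion₀]
  · rfl
  · intro γ δ hγδ
    refine (Disjoint.mono inter_subset_left inter_subset_left ?_).aedisjoint
    rw [disjoint_left]
    rintro _ ⟨b, hb, rfl⟩ ⟨b', hb', hbb⟩
    apply hγδ
    have hbb' : b' * δ.1.unop = b * γ.1.unop := hbb
    have : b' = b := by
      apply hinj hb' hb
      rw [mk_eq_mk_iff]
      have : b'⁻¹ * b = δ.1.unop * (γ.1.unop)⁻¹ := by
        rw [inv_mul_eq_iff_eq_mul, ← mul_assoc, hbb', mul_inv_cancel_right]
      rw [this]
      exact SL2Zi.mul_mem δ.2 (SL2Zi.inv_mem γ.2)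
    rw [this] at hbb'
    exact Subtype.ext (MulOpposite.unop_injective (mul_left_cancel hbb')).symm
  · intro γ
    exact (measurableSet_smul hB γ).nullMeasurableSet.inter hF.nullMeasurableSet

/-! ### Gaussian integers -/

theorem exists_gaussianInt_near (z : ℂ) : ∃ l : GaussianInt, ‖z - l‖ ^ 2 ≤ 1 / 2 := by
  refine ⟨⟨round z.re, round z.im⟩, ?_⟩
  have h1 := abs_sub_round z.re
  have h2 := abs_sub_round z.im
  rw [← Complex.normSq_eq_norm_sq, Complex.normSq_apply]
  rw [Complex.sub_re, Complex.sub_im, GaussianInt.re_toComplex, GaussianInt.im_toComplex]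
  rw [abs_le] at h1 h2
  nlinarith

theorem gaussianInt_norm_eq (z : GaussianInt) : z.norm = z.re * z.re + z.im * z.im := by
  rw [Zsqrtd.norm_def]; ring

/-- The quotient is `z` times the conjugate of `δ`, divided by `δ.norm`; the two conditions say that
its real and imaginary parts are integers. This turns divisibility into integer arithmetic. -/
theorem gaussianInt_dvd_iff (δ z : GaussianInt) (h : δ.norm ≠ 0) :
    δ ∣ z ↔ δ.norm ∣ z.re * δ.re + z.im * δ.im ∧ δ.norm ∣ z.im * δ.re - z.re * δ.im := by
  have hn := gaussianInt_norm_eq δ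
  constructor
  · rintro ⟨w, rfl⟩
    refine ⟨⟨w.re, ?_⟩, ⟨w.im, ?_⟩⟩
    · rw [hn]; simp only [Zsqrtd.re_mul, Zsqrtd.im_mul]; ring
    · rw [hn]; simp only [Zsqrtd.re_mul, Zsqrtd.im_mul]; ring
  · rintro ⟨⟨x, hx⟩, ⟨y, hy⟩⟩
    refine ⟨⟨x, y⟩, ?_⟩
    apply Zsqrtd.ext
    · apply mul_left_cancel₀ h
      simp only [Zsqrtd.re_mul]
      rw [hn] at hx hy ⊢
      linear_combination δ.re * hx - δ.im * hy
    · apply mul_left_cancel₀ h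
      simp only [Zsqrtd.im_mul]
      rw [hn] at hx hy ⊢
      linear_combination δ.im * hx + δ.re * hy

theorem gaussianInt_norm_bounds {z : GaussianInt} {n : ℤ} (hn : n < 9) (h : z.norm ≤ n) :
    -2 ≤ z.re ∧ z.re ≤ 2 ∧ -2 ≤ z.im ∧ z.im ≤ 2 := by
  rw [gaussianInt_norm_eq] at h
  refine ⟨?_, ?_, ?_, ?_⟩ <;> nlinarith [mul_self_nonneg z.re, mul_self_nonneg z.im]

theorem gaussianInt_norm_lt_eight {z : GaussianInt} (h : z.norm < 8) (h0 : z ≠ 0) :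
    z.norm = 1 ∨ z.norm = 2 ∨ z.norm = 4 ∨ z.norm = 5 := by
  obtain ⟨h1, h2, h3, h4⟩ := gaussianInt_norm_bounds (n := 8) (by norm_num) h.le
  have h5 : z.norm ≠ 0 := fun h => h0 ((Zsqrtd.norm_eq_zero_iff (by norm_num) z).1 h)
  rw [gaussianInt_norm_eq] at *
  generalize z.re = x at *
  generalize z.im = y at *
  interval_cases x <;> interval_cases y <;> simp at *

/-- The residue ring modulo `δ` is the field with five elements, represented by 0 and the four
units. -/
theorem exists_residue_of_norm_five {δ : GaussianInt} (hδ : δ.norm = 5) (α : GaussianInt) :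
    ∃ l, (α - l * δ).norm ≤ 1 := by
  -- A finite check suffices: `δ` divides 5, so only the coordinates of `α` modulo 5 matter.
  have key : ∀ p ∈ Finset.Icc (-2 : ℤ) 2, ∀ q ∈ Finset.Icc (-2 : ℤ) 2,
      ∀ x ∈ Finset.Icc (0 : ℤ) 4, ∀ y ∈ Finset.Icc (0 : ℤ) 4, p * p + q * q = 5 →
      ∃ s ∈ Finset.Icc (-1 : ℤ) 1, ∃ t ∈ Finset.Icc (-1 : ℤ) 1,
      (p * p + q * q) ∣ ((x - s) * p + (y - t) * q) ∧
      (p * p + q * q) ∣ ((y - t) * p - (x - s) * q) ∧ s * s + t * t ≤ 1 := by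
    decide +kernel
  obtain ⟨h1, h2, h3, h4⟩ := gaussianInt_norm_bounds (n := 5) (by norm_num) hδ.le
  have hn := gaussianInt_norm_eq δ
  obtain ⟨s, -, t, -, hd1, hd2, hst⟩ := key δ.re (Finset.mem_Icc.2 ⟨h1, h2⟩) δ.im
    (Finset.mem_Icc.2 ⟨h3, h4⟩) (α.re % 5) (Finset.mem_Icc.2 (by omega)) (α.im % 5)
    (Finset.mem_Icc.2 (by omega)) (hn ▸ hδ)
  have : δ ∣ α - ⟨s, t⟩ := by
    rw [gaussianInt_dvd_iff _ _ (by omega)]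
    rw [← hn, hδ] at hd1 hd2
    simp only [Zsqrtd.re_sub, Zsqrtd.im_sub, hδ]
    have e1 : α.re = α.re % 5 + 5 * (α.re / 5) := (Int.emod_add_mul_ediv _ _).symm
    have e2 : α.im = α.im % 5 + 5 * (α.im / 5) := (Int.emod_add_mul_ediv _ _).symm
    constructor
    · obtain ⟨w, hw⟩ := hd1
      exact ⟨w + (α.re / 5) * δ.re + (α.im / 5) * δ.im, by
        linear_combination hw + δ.re * e1 + δ.im * e2⟩
    · obtain ⟨w, hw⟩ := hd2
      exact ⟨w + (α.im / 5) * δ.re - (α.re / 5) * δ.im, by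
        linear_combination hw + δ.re * e2 - δ.im * e1⟩
  obtain ⟨l, hl⟩ := this
  refine ⟨l, ?_⟩
  rw [mul_comm, ← hl, sub_sub_cancel, gaussianInt_norm_eq]
  exact hst

theorem dvd_two_of_norm_four {δ : GaussianInt} (hδ : δ.norm = 4) : δ ∣ 2 ∧ (2 : GaussianInt) ∣ δ := by
  obtain ⟨h1, h2, h3, h4⟩ := gaussianInt_norm_bounds (n := 4) (by norm_num) hδ.le
  have hn := gaussianInt_norm_eq δ
  rw [gaussianInt_dvd_iff _ _ (by omega), gaussianInt_dvd_iff _ _ (by decide), hδ]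
  rw [hδ] at hn
  have e1 : (2 : GaussianInt).re = 2 := rfl
  have e2 : (2 : GaussianInt).im = 0 := rfl
  have e3 : (2 : GaussianInt).norm = 4 := rfl
  rw [e1, e2, e3]
  generalize δ.re = x at *
  generalize δ.im = y at *
  clear hδ e1 e2 e3
  interval_cases x <;> interval_cases y <;>
    first
    | (exfalso; revert hn; decide)
    | decide

/-- Such a `δ` is a unit multiple of `1 + i`, and reduction modulo `1 + i` is the parity of the sum
of the coordinates. -/
theorem dvd_iff_of_norm_two {δ : GaussianInt} (hδ : δ.norm = 2) (z : GaussianInt) :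
    δ ∣ z ↔ 2 ∣ z.re + z.im := by
  obtain ⟨h1, h2, h3, h4⟩ := gaussianInt_norm_bounds (n := 2) (by norm_num) hδ.le
  have hn := gaussianInt_norm_eq δ
  rw [gaussianInt_dvd_iff _ _ (by omega), hδ]
  rw [hδ] at hn
  generalize δ.re = x at *
  generalize δ.im = y at *
  interval_cases x <;> interval_cases y <;> simp at hn <;> omega

/-- The combinatorial core: `a`, `b` are the coordinates of the associated vectors in a basis of
the lattice, and the hypotheses express that small combinations of these vectors with
denominator `δ = det (a, b)` are not in the lattice. -/
theorem norm_det_le_two {a₀ a₁ b₀ b₁ δ : GaussianInt} (hδ : a₀ * b₁ - b₀ * a₁ = δ) (h0 : δ ≠ 0)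
    (h8 : δ.norm < 8)
    (H1 : 4 ≤ δ.norm → ∀ c₀ c₁ l m : GaussianInt, (c₀ * b₁ - c₁ * b₀ - l * δ).norm ≤ 1 →
      (a₀ * c₁ - a₁ * c₀ - m * δ).norm ≤ 1 →
      c₀ * b₁ - c₁ * b₀ = l * δ ∧ a₀ * c₁ - a₁ * c₀ = m * δ)
    (H2 : ∀ c₀ c₁ : GaussianInt, δ ∣ a₀ * c₁ - a₁ * c₀ → δ ∣ c₀ * b₁ - c₁ * b₀)
    (H3 : ∀ c₀ c₁ : GaussianInt, δ ∣ c₀ * b₁ - c₁ * b₀ → δ ∣ a₀ * c₁ - a₁ * c₀) :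
    δ.norm = 1 ∨ δ.norm = 2 := by
  rcases gaussianInt_norm_lt_eight h8 h0 with h | h | h | h
  · exact Or.inl h
  · exact Or.inr h
  · exfalso
    obtain ⟨hd2, h2d⟩ := dvd_two_of_norm_four h
    -- Here `δ` is a unit times 2, with residues 0, 1, i, 1 + i. The claim is that `α` and `β` have
    -- the same residue, 0 or `1 + i`, which leaves at most two cosets where the determinant
    -- requires four.
    have key : ∀ c₀ c₁ : GaussianInt, 2 ∣ (c₀ * b₁ - c₁ * b₀) - (a₀ * c₁ - a₁ * c₀) ∧
        2 ∣ (1 + ⟨0, 1⟩) * (a₀ * c₁ - a₁ * c₀) := by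
      intro c₀ c₁
      have H1' := H1 h.ge c₀ c₁
      have H2' := H2 c₀ c₁
      have H3' := H3 c₀ c₁
      have H2'' := H2 ((1 + ⟨0, 1⟩) * c₀) ((1 + ⟨0, 1⟩) * c₁)
      have H3'' := H3 ((1 + ⟨0, 1⟩) * c₀) ((1 + ⟨0, 1⟩) * c₁)
      have e1 : (1 + ⟨0, 1⟩) * c₀ * b₁ - (1 + ⟨0, 1⟩) * c₁ * b₀ =
        (1 + ⟨0, 1⟩) * (c₀ * b₁ - c₁ * b₀) := by ring
      have e2 : a₀ * ((1 + ⟨0, 1⟩) * c₁) - a₁ * ((1 + ⟨0, 1⟩) * c₀) =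
        (1 + ⟨0, 1⟩) * (a₀ * c₁ - a₁ * c₀) := by ring
      rw [e1, e2] at H2'' H3''
      generalize c₀ * b₁ - c₁ * b₀ = α at *
      generalize a₀ * c₁ - a₁ * c₀ = β at *
      have hdvd : ∀ z : GaussianInt, δ ∣ z ↔ 2 ∣ z.re ∧ 2 ∣ z.im := by
        intro z
        constructor
        · intro hz
          have := h2d.trans hz
          rw [gaussianInt_dvd_iff _ _ (by decide)] at this
          have e1 : (2 : GaussianInt).re = 2 := rfl
          have e2 : (2 : GaussianInt).im = 0 := rfl
          have e3 : (2 : GaussianInt).norm = 4 := rfl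
          rw [e1, e2, e3] at this
          omega
        · rintro ⟨⟨x, hx⟩, ⟨y, hy⟩⟩
          refine hd2.trans ⟨⟨x, y⟩, ?_⟩
          apply Zsqrtd.ext
          · simp [Zsqrtd.re_mul, hx]
          · simp [Zsqrtd.im_mul, hy]
      have hdvd2 : ∀ z : GaussianInt, 2 ∣ z ↔ 2 ∣ z.re ∧ 2 ∣ z.im := fun z => by
        rw [← hdvd]; exact ⟨fun h => hd2.trans h, fun h => h2d.trans h⟩
      have H1'' : ∀ s t : GaussianInt, s.norm ≤ 1 → t.norm ≤ 1 → δ ∣ α - s → δ ∣ β - t →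
          δ ∣ α ∧ δ ∣ β := by
        rintro s t hs ht ⟨l, hl⟩ ⟨m, hm⟩
        obtain ⟨h1, h2⟩ := H1' l m (by rw [mul_comm, ← hl, sub_sub_cancel]; exact hs)
          (by rw [mul_comm, ← hm, sub_sub_cancel]; exact ht)
        exact ⟨⟨l, by rw [h1, mul_comm]⟩, ⟨m, by rw [h2, mul_comm]⟩⟩
      have i1 : (⟨1, 0⟩ : GaussianInt).norm ≤ 1 := by decide
      have i2 : (⟨0, 1⟩ : GaussianInt).norm ≤ 1 := by decide
      have j5 := H1'' ⟨1, 0⟩ ⟨1, 0⟩ i1 i1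
      have j6 := H1'' ⟨1, 0⟩ ⟨0, 1⟩ i1 i2
      have j7 := H1'' ⟨0, 1⟩ ⟨1, 0⟩ i2 i1
      have j8 := H1'' ⟨0, 1⟩ ⟨0, 1⟩ i2 i2
      clear H1 H2 H3 H1' H1'' i1 i2
      simp only [hdvd, hdvd2, Zsqrtd.re_sub, Zsqrtd.im_sub, Zsqrtd.re_mul, Zsqrtd.im_mul,
        Zsqrtd.re_add, Zsqrtd.im_add, Zsqrtd.re_one, Zsqrtd.im_one] at *
      generalize α.re = x at *
      generalize α.im = y at *
      generalize β.re = z at *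
      generalize β.im = w at *
      clear e1 e2 hd2 h2d hdvd hdvd2 hδ h0 h8 h
      -- An odd coordinate sum means that the residue is a unit; two unit residues are excluded by
      -- `H1`. Applying `H2` and `H3` after multiplication by `1 + i` then shows that both sums have
      -- the same parity, hence are even.
      have k1 : ¬ ((x + y) % 2 = 1 ∧ (z + w) % 2 = 1) := by
        rintro ⟨hα, hβ⟩
        rcases Int.emod_two_eq_zero_or_one x with hx | hx <;>
          rcases Int.emod_two_eq_zero_or_one z with hz | hz
        · have := j8 ⟨by omega, by omega⟩ ⟨by omega, by omega⟩; omega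
        · have := j7 ⟨by omega, by omega⟩ ⟨by omega, by omega⟩; omega
        · have := j6 ⟨by omega, by omega⟩ ⟨by omega, by omega⟩; omega
        · have := j5 ⟨by omega, by omega⟩ ⟨by omega, by omega⟩; omega
      have k2 : (z + w) % 2 = 0 → (x + y) % 2 = 0 := fun hβ => by
        have := H2'' ⟨by omega, by omega⟩; omega
      have k3 : (x + y) % 2 = 0 → (z + w) % 2 = 0 := fun hα => by
        have := H3'' ⟨by omega, by omega⟩; omega
      clear H2'' H3'' j5 j6 j7 j8
      have k4 : (x + y) % 2 = 0 := by omega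
      have k5 := k3 k4
      clear k1 k2 k3
      have k6 : x % 2 = z % 2 := by
        rcases Int.emod_two_eq_zero_or_one x with hx | hx
        · have := H3' ⟨by omega, by omega⟩; omega
        · by_contra hz
          have := H2' ⟨by omega, by omega⟩; omega
      clear H2' H3'
      omega
    obtain ⟨⟨p, hp⟩, -⟩ := key 1 0
    obtain ⟨⟨q, hq⟩, ⟨s, hs⟩⟩ := key 0 1
    obtain ⟨-, ⟨t, ht⟩⟩ := key 1 0
    -- Row operations on the determinant, with the divisibilities for the two basis vectors, extract
    -- a factor 4 from `(1 + i)δ`; but its norm is 8, not divisible by 16.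
    have h8' : (1 + ⟨0, 1⟩) * δ = 4 * (s * p - t * q) := by
      have e : (1 + ⟨0, 1⟩) * δ = ((1 + ⟨0, 1⟩) * a₀) * (b₁ + a₁) -
          ((1 + ⟨0, 1⟩) * a₁) * (b₀ + a₀) := by rw [← hδ]; ring
      rw [e]
      have e1 : b₁ + a₁ = 2 * p := by linear_combination hp
      have e2 : b₀ + a₀ = -2 * q := by linear_combination -hq
      have e3 : (1 + ⟨0, 1⟩) * a₀ = 2 * s := by linear_combination hs
      have e4 : (1 + ⟨0, 1⟩) * a₁ = -2 * t := by linear_combination -ht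
      rw [e1, e2, e3, e4]; ring
    have := congrArg Zsqrtd.norm h8'
    rw [Zsqrtd.norm_mul, Zsqrtd.norm_mul, h] at this
    have n1 : ((1 : GaussianInt) + ⟨0, 1⟩).norm = 2 := by decide
    have n2 : (4 : GaussianInt).norm = 16 := by decide
    rw [n1, n2] at this
    omega
  · exfalso
    -- Modulo `δ` both coefficients reduce to 0 or a unit, so `H1` puts the whole lattice in the
    -- span of the two vectors. Then all entries are divisible by `δ`, so `δ²` divides `δ`, which is
    -- impossible at norm 5.
    have key : ∀ c₀ c₁ : GaussianInt, δ ∣ c₀ * b₁ - c₁ * b₀ ∧ δ ∣ a₀ * c₁ - a₁ * c₀ := by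
      intro c₀ c₁
      obtain ⟨l, hl⟩ := exists_residue_of_norm_five h (c₀ * b₁ - c₁ * b₀)
      obtain ⟨m, hm⟩ := exists_residue_of_norm_five h (a₀ * c₁ - a₁ * c₀)
      obtain ⟨h1, h2⟩ := H1 (by omega) c₀ c₁ l m hl hm
      exact ⟨⟨l, by rw [h1, mul_comm]⟩, ⟨m, by rw [h2, mul_comm]⟩⟩
    obtain ⟨⟨p, hp⟩, ⟨q, hq⟩⟩ := key 1 0
    obtain ⟨⟨s, hs⟩, ⟨t, ht⟩⟩ := key 0 1
    have h1 : δ * 1 = δ * (δ * (t * p - s * q)) := by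
      rw [mul_one]
      calc δ = a₀ * b₁ - b₀ * a₁ := hδ.symm
        _ = (a₀ * 1 - a₁ * 0) * (1 * b₁ - 0 * b₀) - (0 * b₁ - 1 * b₀) * (a₀ * 0 - a₁ * 1) := by ring
        _ = _ := by rw [hp, hq, hs, ht]; ring
    have h2 := congrArg Zsqrtd.norm (mul_left_cancel₀ h0 h1)
    rw [Zsqrtd.norm_mul, h, Zsqrtd.norm_one] at h2
    omega

/-! ### Gauss lattices -/

/-- The determinant of two vectors of `ℂ²`. -/
def det2 (u v : Fin 2 → ℂ) : ℂ := u 0 * v 1 - v 0 * u 1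

theorem mem_gaussSpan {M : Matrix (Fin 2) (Fin 2) ℂ} {y : Fin 2 → ℂ} :
    y ∈ gaussSpan M ↔ ∃ p q : GaussianInt, ∀ i, y i = M i 0 * p + M i 1 * q := by
  constructor
  · rintro ⟨z, rfl⟩
    refine ⟨z 0, z 1, fun i => ?_⟩
    change M.mulVec (fun j => GaussianInt.toComplex (z j)) i = _
    simp [Matrix.mulVec, dotProduct, Fin.sum_univ_two]
  · rintro ⟨p, q, h⟩
    refine ⟨![p, q], ?_⟩
    funext i
    change M.mulVec (fun j => GaussianInt.toComplex (![p, q] j)) i = _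
    simp [Matrix.mulVec, dotProduct, Fin.sum_univ_two, h]

theorem mem_lattice_mk {M : SL2C} {y : Fin 2 → ℂ} :
    y ∈ lattice (QuotientGroup.mk M) ↔
      ∃ p q : GaussianInt, ∀ i, y i = entries M i 0 * p + entries M i 1 * q := mem_gaussSpan

theorem gaussianInt_smul_mem (x : LatticeSpace) (l : GaussianInt) {y : Fin 2 → ℂ}
    (hy : y ∈ lattice x) : (l : ℂ) • y ∈ lattice x := by
  obtain ⟨M, rfl⟩ := QuotientGroup.mk_surjective x
  obtain ⟨p, q, h⟩ := mem_lattice_mk.1 hy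
  refine mem_lattice_mk.2 ⟨l * p, l * q, fun i => ?_⟩
  rw [Pi.smul_apply, smul_eq_mul, h]
  simp only [map_mul]
  ring

/-- The Hermitian norm of a vector of `ℂ²`. -/
def hermSq (x : Fin 2 → ℂ) : ℝ := ‖x 0‖ ^ 2 + ‖x 1‖ ^ 2

theorem lagrange_identity (x y : Fin 2 → ℂ) :
    hermSq x * hermSq y = ‖star (x 0) * y 0 + star (x 1) * y 1‖ ^ 2 + ‖det2 x y‖ ^ 2 := by
  simp only [hermSq, det2, ← Complex.normSq_eq_norm_sq, Complex.normSq_apply]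
  simp
  ring

theorem sq_le_hermSq {r : ℝ} (hr : 0 < r) {x : Fin 2 → ℂ} (h : r ≤ ‖x‖) : r ^ 2 ≤ hermSq x := by
  by_contra! hlt
  unfold hermSq at hlt
  refine absurd h (not_le.2 ((pi_norm_lt_iff hr).2 fun i => ?_))
  fin_cases i
  · exact lt_of_pow_lt_pow_left₀ 2 hr.le
      (lt_of_le_of_lt (le_add_of_nonneg_right (sq_nonneg ‖x 1‖)) hlt)
  · exact lt_of_pow_lt_pow_left₀ 2 hr.le
      (lt_of_le_of_lt (le_add_of_nonneg_left (sq_nonneg ‖x 0‖)) hlt)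

/-- One step of Gauss reduction. The multiple of `x` added to `y` is the nearest to minus the
projection coefficient, so the Hermitian product with `x` has squared modulus at most `hermSq x ^ 2
/ 2`; Lagrange's identity adds the determinant term 1. The sign in `-x` keeps the determinant equal
to 1. -/
theorem exists_reduced_pair (Λ : LatticeSpace) {x y : Fin 2 → ℂ} (hx : x ∈ lattice Λ)
    (hy : y ∈ lattice Λ) (hd : det2 x y = 1) :
    ∃ x' ∈ lattice Λ, ∃ y' ∈ lattice Λ, det2 x' y' = 1 ∧
      hermSq x * hermSq x' ≤ hermSq x ^ 2 / 2 + 1 := by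
  have hq : hermSq x ≠ 0 := by
    intro h0
    have h1 := lagrange_identity x y
    rw [h0, hd] at h1
    simp at h1
    have := sq_nonneg ‖(starRingEnd ℂ) (x 0) * y 0 + (starRingEnd ℂ) (x 1) * y 1‖
    linarith
  obtain ⟨l, hl⟩ := exists_gaussianInt_near
    (-(star (x 0) * y 0 + star (x 1) * y 1) / (hermSq x : ℂ))
  have hqc : (hermSq x : ℂ) ≠ 0 := Complex.ofReal_ne_zero.2 hq
  refine ⟨y + (l : ℂ) • x, add_mem hy (gaussianInt_smul_mem Λ l hx), -x, neg_mem hx, ?_, ?_⟩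
  · rw [← hd]; simp [det2]; ring
  · rw [lagrange_identity]
    have h1 : det2 x (y + (l : ℂ) • x) = 1 := by rw [← hd]; simp [det2]; ring
    have h2 : star (x 0) * (y + (l : ℂ) • x) 0 + star (x 1) * (y + (l : ℂ) • x) 1 =
        -(hermSq x : ℂ) * (-(star (x 0) * y 0 + star (x 1) * y 1) / (hermSq x : ℂ) - l) := by
      have h3 : (hermSq x : ℂ) = star (x 0) * x 0 + star (x 1) * x 1 := by
        rw [hermSq, ← Complex.normSq_eq_norm_sq, ← Complex.normSq_eq_norm_sq]
        push_cast
        rw [Complex.normSq_eq_conj_mul_self, Complex.normSq_eq_conj_mul_self]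
        rfl
      rw [mul_sub, neg_mul, mul_div_cancel₀ _ hqc]
      simp only [Pi.add_apply, Pi.smul_apply, smul_eq_mul]
      linear_combination (-(l : ℂ)) * h3
    rw [h1, h2, norm_mul, mul_pow, norm_neg, Complex.norm_real, Real.norm_eq_abs, sq_abs]
    simp only [norm_one, one_pow]
    nlinarith [sq_nonneg (hermSq x)]

/-- Hermite's inequality for Gauss lattices. -/
theorem pow_four_le_two (Λ : LatticeSpace) {r : ℝ} (hr : 0 < r)
    (h : ∀ y ∈ lattice Λ, y ≠ 0 → r ≤ ‖y‖) : r ^ 4 ≤ 2 := by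
  by_contra! h2
  have hq : ∀ x ∈ lattice Λ, ∀ y, det2 x y = 1 → r ^ 2 ≤ hermSq x := by
    intro x hx y hd
    refine sq_le_hermSq hr (h x hx ?_)
    rintro rfl
    simp [det2] at hd
  -- If `r⁴ > 2` then `κ < 1`. Since `1 ≤ hermSq x ^ 2 / r⁴`, each reduction step contracts the
  -- Hermitian norm by `κ`; iterating contradicts the lower bound `r²`, without choosing a shortest
  -- vector.
  set κ : ℝ := 1 / 2 + 1 / r ^ 4 with hκ
  have hκ0 : 0 ≤ κ := by positivity
  have hκ1 : κ < 1 := by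
    have : 1 / r ^ 4 < 1 / 2 := one_div_lt_one_div_of_lt (by norm_num) h2
    linarith
  obtain ⟨M, rfl⟩ := QuotientGroup.mk_surjective Λ
  have key : ∀ n : ℕ, ∃ x ∈ lattice (QuotientGroup.mk M), ∃ y ∈ lattice (QuotientGroup.mk M),
      det2 x y = 1 ∧ hermSq x ≤ κ ^ n * hermSq (fun i => entries M i 0) := by
    intro n
    induction n with
    | zero =>
      refine ⟨fun i => entries M i 0, mem_lattice_mk.2 ⟨1, 0, by simp⟩, fun i => entries M i 1,
        mem_lattice_mk.2 ⟨0, 1, by simp⟩, ?_, by simp⟩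
      rw [← entries_det M, det2]
    | succ n ih =>
      obtain ⟨x, hx, y, hy, hd, hle⟩ := ih
      obtain ⟨x', hx', y', hy', hd', hle'⟩ := exists_reduced_pair _ hx hy hd
      refine ⟨x', hx', y', hy', hd', ?_⟩
      have hqx := hq x hx y hd
      have hr2 : 0 < r ^ 2 := by positivity
      have hpos : 0 < hermSq x := hr2.trans_le hqx
      have h1 : hermSq x' ≤ κ * hermSq x := by
        have h3 : (1 : ℝ) ≤ 1 / r ^ 4 * hermSq x ^ 2 := by
          rw [one_div, ← div_eq_inv_mul, le_div_iff₀ (by positivity), one_mul]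
          nlinarith
        refine le_of_mul_le_mul_left ?_ hpos
        calc hermSq x * hermSq x' ≤ hermSq x ^ 2 / 2 + 1 := hle'
          _ ≤ hermSq x ^ 2 / 2 + 1 / r ^ 4 * hermSq x ^ 2 := by linarith
          _ = hermSq x * (κ * hermSq x) := by rw [hκ]; ring
      calc hermSq x' ≤ κ * hermSq x := h1
        _ ≤ κ * (κ ^ n * hermSq (fun i => entries M i 0)) := by gcongr
        _ = _ := by ring
  have hlim : Filter.Tendsto (fun n : ℕ => κ ^ n * hermSq (fun i => entries M i 0)) Filter.atTop
      (nhds 0) := by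
    simpa using (tendsto_pow_atTop_nhds_zero_of_lt_one hκ0 hκ1).mul_const
      (hermSq (fun i => entries M i 0))
  have hr2 : 0 < r ^ 2 := by positivity
  obtain ⟨n, hn⟩ := (hlim.eventually (gt_mem_nhds hr2)).exists
  obtain ⟨x, hx, y, -, hd, hle⟩ := key n
  exact absurd (hq x hx y hd) (not_le.2 (hle.trans_lt hn))

/-! ### Associated vectors -/

theorem norm_eq_one_of_pow_four {ζ : ℂ} (h : ζ ^ 4 = 1) : ‖ζ‖ = 1 :=
  Complex.norm_eq_one_of_pow_eq_one h (by norm_num)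

theorem exists_gaussianInt_of_pow_four {ζ : ℂ} (h : ζ ^ 4 = 1) : ∃ l : GaussianInt, ζ = l := by
  have h1 : (ζ - 1) * (ζ + 1) * ((ζ - Complex.I) * (ζ + Complex.I)) = 0 := by
    linear_combination h - (ζ ^ 2 - 1) * Complex.I_sq
  rcases mul_eq_zero.1 h1 with h1 | h1 <;> rcases mul_eq_zero.1 h1 with h1 | h1
  · exact ⟨1, by simpa using sub_eq_zero.1 h1⟩
  · exact ⟨-1, by simpa using eq_neg_of_add_eq_zero_left h1⟩
  · exact ⟨⟨0, 1⟩, by simpa [GaussianInt.toComplex_def'] using sub_eq_zero.1 h1⟩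
  · exact ⟨⟨0, -1⟩, by simpa [GaussianInt.toComplex_def'] using eq_neg_of_add_eq_zero_left h1⟩

namespace IsAssociated

variable {x : LatticeSpace} {u v : Fin 2 → ℂ}

theorem pos (h : IsAssociated x u v) : 0 < ‖u 0‖ := (norm_nonneg _).trans_lt h.left_lt

theorem norm_left (h : IsAssociated x u v) : ‖u‖ = ‖u 0‖ := by
  refine le_antisymm ((pi_norm_le_iff_of_nonneg h.pos.le).2 fun i => ?_) (norm_le_pi_norm u 0)
  fin_cases i
  · exact le_rfl
  · exact h.left_lt.le

theorem norm_right (h : IsAssociated x u v) : ‖v‖ = ‖u 0‖ := by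
  refine le_antisymm ((pi_norm_le_iff_of_nonneg h.pos.le).2 fun i => ?_)
    (h.norm_eq ▸ norm_le_pi_norm v 1)
  fin_cases i
  · exact h.right_lt.le
  · exact h.norm_eq.ge

theorem le_norm (h : IsAssociated x u v) {y : Fin 2 → ℂ} (hy : y ∈ lattice x) (h0 : y ≠ 0) :
    ‖u 0‖ ≤ ‖y‖ := by
  by_contra! hlt
  obtain ⟨ζ, hζ, rfl | rfl⟩ := h.only y hy h0 hlt.le
  · rw [norm_smul, norm_eq_one_of_pow_four hζ, h.norm_left] at hlt
    linarith
  · rw [norm_smul, norm_eq_one_of_pow_four hζ, h.norm_right] at hlt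
    linarith

/-- The diagonal product has modulus `r²`, strictly larger than that of the other product. -/
theorem det2_ne_zero (h : IsAssociated x u v) : det2 u v ≠ 0 := by
  intro h0
  have h1 := congrArg norm (sub_eq_zero.1 h0)
  rw [norm_mul, norm_mul, ← h.norm_eq] at h1
  nlinarith [h.left_lt, h.right_lt, norm_nonneg (v 0), norm_nonneg (u 1), h.pos]

/-- The determinant has modulus less than `2r²`, and `r⁴ ≤ 2` by Hermite's inequality. -/
theorem norm_det2_sq_lt (h : IsAssociated x u v) : ‖det2 u v‖ ^ 2 < 8 := by
  have h4 := pow_four_le_two x h.pos fun y hy h0 => h.le_norm hy h0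
  have h1 : ‖det2 u v‖ ≤ ‖u 0‖ * ‖u 0‖ + ‖v 0‖ * ‖u 1‖ := by
    refine (norm_sub_le _ _).trans_eq ?_
    rw [norm_mul, norm_mul, ← h.norm_eq]
  have h2 : ‖v 0‖ * ‖u 1‖ < ‖u 0‖ * ‖u 0‖ := by
    nlinarith [h.left_lt, h.right_lt, norm_nonneg (v 0), norm_nonneg (u 1), h.pos]
  have h3 : ‖det2 u v‖ < 2 * ‖u 0‖ ^ 2 := by nlinarith
  have h5 : ‖det2 u v‖ ^ 2 < (2 * ‖u 0‖ ^ 2) ^ 2 :=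
    pow_lt_pow_left₀ h3 (norm_nonneg _) (by norm_num)
  nlinarith

/-- A lattice vector that is a small combination of the associated vectors is zero. -/
theorem eq_zero_of_small (h : IsAssociated x u v) {y : Fin 2 → ℂ} (hy : y ∈ lattice x)
    {δ α β : ℂ} (he : δ • y = α • u + β • v) (hα : ‖α‖ < ‖δ‖) (hβ : ‖β‖ < ‖δ‖)
    (hαβ : ‖α‖ + ‖β‖ ≤ ‖δ‖) : y = 0 := by
  by_contra h0
  have hδ : 0 < ‖δ‖ := (norm_nonneg _).trans_lt hα
  -- Strictness has two sources: if `t = 0` it comes from `s < ‖δ‖`, otherwise from the off-diagonal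
  -- coordinate `b < ‖u 0‖`.
  have key : ∀ a b s t : ℝ, 0 ≤ s → 0 ≤ t → a = ‖u 0‖ → 0 ≤ b → b < ‖u 0‖ → s < ‖δ‖ →
      s + t ≤ ‖δ‖ → s * a + t * b < ‖δ‖ * ‖u 0‖ := by
    rintro a b s t hs ht rfl hb hb' hs' hst
    rcases ht.eq_or_lt with rfl | ht
    · nlinarith [h.pos]
    · nlinarith [h.pos]
  have hi : ∀ i, ‖δ‖ * ‖y i‖ ≤ ‖α‖ * ‖u i‖ + ‖β‖ * ‖v i‖ := by
    intro i
    have := congrFun he i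
    simp only [Pi.smul_apply, Pi.add_apply, smul_eq_mul] at this
    rw [← norm_mul, this, ← norm_mul, ← norm_mul]
    exact norm_add_le _ _
  refine absurd (h.le_norm hy h0) (not_le.2 ((pi_norm_lt_iff h.pos).2 fun i => ?_))
  refine lt_of_mul_lt_mul_left ((hi i).trans_lt ?_) hδ.le
  fin_cases i
  · exact key _ _ _ _ (norm_nonneg _) (norm_nonneg _) rfl (norm_nonneg _) h.right_lt hα hαβ
  · change ‖α‖ * ‖u 1‖ + ‖β‖ * ‖v 1‖ < _
    rw [add_comm]
    exact key _ _ _ _ (norm_nonneg _) (norm_nonneg _) h.norm_eq.symm (norm_nonneg _) h.left_lt hβ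
      (by linarith)

end IsAssociated

theorem exists_norm_sub_mul_lt (α : GaussianInt) {δ : GaussianInt} (h : δ ≠ 0) :
    ∃ l : GaussianInt, ‖((α - l * δ : GaussianInt) : ℂ)‖ < ‖(δ : ℂ)‖ := by
  have hδ : (δ : ℂ) ≠ 0 := by simpa using h
  obtain ⟨l, hl⟩ := exists_gaussianInt_near ((α : ℂ) / δ)
  refine ⟨l, ?_⟩
  have h1 : ((α - l * δ : GaussianInt) : ℂ) = ((α : ℂ) / δ - l) * δ := by
    simp only [map_sub, map_mul]
    field_simp
  have h2 : 0 < ‖(δ : ℂ)‖ := norm_pos_iff.2 hδ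
  have h3 : ‖(α : ℂ) / δ - l‖ < 1 := by
    have := norm_nonneg ((α : ℂ) / δ - l)
    nlinarith
  rw [h1, norm_mul]
  nlinarith

/-- In a basis of the lattice, Cramer's rule gives `δ y = α u + β v` with `α = c₀b₁ - c₁b₀` and `β =
a₀c₁ - a₁c₀`. Membership in the span of `u` and `v` is divisibility of both by `δ`, so the geometry
becomes the arithmetic of `norm_det_le_two`. -/
theorem IsAssociated.dichotomy {x : LatticeSpace} {u v : Fin 2 → ℂ} (h : IsAssociated x u v) :
    ∃ δ : GaussianInt, det2 u v = δ ∧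
      ((δ.norm = 1 ∧ (gaussSpan (cols u v)).relIndex (lattice x) = 1) ∨
        (δ.norm = 2 ∧ (gaussSpan (cols u v)).relIndex (lattice x) = 2 ∧
          (1 / (δ : ℂ)) • (u + v) ∈ lattice x)) := by
  obtain ⟨M, rfl⟩ := QuotientGroup.mk_surjective x
  obtain ⟨a₀, a₁, ha⟩ := mem_lattice_mk.1 h.left_mem
  obtain ⟨b₀, b₁, hb⟩ := mem_lattice_mk.1 h.right_mem
  have hM := entries_det M
  set δ : GaussianInt := a₀ * b₁ - b₀ * a₁ with hδ
  have hdet : ∀ {y z : Fin 2 → ℂ} {p q s t : GaussianInt},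
      (∀ i, y i = entries M i 0 * p + entries M i 1 * q) →
      (∀ i, z i = entries M i 0 * s + entries M i 1 * t) →
      det2 y z = ((p * t - s * q : GaussianInt) : ℂ) := by
    intro y z p q s t hy hz
    rw [det2, hy, hz, hy, hz]
    simp only [map_sub, map_mul]
    linear_combination ((p : ℂ) * t - s * q) * hM
  have hδ' : det2 u v = δ := hdet ha hb
  have hδ0 : δ ≠ 0 := by
    rintro h0
    apply h.det2_ne_zero
    rw [hδ', h0, map_zero]
  have hδ0' : (δ : ℂ) ≠ 0 := by simpa using hδ0
  have h8 : δ.norm < 8 := by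
    have := h.norm_det2_sq_lt
    rw [hδ', norm_toComplex_sq] at this
    exact_mod_cast this
  -- Subtracting `l u + m v` from the lattice vector with coordinates `(c₀, c₁)` reduces `α` and `β`
  -- modulo `δ`; small remainders force the difference to vanish.
  have small : ∀ c₀ c₁ l m : GaussianInt,
      ‖((c₀ * b₁ - c₁ * b₀ - l * δ : GaussianInt) : ℂ)‖ < ‖(δ : ℂ)‖ →
      ‖((a₀ * c₁ - a₁ * c₀ - m * δ : GaussianInt) : ℂ)‖ < ‖(δ : ℂ)‖ →
      ‖((c₀ * b₁ - c₁ * b₀ - l * δ : GaussianInt) : ℂ)‖ +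
        ‖((a₀ * c₁ - a₁ * c₀ - m * δ : GaussianInt) : ℂ)‖ ≤ ‖(δ : ℂ)‖ →
      c₀ * b₁ - c₁ * b₀ = l * δ ∧ a₀ * c₁ - a₁ * c₀ = m * δ := by
    intro c₀ c₁ l m h1 h2 h3
    set y : Fin 2 → ℂ := fun i => entries M i 0 * ((c₀ - l * a₀ - m * b₀ : GaussianInt) : ℂ) +
      entries M i 1 * ((c₁ - l * a₁ - m * b₁ : GaussianInt) : ℂ) with hy
    have hyi : ∀ i, y i = entries M i 0 * ((c₀ - l * a₀ - m * b₀ : GaussianInt) : ℂ) +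
      entries M i 1 * ((c₁ - l * a₁ - m * b₁ : GaussianInt) : ℂ) := fun i => rfl
    have h0 : y = 0 := by
      refine h.eq_zero_of_small (mem_lattice_mk.2 ⟨_, _, hyi⟩) ?_ h1 h2 h3
      funext i
      simp only [Pi.smul_apply, Pi.add_apply, smul_eq_mul, hyi, ha, hb]
      simp only [map_sub, map_mul]
      rw [hδ]
      simp only [map_sub, map_mul]
      ring
    have e1 := hdet hyi hb
    have e2 := hdet ha hyi
    have z1 : det2 y v = 0 := by rw [h0]; simp [det2]
    have z2 : det2 u y = 0 := by rw [h0]; simp [det2]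
    rw [z1] at e1
    rw [z2] at e2
    have e1' := GaussianInt.toComplex_eq_zero.1 e1.symm
    have e2' := GaussianInt.toComplex_eq_zero.1 e2.symm
    constructor
    · rw [hδ]; linear_combination e1'
    · rw [hδ]; linear_combination e2'
  have le_one : ∀ z : GaussianInt, z.norm ≤ 1 → ‖(z : ℂ)‖ ≤ 1 := by
    intro z hz
    have h1 : ‖(z : ℂ)‖ ^ 2 ≤ 1 := by rw [norm_toComplex_sq]; exact_mod_cast hz
    nlinarith [norm_nonneg (z : ℂ)]
  have H2 : ∀ c₀ c₁ : GaussianInt, δ ∣ a₀ * c₁ - a₁ * c₀ → δ ∣ c₀ * b₁ - c₁ * b₀ := by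
    rintro c₀ c₁ ⟨m, hm⟩
    obtain ⟨l, hl⟩ := exists_norm_sub_mul_lt (c₀ * b₁ - c₁ * b₀) hδ0
    have hz : a₀ * c₁ - a₁ * c₀ - m * δ = 0 := by rw [hm]; ring
    have := small c₀ c₁ l m hl (by rw [hz]; simpa using hδ0) (by rw [hz]; simpa using hl.le)
    exact ⟨l, by rw [this.1, mul_comm]⟩
  have H3 : ∀ c₀ c₁ : GaussianInt, δ ∣ c₀ * b₁ - c₁ * b₀ → δ ∣ a₀ * c₁ - a₁ * c₀ := by
    rintro c₀ c₁ ⟨l, hl⟩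
    obtain ⟨m, hm⟩ := exists_norm_sub_mul_lt (a₀ * c₁ - a₁ * c₀) hδ0
    have hz : c₀ * b₁ - c₁ * b₀ - l * δ = 0 := by rw [hl]; ring
    have := small c₀ c₁ l m (by rw [hz]; simpa using hδ0) hm (by rw [hz]; simpa using hm.le)
    exact ⟨m, by rw [this.2, mul_comm]⟩
  have H1 : 4 ≤ δ.norm → ∀ c₀ c₁ l m : GaussianInt, (c₀ * b₁ - c₁ * b₀ - l * δ).norm ≤ 1 →
      (a₀ * c₁ - a₁ * c₀ - m * δ).norm ≤ 1 →
      c₀ * b₁ - c₁ * b₀ = l * δ ∧ a₀ * c₁ - a₁ * c₀ = m * δ := by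
    intro h4 c₀ c₁ l m h1 h2
    have h5 : 2 ≤ ‖(δ : ℂ)‖ := by
      have h6 : (4 : ℝ) ≤ ‖(δ : ℂ)‖ ^ 2 := by rw [norm_toComplex_sq]; exact_mod_cast h4
      nlinarith [norm_nonneg (δ : ℂ)]
    have := le_one _ h1
    have := le_one _ h2
    exact small c₀ c₁ l m (by linarith) (by linarith) (by linarith)
  have hspan : ∀ (y : Fin 2 → ℂ) (c₀ c₁ : GaussianInt),
      (∀ i, y i = entries M i 0 * c₀ + entries M i 1 * c₁) →
      (y ∈ gaussSpan (cols u v) ↔ δ ∣ c₀ * b₁ - c₁ * b₀ ∧ δ ∣ a₀ * c₁ - a₁ * c₀) := by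
    intro y c₀ c₁ hy
    rw [mem_gaussSpan]
    constructor
    · rintro ⟨p, q, hpq⟩
      have e0 : y 0 = u 0 * p + v 0 * q := hpq 0
      have e1 : y 1 = u 1 * p + v 1 * q := hpq 1
      have d1 := hdet hy hb
      have d2 := hdet ha hy
      rw [det2] at hδ'
      refine ⟨⟨p, ?_⟩, ⟨q, ?_⟩⟩
      · apply GaussianInt.toComplex_inj.1
        rw [mul_comm c₁ b₀, ← d1, det2, e0, e1]
        simp only [map_mul]
        linear_combination (p : ℂ) * hδ'
      · apply GaussianInt.toComplex_inj.1
        rw [mul_comm a₁ c₀, ← d2, det2, e0, e1]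
        simp only [map_mul]
        linear_combination (q : ℂ) * hδ'
    · rintro ⟨⟨p, hp⟩, ⟨q, hq⟩⟩
      refine ⟨p, q, fun i => ?_⟩
      have hp' := congrArg GaussianInt.toComplex hp
      have hq' := congrArg GaussianInt.toComplex hq
      have hδc := congrArg GaussianInt.toComplex hδ
      simp only [map_sub, map_mul] at hp' hq' hδc
      have hci : cols u v i 0 = u i ∧ cols u v i 1 = v i := by
        fin_cases i <;> exact ⟨rfl, rfl⟩
      rw [hci.1, hci.2, hy, ha, hb]
      apply mul_left_cancel₀ hδ0'
      linear_combination (entries M i 0 * c₀ + entries M i 1 * c₁) * hδc +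
        (entries M i 0 * a₀ + entries M i 1 * a₁) * hp' +
        (entries M i 0 * b₀ + entries M i 1 * b₁) * hq'
  refine ⟨δ, hδ', ?_⟩
  rcases norm_det_le_two hδ.symm hδ0 h8 H1 H2 H3 with hn | hn
  · refine Or.inl ⟨hn, AddSubgroup.relIndex_eq_one.2 fun y hy => ?_⟩
    obtain ⟨c₀, c₁, hc⟩ := mem_lattice_mk.1 hy
    have hu : IsUnit δ := (Zsqrtd.norm_eq_one_iff' (by norm_num) δ).1 hn
    exact (hspan y c₀ c₁ hc).2 ⟨hu.dvd, hu.dvd⟩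
  · refine Or.inr ⟨hn, ?_⟩
    have hdvd := dvd_iff_of_norm_two hn
    -- Otherwise the span would be the whole lattice and `δ` would be a unit.
    have hex : ∃ c₀ c₁ : GaussianInt, ¬ δ ∣ c₀ * b₁ - c₁ * b₀ := by
      by_contra! hall
      obtain ⟨p, hp⟩ := hall 1 0
      obtain ⟨q, hq⟩ := H3 1 0 (hall 1 0)
      obtain ⟨s, hs⟩ := hall 0 1
      obtain ⟨t, ht⟩ := H3 0 1 (hall 0 1)
      have h1 : δ * 1 = δ * (δ * (t * p - s * q)) := by
        rw [mul_one]
        calc δ = (a₀ * 1 - a₁ * 0) * (1 * b₁ - 0 * b₀) -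
              (0 * b₁ - 1 * b₀) * (a₀ * 0 - a₁ * 1) := by rw [hδ]; ring
          _ = _ := by rw [hp, hq, hs, ht]; ring
      have h2 := congrArg Zsqrtd.norm (mul_left_cancel₀ hδ0 h1)
      rw [Zsqrtd.norm_mul, hn, Zsqrtd.norm_one] at h2
      omega
    obtain ⟨d₀, d₁, hd⟩ := hex
    have hd' : ¬ δ ∣ a₀ * d₁ - a₁ * d₀ := fun h => hd (H2 _ _ h)
    set z : Fin 2 → ℂ := fun i => entries M i 0 * d₀ + entries M i 1 * d₁ with hz
    have hzm : z ∈ lattice (QuotientGroup.mk M) := mem_lattice_mk.2 ⟨d₀, d₁, fun i => rfl⟩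
    constructor
    -- By `H3` membership in the span depends only on whether `δ` divides `α`, a parity that adding
    -- `z` reverses.
    · rw [AddSubgroup.relIndex_eq_two_iff]
      refine ⟨z, hzm, fun y hy => ?_⟩
      obtain ⟨c₀, c₁, hc⟩ := mem_lattice_mk.1 hy
      have hyz : ∀ i, (y + z) i = entries M i 0 * ((c₀ + d₀ : GaussianInt) : ℂ) +
          entries M i 1 * ((c₁ + d₁ : GaussianInt) : ℂ) := by
        intro i
        rw [Pi.add_apply, hc, hz]
        simp only [map_add]
        ring
      have red : ∀ c₀ c₁ : GaussianInt, δ ∣ c₀ * b₁ - c₁ * b₀ ∧ δ ∣ a₀ * c₁ - a₁ * c₀ ↔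
          δ ∣ c₀ * b₁ - c₁ * b₀ := fun c₀ c₁ => ⟨fun h => h.1, fun h => ⟨h, H3 _ _ h⟩⟩
      rw [hspan _ _ _ hc, hspan _ _ _ hyz, red, red]
      have e : (c₀ + d₀) * b₁ - (c₁ + d₁) * b₀ =
          (c₀ * b₁ - c₁ * b₀) + (d₀ * b₁ - d₁ * b₀) := by ring
      rw [e]
      generalize c₀ * b₁ - c₁ * b₀ = α at *
      generalize d₀ * b₁ - d₁ * b₀ = β at *
      rw [hdvd] at hd
      rw [hdvd, hdvd, xor_iff_not_iff, Zsqrtd.re_add, Zsqrtd.im_add]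
      omega
    -- Modulo an element of norm 2 the only nonzero class is that of 1, so both coefficients of `z`
    -- are 1 modulo `δ`, and `z` differs from `(u + v)/δ` by an element of the span.
    · have hmod : ∀ w : GaussianInt, ¬ δ ∣ w → ∃ l, w = l * δ + 1 := by
        intro w hw
        rw [hdvd] at hw
        have : δ ∣ w - 1 := by
          rw [hdvd, Zsqrtd.re_sub, Zsqrtd.im_sub, Zsqrtd.re_one, Zsqrtd.im_one]
          omega
        obtain ⟨l, hl⟩ := this
        exact ⟨l, by rw [mul_comm, ← hl, sub_add_cancel]⟩
      obtain ⟨l, hl⟩ := hmod _ hd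
      obtain ⟨m, hm⟩ := hmod _ hd'
      have : (1 / (δ : ℂ)) • (u + v) = z - (l : ℂ) • u - (m : ℂ) • v := by
        funext i
        have hl' := congrArg GaussianInt.toComplex hl
        have hm' := congrArg GaussianInt.toComplex hm
        have hδc := congrArg GaussianInt.toComplex hδ
        simp only [map_add, map_sub, map_mul, map_one] at hl' hm' hδc
        simp only [Pi.smul_apply, Pi.sub_apply, Pi.add_apply, smul_eq_mul, hz, ha, hb]
        rw [div_mul_eq_mul_div, one_mul, div_eq_iff hδ0']
        linear_combination (-(entries M i 0 * d₀ + entries M i 1 * d₁)) * hδc -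
          (entries M i 0 * a₀ + entries M i 1 * a₁) * hl' -
          (entries M i 0 * b₀ + entries M i 1 * b₁) * hm'
      rw [this]
      exact sub_mem (sub_mem hzm (gaussianInt_smul_mem _ l h.left_mem))
        (gaussianInt_smul_mem _ m h.right_mem)

/-! ### The two pieces of the transversal -/

namespace IsAssociated

variable {x : LatticeSpace} {u v u' v' : Fin 2 → ℂ}

theorem smul (h : IsAssociated x u v) {ζ ξ : ℂ} (hζ : ζ ^ 4 = 1) (hξ : ξ ^ 4 = 1) :
    IsAssociated x (ζ • u) (ξ • v) where
  left_mem := by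
    obtain ⟨l, rfl⟩ := exists_gaussianInt_of_pow_four hζ
    exact gaussianInt_smul_mem x l h.left_mem
  right_mem := by
    obtain ⟨l, rfl⟩ := exists_gaussianInt_of_pow_four hξ
    exact gaussianInt_smul_mem x l h.right_mem
  norm_eq := by
    simpa [norm_eq_one_of_pow_four hζ, norm_eq_one_of_pow_four hξ] using h.norm_eq
  left_lt := by simpa [norm_eq_one_of_pow_four hζ] using h.left_lt
  right_lt := by
    simpa [norm_eq_one_of_pow_four hζ, norm_eq_one_of_pow_four hξ] using h.right_lt
  only := by
    intro y hy h0 hle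
    have hζ0 : ζ ≠ 0 := by rintro rfl; simp at hζ
    have hξ0 : ξ ≠ 0 := by rintro rfl; simp at hξ
    obtain ⟨η, hη, rfl | rfl⟩ := h.only y hy h0
      (by simpa [norm_eq_one_of_pow_four hζ] using hle)
    · refine ⟨η / ζ, by rw [div_pow, hη, hζ, div_one], Or.inl ?_⟩
      rw [smul_smul, div_mul_cancel₀ _ hζ0]
    · refine ⟨η / ξ, by rw [div_pow, hη, hξ, div_one], Or.inr ?_⟩
      rw [smul_smul, div_mul_cancel₀ _ hξ0]

theorem left_ne_zero (h : IsAssociated x u v) : u ≠ 0 := by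
  rintro rfl
  simpa using h.pos

theorem right_ne_zero (h : IsAssociated x u v) : v ≠ 0 := by
  rintro rfl
  have := h.norm_eq ▸ h.pos
  simp at this

theorem norm_unique (h : IsAssociated x u v) (h' : IsAssociated x u' v') : ‖u' 0‖ = ‖u 0‖ :=
  le_antisymm (h.norm_left ▸ h'.le_norm h.left_mem h.left_ne_zero)
    (h'.norm_left ▸ h.le_norm h'.left_mem h'.left_ne_zero)

/-- A multiple of `v` by a fourth root of unity cannot serve as `u'`: its first coordinate is too
small. -/
theorem left_unique (h : IsAssociated x u v) (h' : IsAssociated x u' v') :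
    ∃ ζ : ℂ, ζ ^ 4 = 1 ∧ u' = ζ • u := by
  obtain ⟨ζ, hζ, rfl | rfl⟩ := h.only u' h'.left_mem h'.left_ne_zero
    (h'.norm_left.trans (h.norm_unique h')).le
  · exact ⟨ζ, hζ, rfl⟩
  · have h1 := h.norm_unique h'
    have h2 := h.right_lt
    simp only [Pi.smul_apply, norm_smul, norm_eq_one_of_pow_four hζ, one_mul] at h1
    linarith

theorem right_unique (h : IsAssociated x u v) (h' : IsAssociated x u' v') :
    ∃ ζ : ℂ, ζ ^ 4 = 1 ∧ v' = ζ • v := by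
  obtain ⟨ζ, hζ, rfl | rfl⟩ := h.only v' h'.right_mem h'.right_ne_zero
    (h'.norm_right.trans (h.norm_unique h')).le
  · have h1 := h.norm_unique h'
    have h2 := h.left_lt
    have h3 := h'.norm_eq
    simp only [Pi.smul_apply, norm_smul, norm_eq_one_of_pow_four hζ, one_mul] at h1 h3
    linarith
  · exact ⟨ζ, hζ, rfl⟩

/-- Both sides are `δ.norm`. This makes the index computable from the determinant and independent of
the chosen associated pair. -/
theorem relIndex_eq_iff (h : IsAssociated x u v) (k : ℕ) :
    (gaussSpan (cols u v)).relIndex (lattice x) = k ↔ ‖det2 u v‖ ^ 2 = k := by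
  obtain ⟨δ, hδ, ⟨h1, h2⟩ | ⟨h1, h2, -⟩⟩ := h.dichotomy <;>
  · rw [h2, hδ, norm_toComplex_sq, h1]
    norm_cast

theorem relIndex_eq_one_or_two (h : IsAssociated x u v) :
    (gaussSpan (cols u v)).relIndex (lattice x) = 1 ∨
      (gaussSpan (cols u v)).relIndex (lattice x) = 2 := by
  obtain ⟨δ, -, ⟨-, h2⟩ | ⟨-, h2, -⟩⟩ := h.dichotomy
  exacts [Or.inl h2, Or.inr h2]

theorem norm_det2_unique (h : IsAssociated x u v) (h' : IsAssociated x u' v') :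
    ‖det2 u' v'‖ = ‖det2 u v‖ := by
  obtain ⟨ζ, hζ, rfl⟩ := h.left_unique h'
  obtain ⟨ξ, hξ, rfl⟩ := h.right_unique h'
  have : det2 (ζ • u) (ξ • v) = ζ * ξ * det2 u v := by simp [det2]; ring
  rw [this, norm_mul, norm_mul, norm_eq_one_of_pow_four hζ, norm_eq_one_of_pow_four hξ, one_mul,
    one_mul]

end IsAssociated

theorem transversal_eq_union : transversal = transversalPiece 1 ∪ transversalPiece 2 := by
  ext x
  constructor
  · rintro ⟨u, v, h⟩
    exact h.relIndex_eq_one_or_two.imp (fun h1 => ⟨u, v, h, h1⟩) fun h1 => ⟨u, v, h, h1⟩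
  · rintro (⟨u, v, h, -⟩ | ⟨u, v, h, -⟩) <;> exact ⟨u, v, h⟩

theorem disjoint_transversalPiece : Disjoint (transversalPiece 1) (transversalPiece 2) := by
  rw [disjoint_left]
  rintro x ⟨u, v, h, h1⟩ ⟨u', v', h', h2⟩
  rw [h.relIndex_eq_iff] at h1
  rw [h'.relIndex_eq_iff, h.norm_det2_unique h', h1] at h2
  norm_num at h2

/-! ### The parametrizations -/

theorem norm_uCoord (p : ℝ × ℂ × ℂ) : ‖uCoord p‖ = 1 := Complex.norm_exp_I_mul_ofReal _

theorem norm_vCoord (k : ℕ) (p : ℝ × ℂ × ℂ) : ‖vCoord k p‖ = 1 := Complex.norm_exp_I_mul_ofReal _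

theorem rad_nonneg (k : ℕ) (p : ℝ × ℂ × ℂ) : 0 ≤ rad k p := by unfold rad; positivity

theorem rad_pos {k : ℕ} (hk : k = 1 ∨ k = 2) {p : ℝ × ℂ × ℂ} (h : p.2.1 * p.2.2 ≠ 1) :
    0 < rad k p := by
  have h1 : 0 < ‖1 - p.2.1 * p.2.2‖ := norm_pos_iff.2 (sub_ne_zero.2 (Ne.symm h))
  have h2 : (0 : ℝ) < k := by rcases hk with rfl | rfl <;> norm_num
  unfold rad
  positivity

theorem mul_ne_one_of_norm_lt {z w : ℂ} (hz : ‖z‖ < 1) (hw : ‖w‖ < 1) : z * w ≠ 1 := by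
  intro h
  have := congrArg norm h
  rw [norm_mul, norm_one] at this
  nlinarith [norm_nonneg z, norm_nonneg w]

theorem norm_uVec_zero (k : ℕ) (p : ℝ × ℂ × ℂ) : ‖uVec k p 0‖ = rad k p := by
  simp [uVec, norm_uCoord, abs_of_nonneg (rad_nonneg k p)]

theorem norm_uVec_one (k : ℕ) (p : ℝ × ℂ × ℂ) : ‖uVec k p 1‖ = rad k p * ‖p.2.2‖ := by
  simp [uVec, norm_vCoord, abs_of_nonneg (rad_nonneg k p)]

theorem norm_vVec_zero (k : ℕ) (p : ℝ × ℂ × ℂ) : ‖vVec k p 0‖ = rad k p * ‖p.2.1‖ := by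
  simp [vVec, norm_uCoord, abs_of_nonneg (rad_nonneg k p)]

theorem norm_vVec_one (k : ℕ) (p : ℝ × ℂ × ℂ) : ‖vVec k p 1‖ = rad k p := by
  simp [vVec, norm_vCoord, abs_of_nonneg (rad_nonneg k p)]

/-- The determinant of the associated vectors in the parametrization `Ψ_k`. -/
def detConst (k : ℕ) : ℂ := if k = 2 then 1 + Complex.I else 1

theorem one_add_I_ne_zero : (1 + Complex.I : ℂ) ≠ 0 := fun h => by
  have := congrArg Complex.re h
  simp at this

theorem detConst_ne_zero (k : ℕ) : detConst k ≠ 0 := by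
  unfold detConst
  split_ifs
  exacts [one_add_I_ne_zero, one_ne_zero]

theorem norm_detConst_sq {k : ℕ} (hk : k = 1 ∨ k = 2) : ‖detConst k‖ ^ 2 = k := by
  rcases hk with rfl | rfl
  · simp [detConst]
  · rw [← Complex.normSq_eq_norm_sq, Complex.normSq_apply]
    simp [detConst]
    norm_num

theorem det2_uVec_vVec {k : ℕ} (hk : k = 1 ∨ k = 2) {p : ℝ × ℂ × ℂ} (h : p.2.1 * p.2.2 ≠ 1) :
    det2 (uVec k p) (vVec k p) = detConst k := by
  have h1 := det_psiMatrix hk p h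
  rcases hk with rfl | rfl
  · rw [psiMatrix, if_neg (by norm_num), cols, Matrix.det_fin_two_of] at h1
    rw [det2, detConst, if_neg (by norm_num), h1]
  · rw [psiMatrix, if_pos rfl, cols, Matrix.det_fin_two_of] at h1
    simp only [Pi.smul_apply, Pi.add_apply, smul_eq_mul] at h1
    have h2 := one_add_I_ne_zero
    field_simp at h1
    rw [det2, detConst, if_pos rfl]
    linear_combination h1

/-- The parametrization `Ψ_k`, lifted to `SL(2, ℂ)`. -/
def psiLift (k : ℕ) (p : ℝ × ℂ × ℂ) : SL2C :=
  open Classical in if h : (psiMatrix k p).det = 1 then (⟨psiMatrix k p, h⟩ : SL2C) else (1 : SL2C)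

theorem psi_eq (k : ℕ) (p : ℝ × ℂ × ℂ) : psi k p = QuotientGroup.mk (psiLift k p) := by
  by_cases h : (psiMatrix k p).det = 1
  · have h2 : psiLift k p = (⟨psiMatrix k p, h⟩ : SL2C) := dif_pos h
    exact (dif_pos h).trans (congrArg QuotientGroup.mk h2.symm)
  · have h2 : psiLift k p = (1 : SL2C) := dif_neg h
    exact (dif_neg h).trans (congrArg QuotientGroup.mk h2.symm)

theorem entries_psiLift {k : ℕ} (hk : k = 1 ∨ k = 2) {p : ℝ × ℂ × ℂ} (h : p.2.1 * p.2.2 ≠ 1) :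
    entries (psiLift k p) = psiMatrix k p := by
  have h2 : psiLift k p = (⟨psiMatrix k p, det_psiMatrix hk p h⟩ : SL2C) := dif_pos _
  rw [h2]
  rfl

theorem psiMatrix_zero (k : ℕ) (p : ℝ × ℂ × ℂ) (i : Fin 2) : psiMatrix k p i 0 = uVec k p i := by
  unfold psiMatrix
  split_ifs <;> fin_cases i <;> rfl

theorem psiMatrix_one (k : ℕ) (p : ℝ × ℂ × ℂ) (i : Fin 2) : psiMatrix k p i 1 =
    if k = 2 then 1 / (1 + Complex.I) * (uVec k p i + vVec k p i) else vVec k p i := by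
  unfold psiMatrix
  split_ifs <;> fin_cases i <;> rfl

theorem uVec_mem_lattice {k : ℕ} (hk : k = 1 ∨ k = 2) {p : ℝ × ℂ × ℂ} (h : p.2.1 * p.2.2 ≠ 1) :
    uVec k p ∈ lattice (psi k p) := by
  rw [psi_eq, mem_lattice_mk, entries_psiLift hk h]
  refine ⟨1, 0, fun i => ?_⟩
  rw [psiMatrix_zero]
  simp

theorem vVec_mem_lattice {k : ℕ} (hk : k = 1 ∨ k = 2) {p : ℝ × ℂ × ℂ} (h : p.2.1 * p.2.2 ≠ 1) :
    vVec k p ∈ lattice (psi k p) := by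
  rw [psi_eq, mem_lattice_mk, entries_psiLift hk h]
  rcases hk with rfl | rfl
  · refine ⟨0, 1, fun i => ?_⟩
    rw [psiMatrix_one, if_neg (by norm_num)]
    simp
  · refine ⟨-1, ⟨1, 1⟩, fun i => ?_⟩
    rw [psiMatrix_one, if_pos rfl, psiMatrix_zero]
    have := one_add_I_ne_zero
    have h1 : ((⟨1, 1⟩ : GaussianInt) : ℂ) = 1 + Complex.I := by simp [GaussianInt.toComplex_def]
    simp only [h1, map_neg, map_one]
    field_simp
    ring

/-- Membership in T_k only says that some associated pair exists. The empty cylinder condition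
bounds `rad k p` by the least norm in the lattice, so `uVec` and `vVec` are minimal vectors
themselves and agree with that pair up to fourth roots of unity. -/
theorem mem_coordDomain_iff {k : ℕ} (hk : k = 1 ∨ k = 2) (p : ℝ × ℂ × ℂ) :
    p ∈ coordDomain k ↔ p.1 ∈ Ico 0 (Real.pi / 2) ∧ ‖p.2.1‖ < 1 ∧ ‖p.2.2‖ < 1 ∧
      IsAssociated (psi k p) (uVec k p) (vVec k p) := by
  refine and_congr_right fun _ => and_congr_right fun h1 => and_congr_right fun h2 => ?_
  have h12 := mul_ne_one_of_norm_lt h1 h2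
  have hr := rad_pos hk h12
  -- Because `|w₁|` and `|w₂|` are less than 1, the cylinder is the closed sup norm ball of radius
  -- `r`.
  have hcyl : interior (cylinder (uVec k p) (vVec k p)) = Metric.ball 0 (rad k p) := by
    rw [← interior_closedBall _ hr.ne']
    congr 1
    ext z
    rw [cylinder, mem_ofPred_eq, norm_uVec_zero, norm_vVec_zero, norm_uVec_one, norm_vVec_one,
      max_eq_left (by nlinarith), max_eq_right (by nlinarith), mem_closedBall_zero_iff,
      pi_norm_le_iff_of_nonneg hr.le, Fin.forall_fin_two]
  rw [hcyl]
  constructor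
  · rintro ⟨⟨u, v, h, hi⟩, hl⟩
    have hmin : ∀ y ∈ lattice (psi k p), y ≠ 0 → rad k p ≤ ‖y‖ := by
      intro y hy h0
      by_contra! hlt
      have : y ∈ (lattice (psi k p) : Set (Fin 2 → ℂ)) ∩ Metric.ball 0 (rad k p) :=
        ⟨hy, mem_ball_zero_iff.2 hlt⟩
      rw [hl] at this
      exact h0 this
    have hu0 : uVec k p ≠ 0 := fun h0 => by
      have := norm_uVec_zero k p
      rw [h0] at this
      simp at this
      linarith
    have hv0 : vVec k p ≠ 0 := fun h0 => by
      have := norm_vVec_one k p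
      rw [h0] at this
      simp at this
      linarith
    have hun : ‖uVec k p‖ ≤ rad k p := (pi_norm_le_iff_of_nonneg hr.le).2 fun i => by
      fin_cases i
      · exact (norm_uVec_zero k p).le
      · exact (norm_uVec_one k p).le.trans (by nlinarith)
    have hvn : ‖vVec k p‖ ≤ rad k p := (pi_norm_le_iff_of_nonneg hr.le).2 fun i => by
      fin_cases i
      · exact (norm_vVec_zero k p).le.trans (by nlinarith)
      · exact (norm_vVec_one k p).le
    have hle : rad k p ≤ ‖u 0‖ := h.norm_left ▸ hmin u h.left_mem h.left_ne_zero
    obtain ⟨ζ, hζ, hu | hu⟩ := h.only _ (uVec_mem_lattice hk h12) hu0 (hun.trans hle)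
    · obtain ⟨ξ, hξ, hv | hv⟩ := h.only _ (vVec_mem_lattice hk h12) hv0 (hvn.trans hle)
      · exfalso
        have e1 := norm_vVec_one k p
        have e2 := norm_uVec_zero k p
        have e3 := h.left_lt
        rw [hv] at e1
        rw [hu] at e2
        simp only [Pi.smul_apply, norm_smul, norm_eq_one_of_pow_four hζ,
          norm_eq_one_of_pow_four hξ, one_mul] at e1 e2
        linarith
      · rw [hu, hv]
        exact h.smul hζ hξ
    · exfalso
      have e1 := norm_uVec_zero k p
      have e2 := norm_uVec_one k p
      have e3 := h.right_lt
      have e4 := h.norm_eq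
      rw [hu] at e1 e2
      simp only [Pi.smul_apply, norm_smul, norm_eq_one_of_pow_four hζ, one_mul] at e1 e2
      nlinarith
  · intro h
    refine ⟨⟨_, _, h, ?_⟩, ?_⟩
    · rw [h.relIndex_eq_iff, det2_uVec_vVec hk h12, norm_detConst_sq hk]
    · ext y
      rw [mem_inter_iff, mem_ball_zero_iff, mem_singleton_iff, ← norm_uVec_zero]
      constructor
      · rintro ⟨hy, hlt⟩
        by_contra h0
        exact absurd (h.le_norm hy h0) (not_le.2 hlt)
      · rintro rfl
        exact ⟨zero_mem _, by simpa using h.pos⟩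

/-- The change of basis has Gaussian integer entries, and its determinant is 1 by multiplicativity.
-/
theorem mk_eq_of_columns_mem {x : LatticeSpace} {M : SL2C}
    (h : ∀ j, (fun i => entries M i j) ∈ lattice x) : QuotientGroup.mk M = x := by
  obtain ⟨N, rfl⟩ := QuotientGroup.mk_surjective x
  obtain ⟨a, b, hab⟩ := mem_lattice_mk.1 (h 0)
  obtain ⟨c, d, hcd⟩ := mem_lattice_mk.1 (h 1)
  have hdet : a * d - c * b = 1 := by
    apply GaussianInt.toComplex_inj.1
    have h1 := entries_det M
    rw [hab, hcd, hab, hcd] at h1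
    simp only [map_sub, map_mul, map_one]
    linear_combination h1 - ((a : ℂ) * d - c * b) * entries_det N
  have hM : M = N * Matrix.SpecialLinearGroup.map GaussianInt.toComplex
      (⟨!![a, c; b, d], by rw [Matrix.det_fin_two_of, hdet]⟩ :
        Matrix.SpecialLinearGroup (Fin 2) GaussianInt) := by
    apply entries_injective
    rw [entries_mul]
    funext i j
    fin_cases j
    · exact hab i
    · exact hcd i
  rw [eq_comm, mk_eq_mk_iff, hM, inv_mul_cancel_left]
  exact ⟨_, rfl⟩

/-- Multiplication by `i` shifts the argument by `π/2`, so the argument can be reduced modulo `π/2`.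
-/
theorem exists_rotation (z : ℂ) : ∃ ζ : ℂ, ζ ^ 4 = 1 ∧ ∃ θ ∈ Ico 0 (Real.pi / 2),
    ζ * z = ‖z‖ * Complex.exp (Complex.I * (θ : ℝ)) := by
  have hp : 0 < Real.pi / 2 := by positivity
  obtain ⟨n, θ, hθ, h1⟩ : ∃ n : ℤ, ∃ θ ∈ Ico 0 (Real.pi / 2),
      Complex.arg z = θ + n * (Real.pi / 2) :=
    ⟨toIcoDiv hp 0 (Complex.arg z), toIcoMod hp 0 (Complex.arg z),
      by simpa only [zero_add] using toIcoMod_mem_Ico hp 0 (Complex.arg z),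
      by simp⟩
  refine ⟨Complex.exp (-(n : ℂ) * (Real.pi / 2 * Complex.I)), ?_, θ, hθ, ?_⟩
  · rw [← Complex.exp_nat_mul, Complex.exp_eq_one_iff]
    refine ⟨-n, ?_⟩
    push_cast
    ring
  · conv_lhs => rw [← Complex.norm_mul_exp_arg_mul_I z, h1]
    rw [mul_left_comm, ← Complex.exp_add]
    congr 2
    push_cast
    ring

/-- All Gaussian integers of norm 1, respectively 2, are unit multiples of 1, respectively `1 + i`;
so the determinant can be normalized by a fourth root of unity. -/
theorem detConst_div_pow_four {δ : GaussianInt} {k : ℕ} (hk : k = 1 ∨ k = 2) (h : δ.norm = k) :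
    (detConst k / δ) ^ 4 = 1 := by
  have hδ : (δ : ℂ) ≠ 0 := by
    intro h0
    have := norm_toComplex_sq δ
    rw [h0, h] at this
    rcases hk with rfl | rfl <;> simp at this
  rw [div_pow, div_eq_one_iff_eq (pow_ne_zero _ hδ)]
  have h4 : (1 + Complex.I : ℂ) ^ 4 = -4 := by
    linear_combination (Complex.I ^ 2 + 4 * Complex.I + 5) * Complex.I_sq
  rcases hk with rfl | rfl
  · obtain ⟨h1, h2, h3, h4'⟩ := gaussianInt_norm_bounds (n := 1) (by norm_num) h.le
    rw [gaussianInt_norm_eq] at h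
    rw [GaussianInt.toComplex_def, detConst, if_neg (by norm_num), one_pow]
    generalize δ.re = x at *
    generalize δ.im = y at *
    interval_cases x <;> interval_cases y <;> norm_num at h <;> norm_num [Complex.I_pow_four, mul_pow]
  · obtain ⟨h1, h2, h3, h4'⟩ := gaussianInt_norm_bounds (n := 2) (by norm_num) h.le
    rw [gaussianInt_norm_eq] at h
    rw [GaussianInt.toComplex_def, detConst, if_pos rfl, h4]
    generalize δ.re = x at *
    generalize δ.im = y at *
    have e1 : (1 + -Complex.I : ℂ) ^ 4 = -4 := by
      linear_combination (Complex.I ^ 2 - 4 * Complex.I + 5) * Complex.I_sq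
    have e2 : (-1 + Complex.I : ℂ) ^ 4 = -4 := by rw [← e1]; ring
    have e3 : (-1 + -Complex.I : ℂ) ^ 4 = -4 := by rw [← h4]; ring
    interval_cases x <;> interval_cases y <;> norm_num at h <;> norm_num [h4, e1, e2, e3]

theorem rad_eq {k : ℕ} (hk : k = 1 ∨ k = 2) {p : ℝ × ℂ × ℂ} {r : ℝ} (hr : 0 < r)
    (h : ‖1 - p.2.1 * p.2.2‖ * r ^ 2 = ‖detConst k‖) : rad k p = r := by
  have hk0 : (0 : ℝ) < k := by rcases hk with rfl | rfl <;> norm_num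
  have hd : ‖detConst k‖ = √(k : ℝ) := by
    rw [← norm_detConst_sq hk, Real.sqrt_sq (norm_nonneg _)]
  have h4 : ((k : ℝ) ^ (1 / 4 : ℝ)) ^ 2 = √(k : ℝ) := by
    rw [← Real.rpow_natCast, ← Real.rpow_mul hk0.le, Real.sqrt_eq_rpow]
    norm_num
  have hn : ‖1 - p.2.1 * p.2.2‖ = ((k : ℝ) ^ (1 / 4 : ℝ) / r) ^ 2 := by
    rw [div_pow, h4, eq_div_iff (by positivity), h, hd]
  have hpos : (0 : ℝ) < (k : ℝ) ^ (1 / 4 : ℝ) := by positivity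
  rw [rad, hn, Real.sqrt_sq (by positivity)]
  field_simp

/-- Two parameters of one lattice give associated pairs differing by fourth roots of unity `ζ`, `ξ`;
the range of `θ` forces `ζ = 1` and the fixed determinant forces `ξ = 1`. Conversely, any associated
pair can be rotated to this normal form, and then `w₁`, `w₂` are ratios of its coordinates. -/
theorem bijOn_psi {k : ℕ} (hk : k = 1 ∨ k = 2) :
    BijOn (psi k) (coordDomain k) (transversalPiece k) := by
  refine ⟨fun p hp => hp.2.2.2.1, ?_, ?_⟩
  · intro p hp q hq hpq
    obtain ⟨hp0, hp1, hp2, hpa⟩ := (mem_coordDomain_iff hk p).1 hp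
    obtain ⟨hq0, hq1, hq2, hqa⟩ := (mem_coordDomain_iff hk q).1 hq
    rw [← hpq] at hqa
    have hp12 := mul_ne_one_of_norm_lt hp1 hp2
    have hq12 := mul_ne_one_of_norm_lt hq1 hq2
    have hr : rad k q = rad k p := by
      rw [← norm_uVec_zero, ← norm_uVec_zero]; exact hpa.norm_unique hqa
    have hrp := rad_pos hk hp12
    have hrc : (rad k p : ℂ) ≠ 0 := Complex.ofReal_ne_zero.2 hrp.ne'
    obtain ⟨ζ, hζ, hu⟩ := hpa.left_unique hqa
    obtain ⟨ξ, hξ, hv⟩ := hpa.right_unique hqa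
    have hu0 : uCoord q = ζ * uCoord p := by
      have := congrFun hu 0
      simp only [uVec, Matrix.cons_val_zero, Pi.smul_apply, smul_eq_mul, hr] at this
      apply mul_left_cancel₀ hrc
      linear_combination this
    have hθ : q.1 = p.1 := by
      have h4 : uCoord q ^ 4 = uCoord p ^ 4 := by rw [hu0, mul_pow, hζ, one_mul]
      unfold uCoord at h4
      rw [← Complex.exp_nat_mul, ← Complex.exp_nat_mul, Complex.exp_eq_exp_iff_exists_int] at h4
      obtain ⟨n, hn⟩ := h4
      have him := congrArg Complex.im hn
      simp at him
      have hpi := Real.pi_pos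
      obtain ⟨a1, a2⟩ := hp0
      obtain ⟨b1, b2⟩ := hq0
      have hn1 : (n : ℝ) < 1 := by nlinarith
      have hn2 : (-1 : ℝ) < n := by nlinarith
      have hn0 : n = 0 := by
        have h1 : n < 1 := by exact_mod_cast hn1
        have h2 : -1 < n := by exact_mod_cast hn2
        omega
      rw [hn0] at him
      simp at him
      linarith
    have hue : uCoord q = uCoord p := by rw [uCoord, uCoord, hθ]
    have hup : uCoord p ≠ 0 := Complex.exp_ne_zero _
    have hζ1 : ζ = 1 := by
      rw [hue] at hu0
      exact mul_right_cancel₀ hup (by rw [one_mul]; exact hu0.symm)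
    have hξ1 : ξ = 1 := by
      have h1 := det2_uVec_vVec hk hq12
      have h2 : det2 (ζ • uVec k p) (ξ • vVec k p) = ζ * ξ * det2 (uVec k p) (vVec k p) := by
        simp [det2]; ring
      rw [hu, hv, h2, det2_uVec_vVec hk hp12, hζ1, one_mul] at h1
      exact mul_right_cancel₀ (detConst_ne_zero k) (by rw [one_mul]; exact h1)
    rw [hζ1, one_smul] at hu
    rw [hξ1, one_smul] at hv
    have hw1 : q.2.1 = p.2.1 := by
      have := congrFun hv 0
      simp only [vVec, Matrix.cons_val_zero, hr, hue] at this
      exact mul_left_cancel₀ hup (mul_left_cancel₀ hrc this)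
    have hv1 : vCoord k q = vCoord k p := by
      have := congrFun hv 1
      simp only [vVec, Matrix.cons_val_one, hr] at this
      exact mul_left_cancel₀ hrc this
    have hw2 : q.2.2 = p.2.2 := by
      have := congrFun hu 1
      simp only [uVec, Matrix.cons_val_one, hr, hv1] at this
      exact mul_left_cancel₀ (Complex.exp_ne_zero _) (mul_left_cancel₀ hrc this)
    exact Prod.ext hθ.symm (Prod.ext hw1.symm hw2.symm)
  · rintro x ⟨u₀, v₀, h₀, hi⟩
    obtain ⟨δ, hδ, hdich⟩ := h₀.dichotomy
    have hnorm : δ.norm = k := by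
      rw [h₀.relIndex_eq_iff, hδ, norm_toComplex_sq] at hi
      exact_mod_cast hi
    obtain ⟨ζ, hζ, θ, hθ, hζu⟩ := exists_rotation (u₀ 0)
    have hζ0 : ζ ≠ 0 := by rintro rfl; simp at hζ
    -- Chosen so that `ζ ξ δ` is the prescribed determinant.
    set ξ : ℂ := detConst k / δ / ζ with hξdef
    have hξ : ξ ^ 4 = 1 := by rw [hξdef, div_pow, detConst_div_pow_four hk hnorm, hζ, div_one]
    have hδ0 : (δ : ℂ) ≠ 0 := hδ ▸ h₀.det2_ne_zero
    have h := h₀.smul hζ hξ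
    have hdet : det2 (ζ • u₀) (ξ • v₀) = detConst k := by
      have h2 : det2 (ζ • u₀) (ξ • v₀) = ζ * ξ * det2 u₀ v₀ := by simp [det2]; ring
      rw [h2, hδ, hξdef]
      field_simp
    have hu0 : (ζ • u₀) 0 = ‖(ζ • u₀) 0‖ * Complex.exp (Complex.I * (θ : ℝ)) := by
      rw [Pi.smul_apply, smul_eq_mul, norm_mul, norm_eq_one_of_pow_four hζ, one_mul, hζu]
    clear_value ξ
    generalize ζ • u₀ = u at *
    generalize ξ • v₀ = v at *
    set r := ‖u 0‖ with hr
    have hr0 : 0 < r := h.pos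
    have hu00 : u 0 ≠ 0 := norm_pos_iff.1 hr0
    have hv10 : v 1 ≠ 0 := norm_pos_iff.1 (h.norm_eq ▸ hr0)
    set p : ℝ × ℂ × ℂ := (θ, v 0 / u 0, u 1 / v 1) with hp
    have hp1 : ‖p.2.1‖ < 1 := by
      rw [hp, norm_div, div_lt_one hr0]; exact h.right_lt
    have hp2 : ‖p.2.2‖ < 1 := by
      rw [hp, norm_div, ← h.norm_eq, div_lt_one hr0]; exact h.left_lt
    have h12 := mul_ne_one_of_norm_lt hp1 hp2
    have hz : (1 - p.2.1 * p.2.2) * (u 0 * v 1) = detConst k := by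
      rw [← hdet, det2]
      simp only [hp]
      field_simp
    have hz0 : 1 - p.2.1 * p.2.2 ≠ 0 := sub_ne_zero.2 (Ne.symm h12)
    have hrad : rad k p = r := by
      apply rad_eq hk hr0
      rw [← hz, norm_mul, norm_mul, ← h.norm_eq, sq]
    have hU0 : uVec k p 0 = u 0 := by
      rw [hu0, ← hrad]; rfl
    have hV1 : vVec k p 1 = v 1 := by
      have h1 := det2_uVec_vVec hk h12
      have h2 : det2 (uVec k p) (vVec k p) =
          (1 - p.2.1 * p.2.2) * (uVec k p 0 * vVec k p 1) := by
        simp [det2, uVec, vVec]; ring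
      rw [h2, hU0, ← hz] at h1
      exact mul_left_cancel₀ hu00 (mul_left_cancel₀ hz0 h1)
    have hU : uVec k p = u := by
      funext i
      fin_cases i
      · exact hU0
      · change uVec k p 1 = u 1
        have : uVec k p 1 = vVec k p 1 * p.2.2 := by simp [uVec, vVec]; ring
        rw [this, hV1]
        simp only [hp]
        field_simp
    have hV : vVec k p = v := by
      funext i
      fin_cases i
      · change vVec k p 0 = v 0
        have : vVec k p 0 = uVec k p 0 * p.2.1 := by simp [uVec, vVec]; ring
        rw [this, hU0]
        simp only [hp]
        field_simp
      · exact hV1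
    have hx : psi k p = x := by
      rw [psi_eq]
      refine mk_eq_of_columns_mem fun j => ?_
      rw [entries_psiLift hk h12]
      fin_cases j
      · have : (fun i => psiMatrix k p i 0) = u := by
          rw [← hU]; funext i; exact psiMatrix_zero k p i
        exact this ▸ h.left_mem
      · change (fun i => psiMatrix k p i 1) ∈ lattice x
        rcases hk with rfl | rfl
        · have : (fun i => psiMatrix 1 p i 1) = v := by
            rw [← hV]; funext i; rw [psiMatrix_one, if_neg (by norm_num)]
          exact this ▸ h.right_mem
        · obtain ⟨δ', hδ', ⟨h1, -⟩ | ⟨-, -, hm⟩⟩ := h.dichotomy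
          · exfalso
            have h2 := norm_detConst_sq (k := 2) (Or.inr rfl)
            rw [← hdet, hδ', norm_toComplex_sq, h1] at h2
            norm_num at h2
          · have : (fun i => psiMatrix 2 p i 1) = (1 / (δ' : ℂ)) • (u + v) := by
              rw [← hδ', hdet, ← hU, ← hV]
              funext i
              rw [psiMatrix_one, if_pos rfl, detConst, if_pos rfl]
              rfl
            exact this ▸ hm
    refine ⟨p, (mem_coordDomain_iff hk p).2 ⟨hθ, hp1, hp2, ?_⟩, hx⟩
    rw [hx, hU, hV]
    exact h

/-! ### Measurability of the parametrizations -/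

theorem measurable_rad (k : ℕ) : Measurable (rad k) := by
  unfold rad
  fun_prop

theorem measurable_uCoord : Measurable uCoord := by
  unfold uCoord
  fun_prop

theorem measurable_vCoord (k : ℕ) : Measurable (vCoord k) := by
  unfold vCoord
  refine Complex.measurable_exp.comp (Measurable.const_mul (Complex.measurable_ofReal.comp ?_) _)
  exact (measurable_const.sub measurable_fst).sub (Complex.measurable_arg.comp (by fun_prop))

theorem measurable_uVec (k : ℕ) (i : Fin 2) : Measurable fun p => uVec k p i := by
  have h1 := Complex.measurable_ofReal.comp (measurable_rad k)
  fin_cases i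
  · exact h1.mul measurable_uCoord
  · exact h1.mul ((measurable_vCoord k).mul (by fun_prop))

theorem measurable_vVec (k : ℕ) (i : Fin 2) : Measurable fun p => vVec k p i := by
  have h1 := Complex.measurable_ofReal.comp (measurable_rad k)
  fin_cases i
  · exact h1.mul (measurable_uCoord.mul (by fun_prop))
  · exact h1.mul (measurable_vCoord k)

theorem measurable_psiMatrix (k : ℕ) (i j : Fin 2) : Measurable fun p => psiMatrix k p i j := by
  fin_cases j
  · simpa only [Fin.zero_eta, psiMatrix_zero] using measurable_uVec k i
  · simp only [Fin.mk_one, psiMatrix_one]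
    split_ifs
    · exact ((measurable_uVec k i).add (measurable_vVec k i)).const_mul _
    · exact measurable_vVec k i

theorem measurable_psiLift (k : ℕ) : Measurable (psiLift k) := by
  classical
  refine measurable_SL2C fun a b => ?_
  have h : (fun p => entries (psiLift k p) a b) = fun p =>
      if (psiMatrix k p).det = 1 then psiMatrix k p a b else entries 1 a b := by
    funext p
    split_ifs with h
    · have h2 : psiLift k p = (⟨psiMatrix k p, h⟩ : SL2C) := dif_pos h
      rw [h2]
      rfl
    · have h2 : psiLift k p = (1 : SL2C) := dif_neg h
      rw [h2]
  rw [h]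
  refine Measurable.ite ?_ (measurable_psiMatrix k a b) measurable_const
  simp only [Matrix.det_fin_two]
  exact measurableSet_eq_fun
    (((measurable_psiMatrix k 0 0).mul (measurable_psiMatrix k 1 1)).sub
      ((measurable_psiMatrix k 0 1).mul (measurable_psiMatrix k 1 0))) measurable_const

theorem measurable_psi (k : ℕ) : Measurable (psi k) := by
  have : psi k = QuotientGroup.mk ∘ psiLift k := funext (psi_eq k)
  rw [this]
  exact measurable_mk.comp (measurable_psiLift k)

/-- A reformulation with countable quantifiers and measurable conditions, from which measurability
of the coordinate domain follows. -/
theorem isAssociated_psi_iff {k : ℕ} (hk : k = 1 ∨ k = 2) {p : ℝ × ℂ × ℂ} (h1 : ‖p.2.1‖ < 1)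
    (h2 : ‖p.2.2‖ < 1) : IsAssociated (psi k p) (uVec k p) (vVec k p) ↔
      ∀ a b : GaussianInt, (fun i => psiMatrix k p i 0 * a + psiMatrix k p i 1 * b) = 0 ∨
        ‖uVec k p 0‖ < ‖fun i => psiMatrix k p i 0 * a + psiMatrix k p i 1 * b‖ ∨
        ∃ l : GaussianInt, (l : ℂ) ^ 4 = 1 ∧
          ((fun i => psiMatrix k p i 0 * a + psiMatrix k p i 1 * b) = (l : ℂ) • uVec k p ∨
            (fun i => psiMatrix k p i 0 * a + psiMatrix k p i 1 * b) = (l : ℂ) • vVec k p) := by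
  have h12 := mul_ne_one_of_norm_lt h1 h2
  have hr := rad_pos hk h12
  constructor
  · intro h a b
    by_contra! hc
    obtain ⟨hc1, hc2, hc3⟩ := hc
    obtain ⟨ζ, hζ, hy⟩ := h.only (fun i => psiMatrix k p i 0 * a + psiMatrix k p i 1 * b)
      (by rw [psi_eq, mem_lattice_mk, entries_psiLift hk h12]; exact ⟨a, b, fun i => rfl⟩) hc1 hc2
    obtain ⟨l, rfl⟩ := exists_gaussianInt_of_pow_four hζ
    rcases hy with hy | hy
    · exact (hc3 l hζ).1 hy
    · exact (hc3 l hζ).2 hy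
  · intro h
    refine ⟨uVec_mem_lattice hk h12, vVec_mem_lattice hk h12, ?_, ?_, ?_, ?_⟩
    · rw [norm_uVec_zero, norm_vVec_one]
    · rw [norm_uVec_zero, norm_uVec_one]; nlinarith
    · rw [norm_uVec_zero, norm_vVec_zero]; nlinarith
    · intro y hy h0 hle
      rw [psi_eq, mem_lattice_mk, entries_psiLift hk h12] at hy
      obtain ⟨a, b, hab⟩ := hy
      obtain rfl : y = _ := funext hab
      rcases h a b with h | h | ⟨l, hl, h⟩
      · exact absurd h h0
      · exact absurd h (not_lt.2 hle)
      · exact ⟨l, hl, h⟩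

theorem measurableSet_coordDomain {k : ℕ} (hk : k = 1 ∨ k = 2) :
    MeasurableSet (coordDomain k) := by
  have hy : ∀ a b : GaussianInt, Measurable fun p : ℝ × ℂ × ℂ =>
      (fun i => psiMatrix k p i 0 * (a : ℂ) + psiMatrix k p i 1 * (b : ℂ)) := fun a b =>
    measurable_pi_lambda _ fun i => ((measurable_psiMatrix k i 0).mul_const _).add
      ((measurable_psiMatrix k i 1).mul_const _)
  have hset : coordDomain k = {p : ℝ × ℂ × ℂ | p.1 ∈ Ico 0 (Real.pi / 2)} ∩
      ({p | ‖p.2.1‖ < 1} ∩ ({p | ‖p.2.2‖ < 1} ∩ {p | ∀ a b : GaussianInt,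
        (fun i => psiMatrix k p i 0 * a + psiMatrix k p i 1 * b) = 0 ∨
        ‖uVec k p 0‖ < ‖fun i => psiMatrix k p i 0 * a + psiMatrix k p i 1 * b‖ ∨
        ∃ l : GaussianInt, (l : ℂ) ^ 4 = 1 ∧
          ((fun i => psiMatrix k p i 0 * a + psiMatrix k p i 1 * b) = (l : ℂ) • uVec k p ∨
            (fun i => psiMatrix k p i 0 * a + psiMatrix k p i 1 * b) = (l : ℂ) • vVec k p)})) := by
    ext p
    rw [mem_coordDomain_iff hk]
    refine and_congr_right fun _ => and_congr_right fun h1 => and_congr_right fun h2 => ?_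
    exact isAssociated_psi_iff hk h1 h2
  rw [hset]
  have hu : Measurable (uVec k) := measurable_pi_lambda _ (measurable_uVec k)
  have hv : Measurable (vVec k) := measurable_pi_lambda _ (measurable_vVec k)
  refine (measurable_fst measurableSet_Ico).inter
    ((measurableSet_lt (by fun_prop) measurable_const).inter
      ((measurableSet_lt (by fun_prop) measurable_const).inter ?_))
  simp only [ofPred_forall, ofPred_or, ofPred_exists, ofPred_and]
  refine MeasurableSet.iInter fun a => MeasurableSet.iInter fun b => ?_
  refine (measurableSet_eq_fun (hy a b) measurable_const).union
    ((measurableSet_lt (measurable_uVec k 0).norm (hy a b).norm).union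
      (MeasurableSet.iUnion fun l => (MeasurableSet.const _).inter
        ((measurableSet_eq_fun (hy a b) (hu.const_smul (l : ℂ))).union
          (measurableSet_eq_fun (hy a b) (hv.const_smul (l : ℂ))))))

theorem psiLift_injOn {k : ℕ} (hk : k = 1 ∨ k = 2) : InjOn (psiLift k) (coordDomain k) :=
  fun p hp q hq h => (bijOn_psi hk).injOn hp hq (by rw [psi_eq, psi_eq, h])

theorem measurableSet_image_psi {k : ℕ} (hk : k = 1 ∨ k = 2) {E : Set (ℝ × ℂ × ℂ)}
    (hE : E ⊆ coordDomain k) (hm : MeasurableSet E) : MeasurableSet (psi k '' E) := by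
  have : psi k '' E = QuotientGroup.mk '' (psiLift k '' E) := by
    rw [image_image]
    exact image_congr fun p _ => psi_eq k p
  rw [this]
  exact measurableSet_image_mk (hm.image_of_measurable_injOn (measurable_psiLift k)
    ((psiLift_injOn hk).mono hE))

/-! ### The volume in flow coordinates -/

/-- Multiplication by a complex number has real determinant its squared modulus. -/
theorem setLIntegral_image_of_hasDerivAt {s : Set ℂ} (hs : MeasurableSet s) {f f' : ℂ → ℂ}
    (hd : ∀ x ∈ s, HasDerivAt f (f' x) x) (hinj : InjOn f s) (g : ℂ → ℝ≥0∞) :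
    ∫⁻ x in f '' s, g x = ∫⁻ x in s, ENNReal.ofReal (‖f' x‖ ^ 2) * g (f x) := by
  rw [lintegral_image_eq_lintegral_abs_det_fderiv_mul volume hs
    (fun x hx => ((hd x hx).hasFDerivAt.restrictScalars ℝ).hasFDerivWithinAt) hinj]
  refine setLIntegral_congr_fun hs fun x _ => ?_
  have h1 : (ContinuousLinearMap.restrictScalars ℝ
      (ContinuousLinearMap.toSpanSingleton ℂ (f' x))).det = ‖f' x‖ ^ 2 := by
    rw [← Complex.normSq_eq_norm_sq, ← Algebra.norm_complex_apply, Algebra.norm_apply]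
    change LinearMap.det _ = _
    congr 1
    ext
    simp [mul_comm]
  simp only [h1, abs_of_nonneg (sq_nonneg ‖f' x‖)]

/-- Tonelli reduces the change of one coordinate to its fibres. No regularity beyond measurability
is needed in the other variables, which matters because `rad` is not holomorphic in `w₁` and `w₂`.
-/
theorem setLIntegral_image_fiber {Y : Type*} [MeasurableSpace Y] [StandardBorelSpace Y]
    {ν : Measure Y} [SFinite ν] {S : Set (ℂ × Y)} (hS : MeasurableSet S) {f f' : ℂ × Y → ℂ}
    (hf : Measurable f) (hf' : Measurable f')
    (hd : ∀ z ∈ S, HasDerivAt (fun x => f (x, z.2)) (f' z) z.1)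
    (hinj : InjOn (fun z => (f z, z.2)) S) {g : ℂ × Y → ℝ≥0∞} (hg : Measurable g) :
    ∫⁻ z in (fun z => (f z, z.2)) '' S, g z ∂(volume.prod ν) =
      ∫⁻ z in S, ENNReal.ofReal (‖f' z‖ ^ 2) * g (f z, z.2) ∂(volume.prod ν) := by
  have hK : Measurable fun z : ℂ × Y => (f z, z.2) := hf.prodMk measurable_snd
  have hKS := hS.image_of_measurable_injOn hK hinj
  rw [← lintegral_indicator hKS, ← lintegral_indicator hS,
    lintegral_prod_symm' _ (hg.indicator hKS), lintegral_prod_symm' _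
      (Measurable.indicator (by fun_prop) hS)]
  refine lintegral_congr fun y => ?_
  have hSy : MeasurableSet {x | (x, y) ∈ S} := hS.preimage (by fun_prop)
  have hset : {x | (x, y) ∈ (fun z => (f z, z.2)) '' S} =
      (fun x => f (x, y)) '' {x | (x, y) ∈ S} := by
    ext x
    constructor
    · rintro ⟨⟨a, b⟩, h, h2⟩
      obtain ⟨rfl, rfl⟩ := Prod.ext_iff.1 h2
      exact ⟨a, h, rfl⟩
    · rintro ⟨a, h, rfl⟩
      exact ⟨(a, y), h, rfl⟩
  have hinjy : InjOn (fun x => f (x, y)) {x | (x, y) ∈ S} := fun a ha b hb hab =>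
    (Prod.ext_iff.1 (hinj ha hb (Prod.ext hab rfl))).1
  have hKy : MeasurableSet {x | (x, y) ∈ (fun z => (f z, z.2)) '' S} :=
    hKS.preimage (by fun_prop)
  calc ∫⁻ x, indicator ((fun z => (f z, z.2)) '' S) g (x, y)
      = ∫⁻ x in {x | (x, y) ∈ (fun z => (f z, z.2)) '' S}, g (x, y) := by
        rw [← lintegral_indicator hKy]; rfl
    _ = ∫⁻ x in {x | (x, y) ∈ S}, ENNReal.ofReal (‖f' (x, y)‖ ^ 2) * g (f (x, y), y) := by
        rw [hset]
        exact setLIntegral_image_of_hasDerivAt hSy (fun x hx => hd (x, y) hx) hinjy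
          fun x => g (x, y)
    _ = _ := by
        rw [← lintegral_indicator hSy]; rfl

/-- The cyclic permutation of the coordinates of `ℂ³`. -/
def cycle : ℂ × ℂ × ℂ ≃ᵐ ℂ × ℂ × ℂ := MeasurableEquiv.prodComm.trans MeasurableEquiv.prodAssoc

theorem measurePreserving_cycle : MeasurePreserving cycle :=
  Measure.measurePreserving_swap.trans volume_preserving_prodAssoc

/-- The permutation places the next variable to be changed in front, so three applications replace
all three variables. -/
theorem setLIntegral_image_cycle {S : Set (ℂ × ℂ × ℂ)} (hS : MeasurableSet S)
    {f f' : ℂ × ℂ × ℂ → ℂ} (hf : Measurable f) (hf' : Measurable f')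
    (hd : ∀ z ∈ S, HasDerivAt (fun x => f (x, z.2)) (f' z) z.1)
    (hinj : InjOn (fun z => (z.2.1, z.2.2, f z)) S) {g : ℂ × ℂ × ℂ → ℝ≥0∞}
    (hg : Measurable g) :
    ∫⁻ z in (fun z => (z.2.1, z.2.2, f z)) '' S, g z =
      ∫⁻ z in S, ENNReal.ofReal (‖f' z‖ ^ 2) * g (z.2.1, z.2.2, f z) := by
  have h1 : (fun z : ℂ × ℂ × ℂ => (z.2.1, z.2.2, f z)) '' S =
      cycle '' ((fun z => (f z, z.2)) '' S) := by
    rw [image_image]; rfl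
  rw [h1, ← measurePreserving_cycle.setLIntegral_comp_emb cycle.measurableEmbedding]
  refine (setLIntegral_image_fiber hS hf hf' hd (fun z hz w hw h => hinj hz hw ?_)
    (hg.comp cycle.measurable)).trans rfl
  exact congrArg cycle h

/-- The flow time and the coordinate `θ`, as one complex coordinate. -/
def flowCoord : ℝ × ℝ × ℂ × ℂ ≃ᵐ ℂ × ℂ × ℂ :=
  MeasurableEquiv.prodAssoc.symm.trans
    (Complex.measurableEquivRealProd.symm.prodCongr (MeasurableEquiv.refl _))

theorem measurePreserving_flowCoord : MeasurePreserving flowCoord :=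
  (volume_preserving_prodAssoc.symm _).trans
    ((Complex.volume_preserving_equiv_real_prod.symm _).prod (MeasurePreserving.id _))

theorem flowCoord_apply (q : ℝ × ℝ × ℂ × ℂ) : flowCoord q = (⟨q.1, q.2.1⟩, q.2.2) := rfl

/-- The first column of `psiMatrix k p` is scaled to `(1, ⋯)`, and then the second one starts with
`(basisShift k + w₁) / detConst k`. -/
def basisShift (k : ℕ) : ℂ := if k = 2 then 1 else 0

/-- The upper left entry, as a function of `(s, w₁, w₂)`. -/
def entryA (k : ℕ) (z : ℂ × ℂ × ℂ) : ℂ := Complex.exp z.1 * rad k (0, z.2)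

/-- The upper right entry, as a function of `(w₁, w₂, a)`. -/
def entryB (k : ℕ) (z : ℂ × ℂ × ℂ) : ℂ := z.2.2 * (basisShift k + z.1) / detConst k

/-- The lower left entry, as a function of `(w₂, a, b)`. -/
def entryC (k : ℕ) (z : ℂ × ℂ × ℂ) : ℂ :=
  detConst k * z.1 / (z.2.1 * (1 - (detConst k * z.2.2 / z.2.1 - basisShift k) * z.1))

/-- The entries `(a, b, c)` as functions of `(s, w₁, w₂)`. -/
def flowEntries (k : ℕ) (z : ℂ × ℂ × ℂ) : ℂ × ℂ × ℂ :=
  (entryA k z, entryB k (z.2.1, z.2.2, entryA k z),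
    entryC k (z.2.2, entryA k z, entryB k (z.2.1, z.2.2, entryA k z)))

theorem measurable_entryA (k : ℕ) : Measurable (entryA k) := by
  have := measurable_rad k
  unfold entryA
  fun_prop

/-- The map is the composition of the three one-variable changes `K₁`, `K₂`, `K₃`, each injective on
the image of the preceding ones. `K₃` needs `c` as a function of `(w₂, a, b)`, so `w₁` has been
eliminated in `entryC`. -/
theorem setLIntegral_flowEntries {k : ℕ} (hk : k = 1 ∨ k = 2) {S : Set (ℂ × ℂ × ℂ)}
    (hS : MeasurableSet S)
    (h : ∀ z ∈ S, z.1.im ∈ Ico 0 (Real.pi / 2) ∧ ‖z.2.1‖ < 1 ∧ ‖z.2.2‖ < 1) :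
    ∫⁻ z in flowEntries k '' S, chartDensity z =
      ∫⁻ z in S, ENNReal.ofReal (32 / ‖1 - z.2.1 * z.2.2‖ ^ 4) ∧ InjOn (flowEntries k) S ∧
      ∀ z ∈ S, entryA k z ≠ 0 := by
  have hκ := detConst_ne_zero k
  have h12 : ∀ z ∈ S, z.2.1 * z.2.2 ≠ 1 := fun z hz => mul_ne_one_of_norm_lt (h z hz).2.1 (h z hz).2.2
  have hρ : ∀ z ∈ S, (rad k (0, z.2) : ℂ) ≠ 0 := fun z hz =>
    Complex.ofReal_ne_zero.2 (rad_pos hk (p := (0, z.2)) (h12 z hz)).ne'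
  have hA : ∀ z ∈ S, entryA k z ≠ 0 := fun z hz => mul_ne_zero (Complex.exp_ne_zero _) (hρ z hz)
  set K₁ : ℂ × ℂ × ℂ → ℂ × ℂ × ℂ := fun z => (z.2.1, z.2.2, entryA k z) with hK₁
  set K₂ : ℂ × ℂ × ℂ → ℂ × ℂ × ℂ := fun z => (z.2.1, z.2.2, entryB k z) with hK₂
  set K₃ : ℂ × ℂ × ℂ → ℂ × ℂ × ℂ := fun z => (z.2.1, z.2.2, entryC k z) with hK₃
  have hA₁ := measurable_entryA k
  have hB₁ : Measurable (entryB k) := by unfold entryB; fun_prop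
  have hC₁ : Measurable (entryC k) := by unfold entryC; fun_prop
  have hi₁ : InjOn K₁ S := by
    rintro z hz w hw hzw
    simp only [hK₁, Prod.mk.injEq] at hzw
    obtain ⟨e1, e2, e3⟩ := hzw
    have e4 : z.2 = w.2 := Prod.ext e1 e2
    refine Prod.ext ?_ e4
    have hz1 := (h z hz).1
    have hw1 := (h w hw).1
    have hpi := Real.pi_pos
    -- The imaginary part of `s` is `θ` in `[0, π/2)`, inside a strip where the exponential is
    -- injective.
    refine Complex.exp_inj_of_neg_pi_lt_of_le_pi (by linarith [hz1.1]) (by linarith [hz1.2])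
      (by linarith [hw1.1]) (by linarith [hw1.2]) ?_
    unfold entryA at e3
    rw [← e4] at e3
    exact mul_right_cancel₀ (hρ z hz) e3
  have hS₁ : MeasurableSet (K₁ '' S) := hS.image_of_measurable_injOn (by fun_prop) hi₁
  have hi₂ : InjOn K₂ (K₁ '' S) := by
    rintro _ ⟨z, hz, rfl⟩ _ ⟨w, hw, rfl⟩ hzw
    simp only [hK₂, hK₁, entryB, Prod.mk.injEq] at hzw ⊢
    obtain ⟨e1, e2, e3⟩ := hzw
    refine ⟨?_, e1, e2⟩
    rw [← e2] at e3
    field_simp at e3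
    exact add_left_cancel (mul_left_cancel₀ (hA z hz) e3)
  have hS₂ : MeasurableSet (K₂ '' (K₁ '' S)) :=
    hS₁.image_of_measurable_injOn (by fun_prop) hi₂
  -- Solving `b = a(basisShift + w₁)/κ` for `w₁`.
  have hw : ∀ z ∈ S, detConst k * entryB k (K₁ z) / entryA k z - basisShift k = z.2.1 := by
    intro z hz
    have := hA z hz
    simp only [entryB, hK₁]
    field_simp
    ring
  have hi₃ : InjOn K₃ (K₂ '' (K₁ '' S)) := by
    rintro _ ⟨_, ⟨z, hz, rfl⟩, rfl⟩ _ ⟨_, ⟨w, hw', rfl⟩, rfl⟩ hzw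
    have a1 := hw z hz
    have a2 := hw w hw'
    have a3 := sub_ne_zero.2 (h12 z hz).symm
    have a4 := sub_ne_zero.2 (h12 w hw').symm
    have a5 := hA z hz
    simp only [hK₃, hK₂, Prod.mk.injEq] at hzw ⊢
    obtain ⟨e1, e2, e3⟩ := hzw
    refine ⟨?_, e1, e2⟩
    change entryA k z = entryA k w at e1
    change z.2.2 = w.2.2
    rw [← e1, ← e2] at a2
    have e4 : z.2.1 = w.2.1 := a1.symm.trans a2
    simp only [entryC] at e3
    change detConst k * z.2.2 / (entryA k z * (1 - (detConst k * entryB k (K₁ z) / entryA k z -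
      basisShift k) * z.2.2)) = detConst k * w.2.2 / (entryA k w * (1 - (detConst k *
      entryB k (K₁ w) / entryA k w - basisShift k) * w.2.2)) at e3
    rw [hw z hz, hw w hw', ← e1, ← e4] at e3
    rw [← e4] at a4
    rw [div_eq_div_iff (mul_ne_zero a5 a3) (mul_ne_zero a5 a4)] at e3
    refine mul_left_cancel₀ (mul_ne_zero hκ a5) ?_
    linear_combination e3
  have himg : flowEntries k '' S = K₃ '' (K₂ '' (K₁ '' S)) := by
    rw [image_image, image_image]; rfl
  refine ⟨?_, ?_, hA⟩
  · rw [himg, setLIntegral_image_cycle (f' := fun z => detConst k /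
        (z.2.1 * (1 - (detConst k * z.2.2 / z.2.1 - basisShift k) * z.1) ^ 2)) hS₂ hC₁
        (by fun_prop) ?_ hi₃ measurable_chartDensity,
      setLIntegral_image_cycle (f' := fun z => z.2.2 / detConst k) hS₁ hB₁ (by fun_prop) ?_ hi₂
        ?_,
      setLIntegral_image_cycle (f' := entryA k) hS hA₁ hA₁ ?_ hi₁ ?_]
    -- The squared derivatives `|a|²`, `|a/κ|²` and `|κ|²/(|a|²|1 - w₁w₂|⁴)` multiply with `32/|a|²`
    -- to the asserted density.
    · refine setLIntegral_congr_fun hS fun z hz => ?_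
      have a1 := hw z hz
      have a3 := sub_ne_zero.2 (h12 z hz).symm
      have a5 := hA z hz
      simp only [chartDensity]
      simp only [hK₁] at a1
      rw [a1, ← ENNReal.ofReal_mul (by positivity), ← ENNReal.ofReal_mul (by positivity),
        ← ENNReal.ofReal_mul (by positivity)]
      congr 1
      simp only [norm_div, norm_mul, norm_pow]
      have b1 := norm_ne_zero_iff.2 a3
      have b2 := norm_ne_zero_iff.2 a5
      have b3 := norm_ne_zero_iff.2 hκ
      field_simp
    · intro z hz
      simp only [entryA]
      exact (Complex.hasDerivAt_exp _).mul_const _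
    · unfold chartDensity
      fun_prop
    · intro z hz
      simp only [entryB]
      have := (((hasDerivAt_id z.1).const_add (basisShift k)).const_mul z.2.2).div_const (detConst k)
      simpa using this
    · unfold chartDensity
      fun_prop
    · rintro _ ⟨_, ⟨z, hz, rfl⟩, rfl⟩
      have a1 := hw z hz
      have a3 := sub_ne_zero.2 (h12 z hz).symm
      have a5 := hA z hz
      simp only [hK₁] at a1
      simp only [entryC, hK₂, hK₁]
      rw [a1]
      have h1 := ((hasDerivAt_id z.2.2).const_mul (detConst k)).div
        ((((hasDerivAt_id z.2.2).const_mul z.2.1).const_sub 1).const_mul (entryA k z))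
        (mul_ne_zero a5 a3)
      refine h1.congr_deriv ?_
      simp only [id]
      field_simp
      ring
  · exact hi₃.comp (hi₂.comp hi₁ (mapsTo_image _ _)) fun z hz =>
      mem_image_of_mem _ (mem_image_of_mem _ hz)

/-- The parametrization of flow boxes, lifted to `SL(2, ℂ)`. -/
def flowLift (k : ℕ) (q : ℝ × ℝ × ℂ × ℂ) : SL2C := diagFlow q.1 * psiLift k q.2

/-- The flow multiplies the first row by `e^t`, which combines with `e^{iθ}` to `exp(t + iθ)`. For
the lower left entry, `e^t` and `e^{-t}` cancel in `a c`, and the fixed determinant gives `a c (1 -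
w₁w₂) = κ w₂`. -/
theorem coords_flowLift {k : ℕ} (hk : k = 1 ∨ k = 2) {q : ℝ × ℝ × ℂ × ℂ}
    (h1 : ‖q.2.2.1‖ < 1) (h2 : ‖q.2.2.2‖ < 1) :
    coords (flowLift k q) = flowEntries k (flowCoord q) := by
  have h12 := mul_ne_one_of_norm_lt h1 h2
  have hr : (rad k q.2 : ℂ) ≠ 0 := Complex.ofReal_ne_zero.2 (rad_pos hk h12).ne'
  have hz := sub_ne_zero.2 h12.symm
  have hdet : rad k q.2 * uCoord q.2 * (rad k q.2 * vCoord k q.2) * (1 - q.2.2.1 * q.2.2.2) =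
      detConst k := by
    rw [← det2_uVec_vVec hk h12]
    simp [det2, uVec, vVec]
    ring
  have hA : entryA k (flowCoord q) = Complex.exp q.1 * (rad k q.2 * uCoord q.2) := by
    have : Complex.exp (⟨q.1, q.2.1⟩ : ℂ) = Complex.exp q.1 * uCoord q.2 := by
      rw [uCoord, ← Complex.exp_add, mul_comm, Complex.mk_eq_add_mul_I]
    have h3 : rad k (0, (flowCoord q).2) = rad k q.2 := rfl
    rw [entryA, h3, flowCoord_apply, this]
    ring
  have hA0 : entryA k (flowCoord q) ≠ 0 := by
    rw [hA]
    exact mul_ne_zero (Complex.exp_ne_zero _) (mul_ne_zero hr (Complex.exp_ne_zero _))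
  have hκ := detConst_ne_zero k
  have e0 : entries (flowLift k q) 0 0 = entryA k (flowCoord q) := by
    rw [flowLift, entries_mul, entries_psiLift hk h12, hA]
    simp [mulEntries, entries, diagFlow, psiMatrix_zero, uVec]
  have e1 : entries (flowLift k q) 0 1 =
      entryA k (flowCoord q) * (basisShift k + q.2.2.1) / detConst k := by
    rw [flowLift, entries_mul, entries_psiLift hk h12, hA]
    rcases hk with rfl | rfl
    · simp [mulEntries, entries, diagFlow, psiMatrix_one, vVec, basisShift, detConst]
      ring
    · simp [mulEntries, entries, diagFlow, psiMatrix_one, uVec, vVec, basisShift, detConst]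
      ring
  have e2 : entries (flowLift k q) 1 0 = detConst k * q.2.2.2 /
      (entryA k (flowCoord q) * (1 - q.2.2.1 * q.2.2.2)) := by
    rw [eq_div_iff (mul_ne_zero hA0 hz), ← hdet, hA, flowLift, entries_mul,
      entries_psiLift hk h12]
    have hexp : Complex.exp (-(q.1 : ℂ)) * Complex.exp q.1 = 1 := by
      rw [← Complex.exp_add]; simp
    simp [mulEntries, entries, diagFlow, psiMatrix_zero, uVec]
    linear_combination (rad k q.2 * (vCoord k q.2 * q.2.2.2) * (rad k q.2 * uCoord q.2) *
      (1 - q.2.2.1 * q.2.2.2)) * hexp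
  have e3 : entryC k (q.2.2.2, entryA k (flowCoord q),
      entryB k (q.2.2.1, q.2.2.2, entryA k (flowCoord q))) = detConst k * q.2.2.2 /
      (entryA k (flowCoord q) * (1 - q.2.2.1 * q.2.2.2)) := by
    have : detConst k * entryB k (q.2.2.1, q.2.2.2, entryA k (flowCoord q)) /
        entryA k (flowCoord q) - basisShift k = q.2.2.1 := by
      simp only [entryB]
      field_simp
      ring
    simp only [entryC]
    rw [this]
  rw [coords, e0, e1, e2]
  exact Prod.ext rfl (Prod.ext rfl e3.symm)

theorem continuous_diagFlow : Continuous diagFlow := by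
  refine isClosedEmbedding_entries.isInducing.continuous_iff.2 ?_
  refine continuous_pi fun a => continuous_pi fun b => ?_
  fin_cases a <;> fin_cases b <;> simp [entries, diagFlow] <;> fun_prop

theorem measurable_flowLift (k : ℕ) : Measurable (flowLift k) :=
  (continuous_diagFlow.measurable.comp measurable_fst).mul
    ((measurable_psiLift k).comp measurable_snd)

theorem volMeasure_flowLift {k : ℕ} (hk : k = 1 ∨ k = 2) {E : Set (ℝ × ℂ × ℂ)}
    (hE : E ⊆ coordDomain k) (hm : MeasurableSet E) (ε : ℝ) :
    MeasurableSet (flowLift k '' (Ico 0 ε ×ˢ E)) ∧ InjOn (flowLift k) (Ico 0 ε ×ˢ E) ∧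
    volMeasure (flowLift k '' (Ico 0 ε ×ˢ E)) =
      ENNReal.ofReal ε * ∫⁻ p in E, ENNReal.ofReal (32 / ‖1 - p.2.1 * p.2.2‖ ^ 4) := by
  have hB : MeasurableSet (Ico 0 ε ×ˢ E) := measurableSet_Ico.prod hm
  have hS : MeasurableSet (flowCoord '' (Ico 0 ε ×ˢ E)) := flowCoord.measurableSet_image.2 hB
  have hmem : ∀ q ∈ Ico 0 ε ×ˢ E, q.2.1 ∈ Ico 0 (Real.pi / 2) ∧ ‖q.2.2.1‖ < 1 ∧ ‖q.2.2.2‖ < 1 :=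
    fun q hq => ⟨(hE hq.2).1, (hE hq.2).2.1, (hE hq.2).2.2.1⟩
  obtain ⟨h1, h2, h3⟩ := setLIntegral_flowEntries hk hS
    (by rintro _ ⟨q, hq, rfl⟩; exact hmem q hq)
  have hco : ∀ q ∈ Ico 0 ε ×ˢ E, coords (flowLift k q) = flowEntries k (flowCoord q) :=
    fun q hq => coords_flowLift hk (hmem q hq).2.1 (hmem q hq).2.2
  have hinj : InjOn (flowLift k) (Ico 0 ε ×ˢ E) := fun q hq q' hq' h =>
    flowCoord.injective (h2 (mem_image_of_mem _ hq) (mem_image_of_mem _ hq')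
      (by rw [← hco q hq, ← hco q' hq', h]))
  have hme := hB.image_of_measurable_injOn (measurable_flowLift k) hinj
  refine ⟨hme, hinj, ?_⟩
  have hset : coords '' (flowLift k '' (Ico 0 ε ×ˢ E) ∩ {g | entries g 0 0 ≠ 0}) =
      flowEntries k '' (flowCoord '' (Ico 0 ε ×ˢ E)) := by
    have : flowLift k '' (Ico 0 ε ×ˢ E) ∩ {g | entries g 0 0 ≠ 0} =
        flowLift k '' (Ico 0 ε ×ˢ E) := by
      rw [inter_eq_left]
      rintro _ ⟨q, hq, rfl⟩
      have := congrArg Prod.fst (hco q hq)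
      exact fun h0 => h3 _ (mem_image_of_mem _ hq) (this.symm.trans h0)
    rw [this, image_image, image_image]
    exact image_congr hco
  rw [volMeasure_apply hme, hset, h1,
    ← measurePreserving_flowCoord.setLIntegral_comp_emb flowCoord.measurableEmbedding]
  change ∫⁻ q in Ico 0 ε ×ˢ E, ENNReal.ofReal (32 / ‖1 - q.2.2.1 * q.2.2.2‖ ^ 4)
    ∂((volume : Measure ℝ).prod (volume : Measure (ℝ × ℂ × ℂ))) = _
  rw [← Measure.prod_restrict, lintegral_prod _ (by fun_prop)]
  change ∫⁻ _ in Ico 0 ε, (∫⁻ p in E, ENNReal.ofReal (32 / ‖1 - p.2.1 * p.2.2‖ ^ 4)) = _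
  rw [lintegral_const, Measure.restrict_apply_univ, Real.volume_Ico, sub_zero, mul_comm]

/-! ### The induced measure on the transversal -/

theorem diagFlow_mul (s t : ℝ) : diagFlow s * diagFlow t = diagFlow (s + t) := by
  apply entries_injective
  rw [entries_mul]
  funext a b
  fin_cases a <;> fin_cases b <;>
    simp [mulEntries, entries, diagFlow, Complex.exp_add, mul_comm]

theorem diagFlow_zero : diagFlow 0 = 1 := by
  have h := diagFlow_mul 0 0
  rwa [add_zero, mul_eq_left] at h

theorem diagFlow_mem_lattice {x : LatticeSpace} {y : Fin 2 → ℂ} (hy : y ∈ lattice x) (t : ℝ) :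
    ![(Real.exp t : ℂ) * y 0, (Real.exp (-t) : ℂ) * y 1] ∈ lattice (diagFlow t • x) := by
  obtain ⟨M, rfl⟩ := QuotientGroup.mk_surjective x
  obtain ⟨a, b, hab⟩ := mem_lattice_mk.1 hy
  change _ ∈ lattice (QuotientGroup.mk (diagFlow t * M))
  refine mem_lattice_mk.2 ⟨a, b, fun i => ?_⟩
  rw [entries_mul]
  have e00 : entries (diagFlow t) 0 0 = (Real.exp t : ℂ) := rfl
  have e01 : entries (diagFlow t) 0 1 = 0 := rfl
  have e10 : entries (diagFlow t) 1 0 = 0 := rfl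
  have e11 : entries (diagFlow t) 1 1 = (Real.exp (-t) : ℂ) := rfl
  fin_cases i
  · simp only [Fin.zero_eta, Matrix.cons_val_zero, hab, mulEntries, e00, e01]
    ring
  · simp only [Fin.mk_one, Matrix.cons_val_one, Matrix.cons_val_fin_one, hab, mulEntries, e10, e11]
    ring

/-- A return after time τ > 0 would make the minima of the two lattices incompatible. The flow
contracts the long coordinate of `v'`, while the short one stays below it; pulling the minimal
vector `u` back then gives a vector shorter than the minimum of `y`. -/
theorem eq_zero_of_diagFlow_smul {ε τ : ℝ} (h0 : 0 ≤ τ) (hτ : τ < ε) {x y : LatticeSpace}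
    {u v u' v' : Fin 2 → ℂ} (hx : IsAssociated x u v) (hy : IsAssociated y u' v')
    (hv : ‖v' 0‖ ≤ Real.exp (-(2 * ε)) * ‖u' 0‖) (hxy : x = diagFlow τ • y) : τ = 0 := by
  by_contra hne
  have hpos : 0 < τ := lt_of_le_of_ne h0 (Ne.symm hne)
  have hr := hx.pos
  have hr' := hy.pos
  -- The vector `g_τ v'` has sup norm at most `e^{-τ} ‖u' 0‖`. This is where the factor `e^{-2ε}`
  -- with `τ < ε` enters.
  have hle : ‖u 0‖ ≤ Real.exp (-τ) * ‖u' 0‖ := by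
    have hmem := diagFlow_mem_lattice hy.right_mem τ
    rw [← hxy] at hmem
    have hv1 : v' 1 ≠ 0 := norm_pos_iff.1 (hy.norm_eq ▸ hr')
    refine (hx.le_norm hmem fun h => ?_).trans ?_
    · have := congrFun h 1
      simp [hv1] at this
    · refine (pi_norm_le_iff_of_nonneg (by positivity)).2 fun i => ?_
      fin_cases i
      · simp only [Fin.zero_eta, Matrix.cons_val_zero, norm_mul, Complex.norm_real,
          Real.norm_eq_abs, Real.abs_exp]
        calc Real.exp τ * ‖v' 0‖ ≤ Real.exp τ * (Real.exp (-(2 * ε)) * ‖u' 0‖) := by gcongr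
          _ = Real.exp (τ + -(2 * ε)) * ‖u' 0‖ := by rw [Real.exp_add]; ring
          _ ≤ Real.exp (-τ) * ‖u' 0‖ := by gcongr; linarith
      · simp only [Fin.mk_one, Matrix.cons_val_one, Matrix.cons_val_fin_one, norm_mul, Complex.norm_real,
          Real.norm_eq_abs, Real.abs_exp]
        rw [hy.norm_eq]
  -- For `g_{-τ} u`, the first coordinate is at most `e^{-2τ} ‖u' 0‖`, and the second is less than
  -- `e^τ ‖u 0‖`, hence less than `‖u' 0‖`.
  have hmem := diagFlow_mem_lattice hx.left_mem (-τ)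
  rw [hxy, smul_smul, diagFlow_mul, neg_add_cancel, diagFlow_zero, one_smul, neg_neg] at hmem
  have hu0 : u 0 ≠ 0 := norm_pos_iff.1 hr
  refine absurd (hy.le_norm hmem fun h => ?_) (not_le.2 ?_)
  · have := congrFun h 0
    simp [hu0] at this
  · refine (pi_norm_lt_iff hr').2 fun i => ?_
    have hexp : Real.exp τ * (Real.exp (-τ) * ‖u' 0‖) = ‖u' 0‖ := by
      rw [← mul_assoc, ← Real.exp_add]; simp
    fin_cases i
    · simp only [Fin.zero_eta, Matrix.cons_val_zero, norm_mul, Complex.norm_real,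
        Real.norm_eq_abs, Real.abs_exp]
      have h1 : Real.exp (-τ) < 1 := by simpa using hpos
      have h2 := Real.exp_pos (-τ)
      nlinarith
    · simp only [Fin.mk_one, Matrix.cons_val_one, Matrix.cons_val_fin_one, norm_mul, Complex.norm_real,
        Real.norm_eq_abs, Real.abs_exp]
      rw [← hexp]
      have := hx.left_lt.trans_le hle
      gcongr

theorem injOn_diagFlow_smul {k : ℕ} (hk : k = 1 ∨ k = 2) {ε : ℝ} {E : Set (ℝ × ℂ × ℂ)}
    (hE : E ⊆ coordDomain k) (hw : ∀ p ∈ E, ‖p.2.1‖ ≤ Real.exp (-(2 * ε))) :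
    InjOn (fun q : ℝ × LatticeSpace => diagFlow q.1 • q.2) (Ico 0 ε ×ˢ (psi k '' E)) := by
  have key : ∀ t ∈ Ico 0 ε, ∀ s ∈ Ico 0 ε, t ≤ s → ∀ x ∈ psi k '' E, ∀ y ∈ psi k '' E,
      diagFlow t • x = diagFlow s • y → t = s ∧ x = y := by
    rintro t ht s hs hts _ ⟨p, hp, rfl⟩ _ ⟨q, hq, rfl⟩ h
    have hxy : psi k p = diagFlow (s - t) • psi k q := by
      have := congrArg (diagFlow (-t) • ·) h
      simp only [smul_smul, diagFlow_mul, neg_add_cancel, diagFlow_zero, one_smul] at this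
      rw [this]
      congr 2
      ring
    have h0 := eq_zero_of_diagFlow_smul (ε := ε) (sub_nonneg.2 hts) (by linarith [ht.1, hs.2])
      ((mem_coordDomain_iff hk p).1 (hE hp)).2.2.2 ((mem_coordDomain_iff hk q).1 (hE hq)).2.2.2
      (by
        rw [norm_vVec_zero, norm_uVec_zero, mul_comm]
        exact mul_le_mul_of_nonneg_right (hw q hq) (rad_nonneg k q)) hxy
    refine ⟨(sub_eq_zero.1 h0).symm, ?_⟩
    rw [hxy, h0, diagFlow_zero, one_smul]
  rintro ⟨t, x⟩ ⟨ht, hx⟩ ⟨s, y⟩ ⟨hs, hy⟩ h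
  rcases le_total t s with hts | hts
  · obtain ⟨h1, h2⟩ := key t ht s hs hts x hx y hy h
    exact Prod.ext h1 h2
  · obtain ⟨h1, h2⟩ := key s hs t ht hts y hy x hx h.symm
    exact Prod.ext h1.symm h2.symm

theorem image_diagFlow_smul (k : ℕ) (ε : ℝ) (E : Set (ℝ × ℂ × ℂ)) :
    (fun q : ℝ × LatticeSpace => diagFlow q.1 • q.2) '' (Ico 0 ε ×ˢ (psi k '' E)) =
      QuotientGroup.mk '' (flowLift k '' (Ico 0 ε ×ˢ E)) := by
  have h : Ico 0 ε ×ˢ (psi k '' E) = Prod.map id (psi k) '' (Ico 0 ε ×ˢ E) := by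
    rw [prodMap_image_prod, image_id]
  rw [h, image_image, image_image]
  refine image_congr fun q _ => ?_
  simp only [Prod.map_fst, Prod.map_snd, psi_eq]
  rfl

/-- Injectivity of the box in Ω₁ means that its lift injects into the quotient, so `m` of the box is
the volume of the lift. -/
theorem IsQuotientMeasure.measure_image_diagFlow_smul {m : Measure LatticeSpace}
    (hm : IsQuotientMeasure volMeasure m) {k : ℕ} (hk : k = 1 ∨ k = 2) {E : Set (ℝ × ℂ × ℂ)}
    (hE : E ⊆ coordDomain k) (hmE : MeasurableSet E) {ε : ℝ}
    (hinj : InjOn (fun q : ℝ × LatticeSpace => diagFlow q.1 • q.2)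
      (Ico 0 ε ×ˢ (psi k '' E))) :
    MeasurableSet ((fun q : ℝ × LatticeSpace => diagFlow q.1 • q.2) ''
        (Ico 0 ε ×ˢ (psi k '' E))) ∧
      m ((fun q : ℝ × LatticeSpace => diagFlow q.1 • q.2) '' (Ico 0 ε ×ˢ (psi k '' E))) =
        ENNReal.ofReal ε * ∫⁻ p in E, ENNReal.ofReal (32 / ‖1 - p.2.1 * p.2.2‖ ^ 4) := by
  obtain ⟨h1, -, h3⟩ := volMeasure_flowLift hk hE hmE ε
  rw [image_diagFlow_smul]
  refine ⟨measurableSet_image_mk h1, ?_⟩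
  rw [hm.measure_image h1, h3]
  rintro _ ⟨q, hq, rfl⟩ _ ⟨q', hq', rfl⟩ h
  have hq1 : ((q.1, psi k q.2) : ℝ × LatticeSpace) ∈ Ico 0 ε ×ˢ (psi k '' E) :=
    ⟨hq.1, mem_image_of_mem _ hq.2⟩
  have hq2 : ((q'.1, psi k q'.2) : ℝ × LatticeSpace) ∈ Ico 0 ε ×ˢ (psi k '' E) :=
    ⟨hq'.1, mem_image_of_mem _ hq'.2⟩
  have h4 := hinj hq1 hq2 (by
    simp only [psi_eq]
    exact h)
  simp only [Prod.mk.injEq] at h4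
  have h5 : q = q' := Prod.ext h4.1 ((bijOn_psi hk).injOn (hE hq.2) (hE hq'.2) h4.2)
  rw [h5]

/-- The measure with density `32 / |1 - w₁ w₂|⁴` in the coordinates on `T_k`. -/
def pieceMeasure (k : ℕ) : Measure LatticeSpace :=
  ((volume.restrict (coordDomain k)).withDensity
    fun p => ENNReal.ofReal (32 / ‖1 - p.2.1 * p.2.2‖ ^ 4)).map (psi k)

theorem pieceMeasure_apply {k : ℕ} {A : Set LatticeSpace} (hA : MeasurableSet A) :
    pieceMeasure k A = ∫⁻ p in psi k ⁻¹' A ∩ coordDomain k,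
      ENNReal.ofReal (32 / ‖1 - p.2.1 * p.2.2‖ ^ 4) := by
  rw [pieceMeasure, Measure.map_apply (measurable_psi k) hA,
    withDensity_apply _ (measurable_psi k hA), Measure.restrict_restrict (measurable_psi k hA)]

theorem pieceMeasure_image {k : ℕ} (hk : k = 1 ∨ k = 2) {E : Set (ℝ × ℂ × ℂ)}
    (hE : E ⊆ coordDomain k) (hm : MeasurableSet E) :
    pieceMeasure k (psi k '' E) = ∫⁻ p in E, ENNReal.ofReal (32 / ‖1 - p.2.1 * p.2.2‖ ^ 4) := by
  rw [pieceMeasure_apply (measurableSet_image_psi hk hE hm)]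
  congr 2
  ext p
  constructor
  · rintro ⟨⟨q, hq, hqp⟩, hp⟩
    exact (bijOn_psi hk).injOn (hE hq) hp hqp ▸ hq
  · exact fun hp => ⟨mem_image_of_mem _ hp, hE hp⟩

theorem inter_transversalPiece {k : ℕ} (hk : k = 1 ∨ k = 2) (A : Set LatticeSpace) :
    A ∩ transversalPiece k = psi k '' (psi k ⁻¹' A ∩ coordDomain k) := by
  rw [image_preimage_inter, (bijOn_psi hk).image_eq]

theorem measurableSet_transversalPiece {k : ℕ} (hk : k = 1 ∨ k = 2) :
    MeasurableSet (transversalPiece k) := by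
  rw [← (bijOn_psi hk).image_eq]
  exact measurableSet_image_psi hk Subset.rfl (measurableSet_coordDomain hk)

theorem measurableSet_transversal : MeasurableSet transversal := by
  rw [transversal_eq_union]
  exact (measurableSet_transversalPiece (Or.inl rfl)).union
    (measurableSet_transversalPiece (Or.inr rfl))

theorem isInducedMeasure_pieceMeasure_add {m : Measure LatticeSpace}
    (hm : IsQuotientMeasure volMeasure m) :
    IsInducedMeasure m (pieceMeasure 1 + pieceMeasure 2) where
  null_compl := by
    have key : ∀ k : ℕ, k = 1 ∨ k = 2 → pieceMeasure k transversalᶜ = 0 := by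
      intro k hk
      rw [pieceMeasure_apply measurableSet_transversal.compl]
      have : psi k ⁻¹' transversalᶜ ∩ coordDomain k = ∅ := by
        rw [eq_empty_iff_forall_notMem]
        rintro p ⟨h1, h2⟩
        obtain ⟨u, v, h, -⟩ := (bijOn_psi hk).mapsTo h2
        exact h1 ⟨u, v, h⟩
      rw [this, Measure.restrict_empty, lintegral_zero_measure]
    rw [Measure.add_apply, key 1 (Or.inl rfl), key 2 (Or.inr rfl), add_zero]
  flow_box := by
    intro A hA hmA ε hε hinj
    have h1 : (1 : ℕ) = 1 ∨ (1 : ℕ) = 2 := Or.inl rfl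
    have h2 : (2 : ℕ) = 1 ∨ (2 : ℕ) = 2 := Or.inr rfl
    set E : ℕ → Set (ℝ × ℂ × ℂ) := fun k => psi k ⁻¹' A ∩ coordDomain k
    have hE : ∀ k, E k ⊆ coordDomain k := fun k => inter_subset_right
    have hmE : ∀ k, k = 1 ∨ k = 2 → MeasurableSet (E k) := fun k hk =>
      (measurable_psi k hmA).inter (measurableSet_coordDomain hk)
    have hsub : ∀ k, psi k '' E k ⊆ A := by
      rintro k _ ⟨p, hp, rfl⟩
      exact hp.1
    have hAE : A = psi 1 '' E 1 ∪ psi 2 '' E 2 := by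
      rw [← inter_transversalPiece h1, ← inter_transversalPiece h2, ← inter_union_distrib_left,
        ← transversal_eq_union, inter_eq_left.2 hA]
    have hdisj : Disjoint (psi 1 '' E 1) (psi 2 '' E 2) := by
      rw [← inter_transversalPiece h1, ← inter_transversalPiece h2]
      exact disjoint_transversalPiece.mono inter_subset_right inter_subset_right
    have hinjE : ∀ k, InjOn (fun q : ℝ × LatticeSpace => diagFlow q.1 • q.2)
        (Ico 0 ε ×ˢ (psi k '' E k)) := fun k => hinj.mono (prod_mono_right (hsub k))
    obtain ⟨-, b1⟩ := hm.measure_image_diagFlow_smul h1 (hE 1) (hmE 1 h1) (hinjE 1)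
    obtain ⟨a2, b2⟩ := hm.measure_image_diagFlow_smul h2 (hE 2) (hmE 2 h2) (hinjE 2)
    have hd : Disjoint
        ((fun q : ℝ × LatticeSpace => diagFlow q.1 • q.2) '' (Ico 0 ε ×ˢ (psi 1 '' E 1)))
        ((fun q : ℝ × LatticeSpace => diagFlow q.1 • q.2) '' (Ico 0 ε ×ˢ (psi 2 '' E 2))) := by
      rw [disjoint_left]
      rintro _ ⟨q, hq, rfl⟩ ⟨q', hq', h⟩
      have := hinj ⟨hq'.1, hsub 2 hq'.2⟩ ⟨hq.1, hsub 1 hq.2⟩ h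
      rw [this] at hq'
      exact disjoint_left.1 hdisj hq.2 hq'.2
    have hν : (pieceMeasure 1 + pieceMeasure 2) A =
        (∫⁻ p in E 1, ENNReal.ofReal (32 / ‖1 - p.2.1 * p.2.2‖ ^ 4)) +
          ∫⁻ p in E 2, ENNReal.ofReal (32 / ‖1 - p.2.1 * p.2.2‖ ^ 4) := by
      rw [Measure.add_apply, pieceMeasure_apply hmA, pieceMeasure_apply hmA]
    rw [hν, mul_add, ← b1, ← b2, ← measure_union hd a2, ← image_union, ← prod_union, ← hAE]

/-- Flow boxes determine `ν` on sets with `|w₁|` bounded away from 1, by cancelling the positive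
finite factor ε. Any `E` is the increasing union of such sets. -/
theorem IsInducedMeasure.measure_image {m ν : Measure LatticeSpace}
    (hm : IsQuotientMeasure volMeasure m) (hν : IsInducedMeasure m ν) {k : ℕ}
    (hk : k = 1 ∨ k = 2) {E : Set (ℝ × ℂ × ℂ)} (hE : E ⊆ coordDomain k)
    (hmE : MeasurableSet E) :
    ν (psi k '' E) = ∫⁻ p in E, ENNReal.ofReal (32 / ‖1 - p.2.1 * p.2.2‖ ^ 4) := by
  have key : ∀ F ⊆ coordDomain k, MeasurableSet F → ∀ ε > 0,
      (∀ p ∈ F, ‖p.2.1‖ ≤ Real.exp (-(2 * ε))) → ν (psi k '' F) = pieceMeasure k (psi k '' F) := by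
    intro F hF hmF ε hε hw
    have hinj := injOn_diagFlow_smul hk hF hw
    have hsub : psi k '' F ⊆ transversal := by
      rintro _ ⟨p, hp, rfl⟩
      obtain ⟨u, v, h, -⟩ := (bijOn_psi hk).mapsTo (hF hp)
      exact ⟨u, v, h⟩
    have h1 := hν.flow_box _ hsub (measurableSet_image_psi hk hF hmF) ε hε hinj
    rw [(hm.measure_image_diagFlow_smul hk hF hmF hinj).2] at h1
    rw [pieceMeasure_image hk hF hmF]
    exact ((ENNReal.mul_right_inj (ENNReal.ofReal_pos.2 hε).ne' ENNReal.ofReal_ne_top).1 h1).symm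
  -- The box length is `ε = 1/(n + 1)`; the bounds `e^{-2ε}` increase to 1, so every point with
  -- `|w₁| < 1` is eventually included.
  set F : ℕ → Set (ℝ × ℂ × ℂ) := fun n => E ∩ {p | ‖p.2.1‖ ≤ Real.exp (-(2 * (1 / (n + 1))))}
  have hmono : Monotone F := by
    intro a b hab p hp
    refine ⟨hp.1, le_trans hp.2 (Real.exp_le_exp.2 ?_)⟩
    have : (1 : ℝ) / (b + 1) ≤ 1 / (a + 1) := by gcongr
    linarith
  have hU : ⋃ n, F n = E := by
    rw [← inter_iUnion, inter_eq_left]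
    intro p hp
    have hp1 := (hE hp).2.1
    have hlim : Filter.Tendsto (fun n : ℕ => Real.exp (-(2 * (1 / ((n : ℝ) + 1)))))
        Filter.atTop (nhds (Real.exp (-(2 * 0)))) :=
      (Real.continuous_exp.tendsto _).comp
        ((tendsto_one_div_add_atTop_nhds_zero_nat.const_mul 2).neg)
    rw [mul_zero, neg_zero, Real.exp_zero] at hlim
    obtain ⟨n, hn⟩ := (hlim.eventually (lt_mem_nhds hp1)).exists
    exact mem_iUnion.2 ⟨n, hn.le⟩
  have hi : psi k '' E = ⋃ n, psi k '' F n := by rw [← image_iUnion, hU]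
  have hmi : Monotone fun n => psi k '' F n := fun a b h => image_mono (hmono h)
  rw [← pieceMeasure_image hk hE hmE, hi, hmi.measure_iUnion, hmi.measure_iUnion]
  refine iSup_congr fun n => key _ (inter_subset_left.trans hE) ?_ (1 / (n + 1)) (by positivity)
    fun p hp => hp.2
  exact hmE.inter (measurableSet_le (by fun_prop) measurable_const)

theorem IsInducedMeasure.eq_pieceMeasure_add {m ν : Measure LatticeSpace}
    (hm : IsQuotientMeasure volMeasure m) (hν : IsInducedMeasure m ν) :
    ν = pieceMeasure 1 + pieceMeasure 2 := by
  ext A hA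
  have h1 : (1 : ℕ) = 1 ∨ (1 : ℕ) = 2 := Or.inl rfl
  have h2 : (2 : ℕ) = 1 ∨ (2 : ℕ) = 2 := Or.inr rfl
  have key : ∀ k : ℕ, k = 1 ∨ k = 2 → ν (A ∩ transversalPiece k) = pieceMeasure k A := by
    intro k hk
    rw [inter_transversalPiece hk, hν.measure_image hm hk inter_subset_right
      ((measurable_psi k hA).inter (measurableSet_coordDomain hk)), pieceMeasure_apply hA]
  rw [Measure.add_apply, ← key 1 h1, ← key 2 h2, ← measure_union
    (disjoint_transversalPiece.mono inter_subset_right inter_subset_right)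
    (hA.inter (measurableSet_transversalPiece h2)), ← inter_union_distrib_left,
    ← transversal_eq_union]
  exact (measure_inter_conull hν.null_compl).symm

end GaussLattice

end

/-! ### The theorem -/

theorem theorem4 :
    -- the volume form defines a measure on the group, which is a Haar measure
    (∃! μ : Measure GaussLattice.SL2C, GaussLattice.IsVolumeFormMeasure μ) ∧
    ∀ μ : Measure GaussLattice.SL2C, GaussLattice.IsVolumeFormMeasure μ →
      μ.IsHaarMeasure ∧
      -- it induces a measure on the space of lattices
      (∃! m : Measure GaussLattice.LatticeSpace, GaussLattice.IsQuotientMeasure μ m) ∧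
      ∀ m : Measure GaussLattice.LatticeSpace, GaussLattice.IsQuotientMeasure μ m →
        -- which, with the flow, induces a measure on the transversal
        (∃! ν : Measure GaussLattice.LatticeSpace, GaussLattice.IsInducedMeasure m ν) ∧
        ∀ ν : Measure GaussLattice.LatticeSpace, GaussLattice.IsInducedMeasure m ν →
          -- the two pieces are parametrized by the maps `Ψ_k`, and this is the density
          GaussLattice.transversal =
            GaussLattice.transversalPiece 1 ∪ GaussLattice.transversalPiece 2 ∧
          Disjoint (GaussLattice.transversalPiece 1) (GaussLattice.transversalPiece 2) ∧
          ∀ k : ℕ, k = 1 ∨ k = 2 →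
            Measurable (GaussLattice.psi k) ∧
            MeasurableSet (GaussLattice.coordDomain k) ∧
            BijOn (GaussLattice.psi k) (GaussLattice.coordDomain k)
              (GaussLattice.transversalPiece k) ∧
            ∀ E ⊆ GaussLattice.coordDomain k, MeasurableSet E →
              MeasurableSet (GaussLattice.psi k '' E) ∧
              ν (GaussLattice.psi k '' E) =
                ∫⁻ p in E, ENNReal.ofReal (32 / ‖1 - p.2.1 * p.2.2‖ ^ 4) := by

  refine ⟨⟨GaussLattice.volMeasure, GaussLattice.isVolumeFormMeasure_volMeasure,
    fun μ hμ => hμ.eq_volMeasure⟩, fun μ hμ => ?_⟩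
  obtain rfl := hμ.eq_volMeasure
  refine ⟨inferInstance, GaussLattice.existsUnique_isQuotientMeasure, fun m hm => ?_⟩
  refine ⟨⟨_, GaussLattice.isInducedMeasure_pieceMeasure_add hm,
    fun ν hν => hν.eq_pieceMeasure_add hm⟩, fun ν hν => ?_⟩
  refine ⟨GaussLattice.transversal_eq_union, GaussLattice.disjoint_transversalPiece,
    fun k hk => ⟨GaussLattice.measurable_psi k, GaussLattice.measurableSet_coordDomain hk,
      GaussLattice.bijOn_psi hk, fun E hE hm' =>
        ⟨GaussLattice.measurableSet_image_psi hk hE hm', hν.measure_image hm hk hE hm'⟩⟩⟩
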